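/- Let $\mathfrak{ham}_2^0$ be the Lie algebra of formal Hamiltonian vector fields on $\mathbb{R}^2$ (with the standard symplectic form) that vanish at the origin. Via Hamiltonian potentials it is identified with the formal power series $f\in\mathbb{R}[[q,p]]$ without constant and linear terms, i.e. with the completion of $\bigoplus_{\ell\ge 2}S^\ell$, where $S^\ell$ is the space of homogeneous polynomials of degree $\ell$ in $q,p$; the bracket is the Poisson bracket $\{f,g\}=\frac{\partial f}{\partial q}\frac{\partial g}{\partial p}-\frac{\partial f}{\partial p}\frac{\partial g}{\partial q}$. A $k$-cochain is a continuous alternating $\mathbb{R}$-multilinear form $\sigma(f_1,\dots,f_k)\in\mathbb{R}$ (for coefficientwise convergence), and $$(d\sigma)(f_0,\dots,f_k)=\sum_{i<j}(-1)^{i+j}\,\sigma(\{f_i,f_j\},\dots,\widehat{f_i},\dots,\widehat{f_j},\dots).$$ Let $C^k(\mathfrak{ham}_2^0,Sp(2,\mathbb{R}))$ be the space of relative cochains: those $\sigma$ with $i_X\sigma=0$ for all $X\in\mathfrak{sp}(2,\mathbb{R})=S^2$ and $\sigma(f_1\circ a,\dots,f_k\circ a)=\sigma(f_1,\dots,f_k)$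 for all $a\in Sp(2,\mathbb{R})$. Elements of the dual of $S^\ell$ have weight $\ell-2$, and weights add under the exterior product; so $\sigma$ has weight $w$ if it vanishes on all $f_i\in S^{\ell_i}$ with $\sum_i(\ell_i-2)\ne w$. Let $C^k_w\subset C^k(\mathfrak{ham}_2^0,Sp(2,\mathbb{R}))$ be the subspace of weight $w$. **Theorem.** The relative cochains form a cochain complex under $d$, and for every $w$ so do the subspaces $C^\bullet_w$; write $H^k_w=H^k(\mathfrak{ham}_2^0,Sp(2,\mathbb{R}))_w$ for the cohomology of the latter. The group $H^0(\mathfrak{ham}_2^0,Sp(2,\mathbb{R}))$ is one-dimensional (the constants, which have weight $0$). For $w=12,14,16,18$ all $C^k_w$ are finite-dimensional, and $\dim C^k_w$, the rank of $d\colon C^k_w\to C^{k+1}_w$ and the Betti number $\dim H^k_w$ are, for $1\le k\le 10$, as follows; all three are $0$ for $k=0$ and for $k>10$. $$\begin{array}{|c|c|rrrrrrrrrr|}\hline w & k & 1&2&3&4&5&6&7&8&9&10\\\hline 12&\dim&0&0&8&23&22&13&5&0&0&0\\ &\operatorname{rank} d&0&0&8&14&8&5&0&0&0&0\\ &\text{Betti}&0&0&0&1&0&0&0&0&0&0\\\hline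 14&\dim&0&1&6&31&71&58&15&2&1&0\\ &\operatorname{rank} d&0&1&5&26&44&14&1&1&0&0\\ &\text{Betti}&0&0&0&0&1&0&0&0&0&0\\\hline 16&\dim&0&0&12&61&126&147&95&24&0&0\\ &\operatorname{rank} d&0&0&12&49&77&70&24&0&0&0\\ &\text{Betti}&0&0&0&0&0&0&1&0&0&0\\\hline 18&\dim&0&1&10&80&262&380&268&100&21&1\\ &\operatorname{rank} d&0&1&9&71&191&188&80&20&1&0\\ &\text{Betti}&0&0&0&0&0&1&0&0&0&0\\\hline\end{array}$$ In particular, in positive degrees the only nonzero groups of these weights are $H^4_{12}$, $H^5_{14}$, $H^7_{16}$ and $H^6_{18}$, each of dimension one. -/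

import Mathlib

/-! Relative Gel'fand–Kalinin–Fuks cohomology of the Lie algebra of formal Hamiltonian vector fields
on `ℝ^{2n}` vanishing at the origin. -/

namespace GKF

open MvPowerSeries

noncomputable section

/-- Formal power series in `q^1, …, q^n` (variables `Sum.inl i`) and `p_1, …, p_n` (variables
`Sum.inr i`). -/
abbrev Series (n : ℕ) : Type := MvPowerSeries (Fin n ⊕ Fin n) ℝ

/-- The Poisson bracket `{f, g} = ∑ i, (∂f/∂q^i ∂g/∂p_i - ∂f/∂p_i ∂g/∂q^i)`. -/
def poisson {n : ℕ} (f g : Series n) : Series n :=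
  ∑ i : Fin n, (pderiv ℝ (Sum.inl i) f * pderiv ℝ (Sum.inr i) g
    - pderiv ℝ (Sum.inr i) f * pderiv ℝ (Sum.inl i) g)

/-- The linear change of variables `f ↦ f ∘ a` for a `2n × 2n` matrix `a`: each variable `x_i` is
replaced by the linear form `∑ j, a i j x_j`. -/
def compLinear {n : ℕ} (a : Matrix (Fin n ⊕ Fin n) (Fin n ⊕ Fin n) ℝ) (f : Series n) : Series n :=
  MvPowerSeries.subst
    (fun i => (∑ j, a i j • (MvPowerSeries.X j : Series n) : Series n)) f

/-- The space `ham_{2n}^0` of formal Hamiltonian vector fields on `ℝ^{2n}` vanishing at the origin,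
each given by its Hamiltonian potential, normalized to have no constant term.  The field vanishes at
the origin exactly if the potential has no linear term either, so this is the completion of
`⨁_{ℓ ≥ 2} S^ℓ`. The Lie bracket is the Poisson bracket. -/
def ham0 (n : ℕ) : Submodule ℝ (Series n) where
  carrier := {f | ∀ d : (Fin n ⊕ Fin n) →₀ ℕ, d.degree < 2 → coeff d f = 0}
  add_mem' hf hg d hd := by rw [map_add, hf d hd, hg d hd, add_zero]
  zero_mem' d _ := by simp
  smul_mem' c f hf d hd := by rw [map_smul, hf d hd, smul_zero]

theorem mem_ham0_iff {n : ℕ} {f : Series n} : f ∈ ham0 n ↔ 2 ≤ f.order := by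
  constructor
  · intro h
    exact le_order (n := 2) fun d hd => h d (by exact_mod_cast hd)
  · intro h d hd
    exact coeff_of_lt_order (lt_of_lt_of_le (by exact_mod_cast hd) h)

theorem coeff_pderiv_of_mem {n : ℕ} {f : Series n} (hf : f ∈ ham0 n) (i : Fin n ⊕ Fin n)
    {d : (Fin n ⊕ Fin n) →₀ ℕ} (hd : d.degree < 1) : coeff d (pderiv ℝ i f) = 0 := by
  rw [coeff_pderiv, hf, zero_mul]
  rw [map_add, Finsupp.degree_single]
  omega

theorem coeff_pderiv_mul_pderiv {n : ℕ} {f g : Series n} (hf : f ∈ ham0 n) (hg : g ∈ ham0 n)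
    (i j : Fin n ⊕ Fin n) {d : (Fin n ⊕ Fin n) →₀ ℕ} (hd : d.degree < 2) :
    coeff d (pderiv ℝ i f * pderiv ℝ j g) = 0 := by
  classical
  rw [coeff_mul]
  refine Finset.sum_eq_zero fun x hx => ?_
  have hx' : x.1.degree + x.2.degree = d.degree := by
    rw [← map_add, Finset.HasAntidiagonal.mem_antidiagonal.mp hx]
  by_cases h : x.1.degree < 1
  · rw [coeff_pderiv_of_mem hf i h, zero_mul]
  · rw [coeff_pderiv_of_mem hg j (by omega), mul_zero]

theorem poisson_mem {n : ℕ} {f g : Series n} (hf : f ∈ ham0 n) (hg : g ∈ ham0 n) :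
    poisson f g ∈ ham0 n := by
  refine Submodule.sum_mem _ fun i _ => Submodule.sub_mem _ ?_ ?_
  · exact fun d hd => coeff_pderiv_mul_pderiv hf hg _ _ hd
  · exact fun d hd => coeff_pderiv_mul_pderiv hf hg _ _ hd

theorem compLinear_mem {n : ℕ} (a : Matrix (Fin n ⊕ Fin n) (Fin n ⊕ Fin n) ℝ) {f : Series n}
    (hf : f ∈ ham0 n) : compLinear a f ∈ ham0 n := by
  rw [mem_ham0_iff] at hf ⊢
  have h0 : ∀ i : Fin n ⊕ Fin n,
      constantCoeff (∑ j, a i j • (MvPowerSeries.X j : Series n) : Series n) = 0 := by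
    intro i
    rw [map_sum]
    refine Finset.sum_eq_zero fun j _ => ?_
    rw [smul_eq_C_mul, map_mul, constantCoeff_X, mul_zero]
  refine le_trans ?_ (le_order_subst (hasSubst_of_constantCoeff_zero h0) f)
  have h1 : (1 : ℕ∞) ≤ ⨅ i : Fin n ⊕ Fin n,
      (∑ j, a i j • (MvPowerSeries.X j : Series n) : Series n).order :=
    le_iInf fun i => one_le_order_iff_constCoeff_eq_zero.mpr (h0 i)
  calc (2 : ℕ∞) = 1 * 2 := by norm_num
    _ ≤ _ := mul_le_mul' h1 hf

/-- The Lie bracket of `ham_{2n}^0`. -/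
def bracket {n : ℕ} (f g : ham0 n) : ham0 n :=
  ⟨poisson (f : Series n) (g : Series n), poisson_mem f.2 g.2⟩

/-- The substitution `f ↦ f ∘ a` on `ham_{2n}^0`. -/
def compSp {n : ℕ} (a : Matrix (Fin n ⊕ Fin n) (Fin n ⊕ Fin n) ℝ) (f : ham0 n) : ham0 n :=
  ⟨compLinear a (f : Series n), compLinear_mem a f.2⟩

/-- `f` is a homogeneous polynomial of degree `l`, that is, an element of `S^l`. -/
def IsHom {n : ℕ} (f : ham0 n) (l : ℕ) : Prop :=
  MvPowerSeries.IsHomogeneous (f : Series n) l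

/-- Real-valued functions of `k` elements of `ham_{2n}^0`; the cochains are found among them. -/
abbrev Fun (n k : ℕ) : Type := (Fin k → ham0 n) → ℝ

section Topology

open scoped MvPowerSeries.WithPiTopology

/-- The `k`-cochains: continuous alternating `ℝ`-multilinear forms in `k` elements of `ham_{2n}^0`,
where power series carry the topology of coefficientwise convergence. -/
def cochains (n k : ℕ) : Submodule ℝ (Fun n k) where
  carrier := {σ | ∃ τ : (ham0 n) [⋀^Fin k]→L[ℝ] ℝ, ∀ f, τ f = σ f}
  add_mem' := by
    rintro σ σ' ⟨τ, h⟩ ⟨τ', h'⟩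
    exact ⟨τ + τ', fun f => by simp [h, h']⟩
  zero_mem' := ⟨0, fun f => by simp⟩
  smul_mem' := by
    rintro c σ ⟨τ, h⟩
    exact ⟨c • τ, fun f => by simp [h]⟩

end Topology

/-- The coboundary operator
`(d σ)(f_0, …, f_k) = ∑_{i < j} (-1)^{i+j} σ({f_i, f_j}, …, f̂_i, …, f̂_j, …)`.
It vanishes on `0`-cochains, where the sum is empty. In the code `i < j` is taken in `Fin (m + 1)`,
which loses nothing since the last index cannot be the smaller one; removing first `f_j` and then
`f_i` leaves the other arguments in their order. -/
def coboundary (n : ℕ) : (k : ℕ) → Fun n k →ₗ[ℝ] Fun n (k + 1)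
  | 0 => 0
  | m + 1 =>
    { toFun := fun σ f =>
        ∑ j : Fin (m + 2), ∑ i : Fin (m + 1),
          if i.castSucc < j then
            (-1 : ℝ) ^ ((i : ℕ) + (j : ℕ)) *
              σ (Fin.cons (bracket (f i.castSucc) (f j)) (i.removeNth (j.removeNth f)))
          else 0
      map_add' := by
        intro σ τ
        funext f
        simp only [Pi.add_apply, ← Finset.sum_add_distrib]
        refine Finset.sum_congr rfl fun j _ => Finset.sum_congr rfl fun i _ => ?_
        split_ifs <;> ring
      map_smul' := by
        intro c σ
        funext f
        simp only [Pi.smul_apply, smul_eq_mul, RingHom.id_apply, Finset.mul_sum]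
        refine Finset.sum_congr rfl fun j _ => Finset.sum_congr rfl fun i _ => ?_
        split_ifs <;> ring }

/-- The relative cochains `C^k(ham_{2n}^0, Sp(2n, ℝ))`: the cochains `σ` such that
* `i_X σ = 0` for all `X` in `sp(2n, ℝ) = S^2` (`σ` being alternating, `X` may stand in any place);
* `σ` is invariant under the action `(a · σ)(f_1, …, f_k) = σ(f_1 ∘ a, …, f_k ∘ a)`
  of `Sp(2n, ℝ)`. -/
def relCochains (n k : ℕ) : Submodule ℝ (Fun n k) where
  carrier := {σ | σ ∈ cochains n k ∧
    (∀ (f : Fin k → ham0 n) (i : Fin k), IsHom (f i) 2 → σ f = 0) ∧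
    (∀ a ∈ Matrix.symplecticGroup (Fin n) ℝ, ∀ f : Fin k → ham0 n,
      σ (fun i => compSp a (f i)) = σ f)}
  add_mem' := by
    rintro σ τ ⟨h1, h2, h3⟩ ⟨h1', h2', h3'⟩
    refine ⟨Submodule.add_mem _ h1 h1', fun f i hi => ?_, fun a ha f => ?_⟩
    · rw [Pi.add_apply, h2 f i hi, h2' f i hi, add_zero]
    · rw [Pi.add_apply, Pi.add_apply, h3 a ha f, h3' a ha f]
  zero_mem' := ⟨Submodule.zero_mem _, fun _ _ _ => rfl, fun _ _ _ => rfl⟩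
  smul_mem' := by
    rintro c σ ⟨h1, h2, h3⟩
    refine ⟨Submodule.smul_mem _ c h1, fun f i hi => ?_, fun a ha f => ?_⟩
    · rw [Pi.smul_apply, h2 f i hi, smul_zero]
    · rw [Pi.smul_apply, Pi.smul_apply, h3 a ha f]

/-- The functions of weight `w`. The dual of `S^l` has weight `l - 2`, and weights add under the
exterior product. So a cochain has weight `w`, i.e. lies in the sum of the
`Λ^{k_2} (S^2)^* ⊗ Λ^{k_3} (S^3)^* ⊗ ⋯` with `∑ (j - 2) k_j = w`, exactly if it vanishes on
all homogeneous arguments `f_i ∈ S^{l_i}` with `∑ (l_i - 2) ≠ w`. -/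
def ofWeight (n : ℕ) (w : ℤ) (k : ℕ) : Submodule ℝ (Fun n k) where
  carrier := {σ | ∀ (f : Fin k → ham0 n) (l : Fin k → ℕ), (∀ i, IsHom (f i) (l i)) →
    ∑ i, ((l i : ℤ) - 2) ≠ w → σ f = 0}
  add_mem' := by
    intro σ τ h h' f l hf hl
    rw [Pi.add_apply, h f l hf hl, h' f l hf hl, add_zero]
  zero_mem' := fun _ _ _ _ => rfl
  smul_mem' := by
    intro c σ h f l hf hl
    rw [Pi.smul_apply, h f l hf hl, smul_zero]

/-- The relative `k`-cochains of weight `w`, `C^k(ham_{2n}^0, Sp(2n, ℝ))_w`. -/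
def relCochainsOfWeight (n : ℕ) (w : ℤ) (k : ℕ) : Submodule ℝ (Fun n k) :=
  relCochains n k ⊓ ofWeight n w k

/-- The cocycles of degree `k` in a family of spaces `C k` stable under `d`. -/
def cocycles {n : ℕ} (C : (k : ℕ) → Submodule ℝ (Fun n k)) (k : ℕ) : Submodule ℝ (Fun n k) :=
  C k ⊓ LinearMap.ker (coboundary n k)

/-- The coboundaries of degree `k`: the image of `C (k - 1)` under `d`, or `0` if `k = 0`. -/
def coboundaries {n : ℕ} (C : (k : ℕ) → Submodule ℝ (Fun n k)) :
    (k : ℕ) → Submodule ℝ (Fun n k)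
  | 0 => ⊥
  | m + 1 => (C m).map (coboundary n m)

/-- The cohomology `H^k` of `C`: cocycles modulo coboundaries. -/
abbrev Cohomology {n : ℕ} (C : (k : ℕ) → Submodule ℝ (Fun n k)) (k : ℕ) : Type :=
  cocycles C k ⧸ (coboundaries C k).submoduleOf (cocycles C k)

/-- `C` is a subcomplex: `d` maps `C k` into `C (k + 1)`, and `d ∘ d = 0` on `C`. -/
def IsComplex {n : ℕ} (C : (k : ℕ) → Submodule ℝ (Fun n k)) : Prop :=
  ∀ k, ∀ σ ∈ C k, coboundary n k σ ∈ C (k + 1) ∧ coboundary n (k + 1) (coboundary n k σ) = 0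

/-- For every degree `k`, the space `C k` is finite-dimensional, and `dim C k`, the rank of
`d : C k → C (k + 1)` and `dim H^k` are the entries number `k` (counted from `0`) of the lists
`dims`, `ranks` and `bettis`, and they are `0` beyond the end of the list. -/
def HasTable {n : ℕ} (C : (k : ℕ) → Submodule ℝ (Fun n k)) (dims ranks bettis : List ℕ) : Prop :=
  ∀ k : ℕ, Module.Finite ℝ (C k) ∧
    Module.finrank ℝ (C k) = dims.getD k 0 ∧
    Module.finrank ℝ ((C k).map (coboundary n k)) = ranks.getD k 0 ∧
    Module.finrank ℝ (Cohomology C k) = bettis.getD k 0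

end

end GKF

/-!
The theorem has an algebraic part, which identifies the complex and computes the dimensions of its
cochain spaces, and a computational part, which bounds the spaces of cocycles.

*Relative cochains.* A continuous alternating form is determined by its values on the monomials
`q^i p^j` (`eq_zero_of_mono`). Invariance under `Sp(2, ℝ) = SL(2, ℝ)`, which is generated by the two
families of shears, is equivalent to the vanishing of the Lie derivatives along `q² / 2` and
`-p² / 2` (`mem_relCochains_iff`): along a shear the value of a form on monomials is a polynomial
whose derivative is given by the Lie derivative. Then Cartan's formula `L_X = ± (d ι_X + ι_X d)`
shows that `d` preserves the relative cochains and that `d² = 0`.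

*Dimensions.* Let `W_t` be the space of cochains of weight `w` that vanish on `S^2` and on which the
diagonal torus acts with weight `t`; a basis is given by the sets of `k` monomials with the right
total degrees in `q` and `p`. The relative cochains are the kernel of the raising operator
`W_0 → W_2`, which is onto by the representation theory of `sl(2)`; hence
`dim C^k_w = dim W_0 - dim W_2` (`finrank_relCochainsOfWeight`), a difference of two coefficients of
a generating function, which is computed as a table of numbers in a large base
(`dimsFrom_fullTable`).

*Ranks.* From `rank d_(k-1) + rank d_k ≤ dim C^k` it follows that lower bounds for the ranks which
differ from the dimensions only at one isolated degree `k` are sharp (`hasTable_of_le`). So it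
suffices to bound the dimension of the cocycles in `C^k` by `dim C^k - rank d_k` from above
(`finrank_cocycles_le`), that is, to find so many values of a cocycle that it vanishes as soon as
these do. This can be tested modulo a prime: the values on monomials of a nonzero cocycle generate a
free abelian group of finite rank, and some coordinate modulo `8191` does not vanish identically
(`exists_addMonoidHom_ne_zero`), while the invariance and the cocycle condition are equations with
integral coefficients. Modulo `8191` the invariance is used to express all values through those at
lists which contain a power of `q` and a power of `p` (`straighten_rep`, `mem_bases`), and for the
latter a system of linear equations, one for each unknown, is solved by elimination
(`eq_zero_of_check`). The tables in the theorems `check_w_k` only say which values are prescribed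
and which equations are used.

The functions that are evaluated by the kernel are written with recursors and `Nat` operations.
Lists of monomials are encoded as numbers in base `1024`, and linear forms in up to `512` unknowns
as numbers in base `2^40`, so that one operation on big numbers acts on all coefficients.
-/

namespace GKF

open MvPowerSeries
open scoped MvPowerSeries.WithPiTopology

noncomputable section

/-! ### The bracket of `ham_2^0` -/

theorem poisson_one (f g : Series 1) : poisson f g =
    pderiv ℝ (Sum.inl 0) f * pderiv ℝ (Sum.inr 0) g
      - pderiv ℝ (Sum.inr 0) f * pderiv ℝ (Sum.inl 0) g := by
  simp [poisson]

theorem bracket_add_left (f g h : ham0 1) : bracket (f + g) h = bracket f h + bracket g h := by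
  ext1
  simp only [bracket, poisson_one, Submodule.coe_add, map_add]
  ring

theorem bracket_skew (f g : ham0 1) : bracket f g = -bracket g f := by
  ext1
  simp only [bracket, poisson_one, Submodule.coe_neg]
  ring

theorem bracket_smul_left (c : ℝ) (f h : ham0 1) : bracket (c • f) h = c • bracket f h := by
  ext1
  simp only [bracket, poisson_one, Submodule.coe_smul, Derivation.map_smul, smul_sub,
    smul_mul_assoc]

theorem bracket_add_right (f g h : ham0 1) : bracket f (g + h) = bracket f g + bracket f h := by
  rw [bracket_skew, bracket_add_left, bracket_skew g, bracket_skew h, neg_add, neg_neg, neg_neg]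

theorem bracket_smul_right (c : ℝ) (f h : ham0 1) : bracket f (c • h) = c • bracket f h := by
  rw [bracket_skew, bracket_smul_left, bracket_skew h, smul_neg, neg_neg]

theorem bracket_self (f : ham0 1) : bracket f f = 0 := by
  ext1
  simp only [bracket, poisson_one, Submodule.coe_zero]
  ring

theorem pderiv_comm (i j : Fin 1 ⊕ Fin 1) (f : Series 1) :
    pderiv ℝ i (pderiv ℝ j f) = pderiv ℝ j (pderiv ℝ i f) := by
  ext d
  simp only [coeff_pderiv, Finsupp.add_apply]
  rw [add_right_comm]
  by_cases h : i = j
  · subst h; rfl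
  · rw [Finsupp.single_eq_of_ne (Ne.symm h), Finsupp.single_eq_of_ne h]
    push_cast
    ring

theorem bracket_jacobi (f g h : ham0 1) :
    bracket (bracket f g) h = bracket f (bracket g h) - bracket g (bracket f h) := by
  ext1
  simp only [bracket, poisson_one, Submodule.coe_sub, map_sub, Derivation.leibniz, smul_eq_mul]
  rw [pderiv_comm (Sum.inr 0) (Sum.inl 0) f, pderiv_comm (Sum.inr 0) (Sum.inl 0) g,
    pderiv_comm (Sum.inr 0) (Sum.inl 0) h]
  ring

/-- The bracket with a fixed element, as a linear map. -/
def ad (X : ham0 1) : ham0 1 →ₗ[ℝ] ham0 1 where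
  toFun := bracket X
  map_add' := bracket_add_right X
  map_smul' c := bracket_smul_right c X

@[simp] theorem ad_apply (X Y : ham0 1) : ad X Y = bracket X Y := rfl

/-! ### Cartan calculus -/

/-- The contraction `ι_X σ = σ(X, ·)`. -/
def contract {k : ℕ} (X : ham0 1) (σ : Fun 1 (k + 1)) : Fun 1 k := fun f => σ (Fin.cons X f)

/-- The Lie derivative `(L_X σ)(f_1, …, f_k) = ∑ j, σ(f_1, …, {X, f_j}, …, f_k)`, with the sign
that spares minus signs in the formulas for homogeneous polynomials. -/
def lieD {k : ℕ} (X : ham0 1) (σ : Fun 1 k) : Fun 1 k :=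
  fun f => ∑ j, σ (Function.update f j (bracket X (f j)))

theorem contract_add {k : ℕ} (X : ham0 1) (σ τ : Fun 1 (k + 1)) :
    contract X (σ + τ) = contract X σ + contract X τ := rfl

theorem contract_sub {k : ℕ} (X : ham0 1) (σ τ : Fun 1 (k + 1)) :
    contract X (σ - τ) = contract X σ - contract X τ := rfl

theorem contract_neg {k : ℕ} (X : ham0 1) (σ : Fun 1 (k + 1)) :
    contract X (-σ) = -contract X σ := rfl

theorem lieD_add {k : ℕ} (X : ham0 1) (σ τ : Fun 1 k) :
    lieD X (σ + τ) = lieD X σ + lieD X τ := by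
  funext f; simp [lieD, Finset.sum_add_distrib]

theorem lieD_sub {k : ℕ} (X : ham0 1) (σ τ : Fun 1 k) :
    lieD X (σ - τ) = lieD X σ - lieD X τ := by
  funext f; simp [lieD, Finset.sum_sub_distrib]

theorem lieD_neg {k : ℕ} (X : ham0 1) (σ : Fun 1 k) : lieD X (-σ) = -lieD X σ := by
  funext f; simp [lieD]

theorem lieD_smul {k : ℕ} (X : ham0 1) (c : ℝ) (σ : Fun 1 k) : lieD X (c • σ) = c • lieD X σ := by
  funext f; simp [lieD, Finset.mul_sum]

theorem lieD_zero {k : ℕ} (X : ham0 1) : lieD X (0 : Fun 1 k) = 0 := by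
  funext f; simp [lieD]

theorem contract_ext {k : ℕ} {σ τ : Fun 1 (k + 1)} (h : ∀ X, contract X σ = contract X τ) :
    σ = τ := by
  funext f
  rw [← Fin.cons_self_tail f]
  exact congrFun (h (f 0)) (Fin.tail f)

/-- The commutator of contraction and Lie derivative; read as a recursion, it determines the Lie
derivative. -/
theorem contract_lieD {k : ℕ} (X Z : ham0 1) (σ : Fun 1 (k + 1)) :
    contract Z (lieD X σ) = lieD X (contract Z σ) + contract (bracket X Z) σ := by
  funext f
  simp only [contract, lieD, Fin.sum_univ_succ, Pi.add_apply, Fin.cons_zero, Fin.cons_succ,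
    Fin.cons_update, Fin.update_cons_zero]
  ring

/-- `σ` is an alternating multilinear form, expressed by recursion on the number of arguments. -/
def IsAlt : (k : ℕ) → Fun 1 k → Prop
  | 0, _ => True
  | k + 1, σ => (∀ Z, IsAlt k (contract Z σ)) ∧
      (∀ Y Z, contract (Y + Z) σ = contract Y σ + contract Z σ) ∧
      (∀ (c : ℝ) (Z), contract (c • Z) σ = c • contract Z σ) ∧
      ∀ (f : Fin k → ham0 1) (j : Fin k), contract (f j) σ f = 0

theorem isAlt_alternatingMap : ∀ {k : ℕ} (τ : (ham0 1) [⋀^Fin k]→ₗ[ℝ] ℝ), IsAlt k τ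
  | 0, _ => trivial
  | k + 1, τ => by
    refine ⟨fun Z => isAlt_alternatingMap (τ.curryLeft Z), fun Y Z => ?_, fun c Z => ?_,
      fun f j => ?_⟩
    · exact congrArg DFunLike.coe (τ.curryLeft.map_add Y Z)
    · exact congrArg DFunLike.coe (τ.curryLeft.map_smul c Z)
    · exact τ.map_eq_zero_of_eq (i := 0) (j := j.succ) _ (by simp) (Fin.succ_ne_zero j).symm

theorem IsAlt.exists_alternatingMap : ∀ {k : ℕ} {σ : Fun 1 k}, IsAlt k σ →
    ∃ τ : (ham0 1) [⋀^Fin k]→ₗ[ℝ] ℝ, ⇑τ = σ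
  | 0, σ, _ => ⟨AlternatingMap.constOfIsEmpty ℝ (ham0 1) (Fin 0) (σ default), by
      funext f; simp [Subsingleton.elim f default]⟩
  | k + 1, σ, ⟨h1, h2, h3, h4⟩ => by
    choose τ hτ using fun Z => (h1 Z).exists_alternatingMap
    have e : ∀ f, σ f = τ (f 0) (Fin.tail f) := fun f => by
      rw [hτ, contract, Fin.cons_self_tail]
    refine ⟨{ toFun := σ
              map_update_add' := ?_
              map_update_smul' := ?_
              map_eq_zero_of_eq' := ?_ }, rfl⟩
    · intro dec f i x y
      obtain rfl : dec = instDecidableEqFin _ := Subsingleton.elim _ _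
      refine Fin.cases ?_ (fun i => ?_) i
      · simp only [e, Function.update_self, Fin.tail_update_zero]
        simp only [hτ, h2, Pi.add_apply]
      · have h0 : ∀ v, Function.update f i.succ v 0 = f 0 := fun v =>
          Function.update_of_ne (Fin.succ_ne_zero i).symm v f
        simp only [e, h0, Fin.tail_update_succ, AlternatingMap.map_update_add]
    · intro dec f i c x
      obtain rfl : dec = instDecidableEqFin _ := Subsingleton.elim _ _
      refine Fin.cases ?_ (fun i => ?_) i
      · simp only [e, Function.update_self, Fin.tail_update_zero]
        simp only [hτ, h3, Pi.smul_apply]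
      · have h0 : ∀ v, Function.update f i.succ v 0 = f 0 := fun v =>
          Function.update_of_ne (Fin.succ_ne_zero i).symm v f
        simp only [e, h0, Fin.tail_update_succ, AlternatingMap.map_update_smul]
    · intro f i j hij hne
      have key : ∀ j : Fin k, f 0 = f j.succ → σ f = 0 := fun j hj => by
        have := h4 (Fin.tail f) j
        rwa [Fin.tail, ← hj, contract, Fin.cons_self_tail] at this
      induction i using Fin.cases with
      | zero =>
        induction j using Fin.cases with
        | zero => exact absurd rfl hne
        | succ j => exact key j hij
      | succ i =>
        induction j using Fin.cases with
        | zero => exact key i hij.symm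
        | succ j =>
          rw [e]
          exact (τ (f 0)).map_eq_zero_of_eq (Fin.tail f) hij fun h => hne (congrArg _ h)

theorem IsAlt.neg : ∀ {k : ℕ} {σ : Fun 1 k}, IsAlt k σ → IsAlt k (-σ) := fun h => by
  obtain ⟨τ, rfl⟩ := h.exists_alternatingMap
  exact isAlt_alternatingMap (-τ)

theorem IsAlt.add {k : ℕ} {σ τ : Fun 1 k} (h : IsAlt k σ) (h' : IsAlt k τ) : IsAlt k (σ + τ) := by
  obtain ⟨a, rfl⟩ := h.exists_alternatingMap
  obtain ⟨b, rfl⟩ := h'.exists_alternatingMap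
  exact isAlt_alternatingMap (a + b)

theorem IsAlt.sub {k : ℕ} {σ τ : Fun 1 k} (h : IsAlt k σ) (h' : IsAlt k τ) : IsAlt k (σ - τ) := by
  rw [sub_eq_add_neg]; exact h.add h'.neg

theorem IsAlt.contract {k : ℕ} {σ : Fun 1 (k + 1)} (h : IsAlt (k + 1) σ) (Z : ham0 1) :
    IsAlt k (contract Z σ) := h.1 Z

theorem IsAlt.contract_contract_self {k : ℕ} {σ : Fun 1 (k + 2)} (h : IsAlt (k + 2) σ)
    (Z : ham0 1) :
    GKF.contract Z (GKF.contract Z σ) = 0 := by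
  funext f
  exact h.2.2.2 (Fin.cons Z f) 0

theorem IsAlt.contract_contract {k : ℕ} {σ : Fun 1 (k + 2)} (h : IsAlt (k + 2) σ) (Y Z : ham0 1) :
    GKF.contract Y (GKF.contract Z σ) = -GKF.contract Z (GKF.contract Y σ) := by
  have h1 := h.contract_contract_self (Y + Z)
  rw [h.2.1, contract_add, (h.1 Y).2.1, (h.1 Z).2.1, h.contract_contract_self Y,
    h.contract_contract_self Z, zero_add, add_zero] at h1
  rw [eq_neg_iff_add_eq_zero]
  rw [add_comm] at h1
  exact h1

/-- A recursive criterion: the vanishing on equal arguments need only be known for the first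
two. -/
theorem isAlt_of_contract {k : ℕ} {σ : Fun 1 (k + 1)} (h1 : ∀ Z, IsAlt k (contract Z σ))
    (h2 : ∀ Y Z, contract (Y + Z) σ = contract Y σ + contract Z σ)
    (h3 : ∀ (c : ℝ) (Z), contract (c • Z) σ = c • contract Z σ)
    (h4 : ∀ Z (f : Fin k → ham0 1) (j : Fin k), (j : ℕ) = 0 → f j = Z → contract Z σ f = 0) :
    IsAlt (k + 1) σ := by
  refine ⟨h1, h2, h3, fun f j => ?_⟩
  obtain ⟨τ, hτ⟩ := (h1 (f j)).exists_alternatingMap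
  by_cases hj : (j : ℕ) = 0
  · exact h4 _ f j hj rfl
  · have hk : 0 < k := by have := j.2; omega
    have h0 := h4 (f j) (f ∘ Equiv.swap ⟨0, hk⟩ j) ⟨0, hk⟩ rfl (by simp)
    rw [← hτ] at h0 ⊢
    rwa [τ.map_swap f (fun h => hj (by rw [← h])), neg_eq_zero] at h0

theorem IsAlt.lieD : ∀ {k : ℕ} {σ : Fun 1 k}, IsAlt k σ → ∀ X, IsAlt k (lieD X σ)
  | 0, _, _, _ => trivial
  | k + 1, σ, h, X => by
    refine isAlt_of_contract (fun Z => ?_) (fun Y Z => ?_) (fun c Z => ?_) ?_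
    · rw [contract_lieD]
      exact ((h.1 Z).lieD X).add (h.1 _)
    · simp only [contract_lieD, bracket_add_right, h.2.1, lieD_add]
      abel
    · simp only [contract_lieD, bracket_smul_right, h.2.2.1, lieD_smul, smul_add]
    · intro Z f j hj hfj
      obtain ⟨m, rfl⟩ : ∃ m, k = m + 1 := ⟨k - 1, by have := j.2; omega⟩
      obtain rfl : j = 0 := Fin.ext hj
      have : GKF.contract Z (GKF.contract Z (GKF.lieD X σ)) = 0 := by
        rw [contract_lieD, contract_add, contract_lieD, h.contract_contract_self, lieD_zero,
          zero_add, h.contract_contract Z, add_neg_cancel]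
      have h5 := congrFun this (Fin.tail f)
      subst hfj
      rw [GKF.contract, Fin.cons_self_tail] at h5
      exact h5

/-- With the sign chosen for it, the Lie derivative reverses brackets. -/
theorem lieD_lieD : ∀ {k : ℕ} {σ : Fun 1 k}, IsAlt k σ → ∀ X Y,
    lieD X (lieD Y σ) = lieD Y (lieD X σ) - lieD (bracket X Y) σ
  | 0, σ, _, X, Y => by funext f; simp [lieD]
  | k + 1, σ, h, X, Y => by
    refine contract_ext fun Z => ?_
    have hj : contract (bracket (bracket X Y) Z) σ =
        contract (bracket X (bracket Y Z)) σ - contract (bracket Y (bracket X Z)) σ := by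
      rw [bracket_jacobi, sub_eq_add_neg, h.2.1, ← neg_one_smul ℝ, h.2.2.1, neg_one_smul,
        sub_eq_add_neg]
    simp only [contract_sub, contract_lieD, lieD_add, lieD_lieD (h.1 Z) X Y, hj]
    abel

theorem coboundary_zero_eq (σ : Fun 1 0) : coboundary 1 0 σ = 0 := rfl

theorem coboundary_succ_apply {m : ℕ} (σ : Fun 1 (m + 1)) (f : Fin (m + 2) → ham0 1) :
    coboundary 1 (m + 1) σ f = ∑ j : Fin (m + 2), ∑ i : Fin (m + 1),
      if i.castSucc < j then (-1 : ℝ) ^ ((i : ℕ) + (j : ℕ)) *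
        σ (Fin.cons (bracket (f i.castSucc) (f j)) (i.removeNth (j.removeNth f))) else 0 := rfl

/-- Moving an argument to the front costs the sign of a cycle. -/
theorem IsAlt.map_cons_removeNth {k : ℕ} {σ : Fun 1 (k + 1)} (h : IsAlt (k + 1) σ)
    (g : Fin (k + 1) → ham0 1) (j : Fin (k + 1)) (v : ham0 1) :
    σ (Fin.cons v (j.removeNth g)) = (-1 : ℝ) ^ (j : ℕ) * σ (Function.update g j v) := by
  obtain ⟨τ, rfl⟩ := h.exists_alternatingMap
  have := τ.map_insertNth j v (j.removeNth g)
  rw [Fin.insertNth_removeNth] at this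
  rw [this, zsmul_eq_mul, ← mul_assoc]
  push_cast
  rw [← mul_pow]
  norm_num
  rfl

/-- Cartan's formula. -/
theorem contract_coboundary {k : ℕ} {σ : Fun 1 (k + 1)} (h : IsAlt (k + 1) σ) (X : ham0 1) :
    contract X (coboundary 1 (k + 1) σ) = -lieD X σ - coboundary 1 k (contract X σ) := by
  funext g
  simp only [contract, coboundary_succ_apply]
  rw [Fin.sum_univ_succ]
  simp only [Fin.not_lt_zero, if_false, Finset.sum_const_zero, zero_add]
  have e1 : ∀ j : Fin (k + 1), (∑ i : Fin (k + 1), if i.castSucc < j.succ then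
      (-1 : ℝ) ^ ((i : ℕ) + (j.succ : ℕ)) *
        σ (Fin.cons (bracket ((Fin.cons X g : Fin (k + 2) → ham0 1) i.castSucc)
          ((Fin.cons X g : Fin (k + 2) → ham0 1) j.succ))
            (i.removeNth (j.succ.removeNth (Fin.cons X g : Fin (k + 2) → ham0 1)))) else 0)
      = - σ (Function.update g j (bracket X (g j))) +
        ∑ i : Fin k, if i.castSucc < j then (-1 : ℝ) ^ ((i : ℕ) + (j : ℕ)) *
          σ (Fin.cons (bracket (g i.castSucc) (g j)) (i.succ.removeNth
            (j.succ.removeNth (Fin.cons X g : Fin (k + 2) → ham0 1)))) else 0 := by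
    intro j
    rw [Fin.sum_univ_succ]
    congr 1
    · have hr : Fin.removeNth 0 (j.succ.removeNth (Fin.cons X g : Fin (k + 2) → ham0 1)) =
          j.removeNth g := by
        funext i
        simp [Fin.removeNth]
      rw [if_pos (by simp)]
      simp only [Fin.castSucc_zero, Fin.cons_zero, Fin.cons_succ, hr, h.map_cons_removeNth]
      rw [← mul_assoc, ← pow_add]
      have : (-1 : ℝ) ^ (((0 : Fin (k + 1)) : ℕ) + (j.succ : ℕ) + (j : ℕ)) = -1 := by
        apply Odd.neg_one_pow
        simp only [Fin.val_zero, Fin.val_succ]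
        exact ⟨j, by ring⟩
      rw [this]; ring
    · refine Finset.sum_congr rfl fun i _ => ?_
      simp only [← Fin.succ_castSucc, Fin.succ_lt_succ_iff, Fin.cons_succ, Fin.val_succ]
      congr 2
      rw [show (i : ℕ) + 1 + ((j : ℕ) + 1) = i + j + 2 by ring, pow_add]
      norm_num
  rw [Finset.sum_congr rfl fun j _ => e1 j, Finset.sum_add_distrib, Finset.sum_neg_distrib]
  simp only [Pi.sub_apply, Pi.neg_apply, lieD, sub_eq_add_neg]
  congr 1
  cases k with
  | zero => simp [coboundary]
  | succ k =>
    rw [coboundary_succ_apply, ← Finset.sum_neg_distrib]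
    refine Finset.sum_congr rfl fun j _ => ?_
    rw [← Finset.sum_neg_distrib]
    refine Finset.sum_congr rfl fun i _ => ?_
    split_ifs with hij
    · have hr : i.succ.removeNth (j.succ.removeNth (Fin.cons X g : Fin (k + 3) → ham0 1)) =
          Fin.cons X (i.removeNth (j.removeNth g)) := by
        funext s
        refine Fin.cases ?_ (fun s => ?_) s
        · simp [Fin.removeNth]
        · simp [Fin.removeNth, Fin.succ_succAbove_succ]
      rw [hr]
      have := congrFun (h.contract_contract (bracket (g i.castSucc) (g j)) X)
        (i.removeNth (j.removeNth g))
      simp only [contract, Pi.neg_apply] at this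
      rw [← neg_eq_iff_eq_neg] at this
      rw [← this, contract]
      ring
    · simp

theorem IsAlt.coboundary : ∀ {k : ℕ} {σ : Fun 1 k}, IsAlt k σ → IsAlt (k + 1) (coboundary 1 k σ)
  | 0, σ, _ => by
    rw [coboundary_zero_eq]
    exact isAlt_alternatingMap 0
  | k + 1, σ, h => by
    have hl : ∀ Y Z, GKF.lieD (Y + Z) σ = GKF.lieD Y σ + GKF.lieD Z σ := fun Y Z => by
      obtain ⟨τ, rfl⟩ := h.exists_alternatingMap
      funext f
      simp [GKF.lieD, bracket_add_left, Finset.sum_add_distrib]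
    have hs : ∀ (c : ℝ) Z, GKF.lieD (c • Z) σ = c • GKF.lieD Z σ := fun c Z => by
      obtain ⟨τ, rfl⟩ := h.exists_alternatingMap
      funext f
      simp [GKF.lieD, bracket_smul_left, Finset.mul_sum]
    refine isAlt_of_contract (fun Z => ?_) (fun Y Z => ?_) (fun c Z => ?_) ?_
    · rw [contract_coboundary h]
      exact (h.lieD Z).neg.sub (h.contract Z).coboundary
    · simp only [contract_coboundary h, h.2.1, map_add, hl]
      abel
    · simp only [contract_coboundary h, h.2.2.1, map_smul, hs, smul_sub, smul_neg]
    · intro Z f j hj hfj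
      obtain rfl : j = 0 := Fin.ext hj
      have : GKF.contract Z (GKF.contract Z (GKF.coboundary 1 (k + 1) σ)) = 0 := by
        rw [contract_coboundary h, contract_sub, contract_neg, contract_lieD, bracket_self]
        have h0 : GKF.contract 0 σ = 0 := by
          have := h.2.2.1 0 0
          rwa [zero_smul, zero_smul] at this
        rw [h0, add_zero]
        cases k with
        | zero => funext f; simp [GKF.lieD, GKF.contract, coboundary_zero_eq]
        | succ k =>
          rw [contract_coboundary (h.contract Z), h.contract_contract_self, map_zero]
          abel
      have h5 := congrFun this (Fin.tail f)
      subst hfj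
      rw [GKF.contract, Fin.cons_self_tail] at h5
      exact h5

theorem lieD_coboundary : ∀ {k : ℕ} {σ : Fun 1 k}, IsAlt k σ → ∀ X,
    lieD X (coboundary 1 k σ) = coboundary 1 k (lieD X σ)
  | 0, σ, _, X => by rw [coboundary_zero_eq, coboundary_zero_eq, lieD_zero]
  | k + 1, σ, h, X => by
    refine contract_ext fun Z => ?_
    rw [contract_lieD, contract_coboundary h, contract_coboundary h, contract_coboundary (h.lieD X),
      contract_lieD, lieD_sub, lieD_neg, lieD_coboundary (h.contract Z) X, lieD_lieD h X Z, map_add]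
    abel

theorem coboundary_coboundary : ∀ {k : ℕ} {σ : Fun 1 k}, IsAlt k σ →
    coboundary 1 (k + 1) (coboundary 1 k σ) = 0
  | 0, σ, _ => by rw [coboundary_zero_eq, map_zero]
  | k + 1, σ, h => by
    refine contract_ext fun Z => ?_
    rw [contract_coboundary h.coboundary, contract_coboundary h, map_sub, map_neg,
      lieD_coboundary h, coboundary_coboundary (h.contract Z)]
    funext f
    simp [contract]

/-! ### Monomials -/

/-- The exponent of the monomial `q^i p^j`. -/
def expo (i j : ℕ) : (Fin 1 ⊕ Fin 1) →₀ ℕ :=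
  Finsupp.single (Sum.inl 0) i + Finsupp.single (Sum.inr 0) j

@[simp] theorem expo_inl (i j : ℕ) : expo i j (Sum.inl 0) = i := by simp [expo]

@[simp] theorem expo_inr (i j : ℕ) : expo i j (Sum.inr 0) = j := by simp [expo]

theorem expo_apply (d : (Fin 1 ⊕ Fin 1) →₀ ℕ) : expo (d (Sum.inl 0)) (d (Sum.inr 0)) = d := by
  ext x
  rcases x with x | x <;> obtain rfl := Subsingleton.elim x 0 <;> simp

theorem expo_degree (i j : ℕ) : (expo i j).degree = i + j := by
  simp [expo, map_add, Finsupp.degree_single]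

theorem expo_add (i j i' j' : ℕ) : expo i j + expo i' j' = expo (i + i') (j + j') := by
  simp only [expo, Finsupp.single_add]; abel

theorem expo_inj {i j i' j' : ℕ} : expo i j = expo i' j' ↔ i = i' ∧ j = j' := by
  refine ⟨fun h => ⟨?_, ?_⟩, fun ⟨h, h'⟩ => by rw [h, h']⟩
  · simpa using DFunLike.congr_fun h (Sum.inl 0)
  · simpa using DFunLike.congr_fun h (Sum.inr 0)

/-- The monomial `q^i p^j` as an element of `ham_2^0`, with value `0` if its degree is below `2`. -/
def mono (i j : ℕ) : ham0 1 :=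
  if h : 2 ≤ i + j then
    ⟨monomial (expo i j) 1, fun d hd => by
      classical
      rw [coeff_monomial, if_neg]
      rintro rfl
      rw [expo_degree] at hd
      omega⟩
  else 0

theorem coe_mono {i j : ℕ} (h : 2 ≤ i + j) : (mono i j : Series 1) = monomial (expo i j) 1 := by
  rw [mono, dif_pos h]

theorem mono_of_lt {i j : ℕ} (h : i + j < 2) : mono i j = 0 := by
  rw [mono, dif_neg (by omega)]

theorem coeff_mono {i j : ℕ} (h : 2 ≤ i + j) (i' j' : ℕ) :
    coeff (expo i' j') (mono i j : Series 1) = if i' = i ∧ j' = j then 1 else 0 := by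
  classical
  rw [coe_mono h, coeff_monomial]
  simp only [expo_inj]

theorem isHom_mono (i j : ℕ) : IsHom (mono i j) (i + j) := by
  classical
  by_cases h : 2 ≤ i + j
  · intro hd
    rename_i d
    rw [coe_mono h, coeff_monomial] at hd
    by_cases hde : d = expo i j
    · rw [hde, ← expo_degree i j, Finsupp.degree_eq_weight_one]; rfl
    · rw [if_neg hde] at hd
      exact absurd rfl hd
  · rw [mono_of_lt (by omega)]
    intro hd
    exact absurd (by simp) hd

theorem pderiv_inl_monomial (i j : ℕ) : pderiv ℝ (Sum.inl 0) (monomial (expo i j) 1 : Series 1) =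
    monomial (expo (i - 1) j) (i : ℝ) := by
  rw [← MvPolynomial.coe_monomial, pderiv_coe, MvPolynomial.pderiv_monomial,
    MvPolynomial.coe_monomial, one_mul, expo_inl]
  congr 2
  ext x
  rcases x with x | x <;> obtain rfl := Subsingleton.elim x 0 <;> simp

theorem pderiv_inr_monomial (i j : ℕ) : pderiv ℝ (Sum.inr 0) (monomial (expo i j) 1 : Series 1) =
    monomial (expo i (j - 1)) (j : ℝ) := by
  rw [← MvPolynomial.coe_monomial, pderiv_coe, MvPolynomial.pderiv_monomial,
    MvPolynomial.coe_monomial, one_mul, expo_inr]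
  congr 2
  ext x
  rcases x with x | x <;> obtain rfl := Subsingleton.elim x 0 <;> simp

theorem bracket_mono {i j i' j' : ℕ} (h : 2 ≤ i + j) (h' : 2 ≤ i' + j') :
    bracket (mono i j) (mono i' j') =
      ((i : ℝ) * j' - j * i') • mono (i + i' - 1) (j + j' - 1) := by
  have key : ∀ a b c d : ℕ, 2 ≤ a + b → 2 ≤ c + d →
      (monomial (expo (a - 1 + c) (b + (d - 1))) ((a : ℝ) * d) : Series 1) =
        ((a : ℝ) * d) • (mono (a + c - 1) (b + d - 1) : Series 1) := by
    intro a b c d h1 h2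
    rcases Nat.eq_zero_or_pos a with rfl | ha
    · simp
    rcases Nat.eq_zero_or_pos d with rfl | hd
    · simp
    rw [coe_mono (by omega), ← map_smul, smul_eq_mul, mul_one,
      show a - 1 + c = a + c - 1 by omega, show b + (d - 1) = b + d - 1 by omega]
  ext1
  simp only [bracket, poisson_one, Submodule.coe_smul]
  rw [coe_mono h, coe_mono h', pderiv_inl_monomial, pderiv_inr_monomial, pderiv_inl_monomial,
    pderiv_inr_monomial, monomial_mul_monomial, monomial_mul_monomial, expo_add, expo_add,
    key i j i' j' h h', add_comm i (i' - 1), add_comm (j - 1) j', mul_comm (j : ℝ),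
    key i' j' i j h' h, add_comm i' i, add_comm j' j, sub_smul]

/-! ### Continuity -/

theorem continuous_pderiv (i : Fin 1 ⊕ Fin 1) :
    Continuous fun f : Series 1 => pderiv ℝ i f := by
  refine continuous_pi fun d => ?_
  have : (fun f : Series 1 => pderiv ℝ i f d) =
      fun f => coeff (d + Finsupp.single i 1) f * ((d i : ℝ) + 1) :=
    funext fun f => coeff_pderiv f d
  rw [this]
  exact (WithPiTopology.continuous_coeff ℝ _).mul continuous_const

theorem continuous_bracket {T : Type*} [TopologicalSpace T] {g f : T → ham0 1}
    (hg : Continuous g) (hf : Continuous f) : Continuous fun t => bracket (g t) (f t) := by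
  have h1 : Continuous fun t => (g t : Series 1) := continuous_subtype_val.comp hg
  have h2 : Continuous fun t => (f t : Series 1) := continuous_subtype_val.comp hf
  have h3 : Continuous fun t => poisson (g t : Series 1) (f t : Series 1) := by
    simp only [poisson_one]
    exact (((continuous_pderiv _).comp h1).mul ((continuous_pderiv _).comp h2)).sub
      (((continuous_pderiv _).comp h1).mul ((continuous_pderiv _).comp h2))
  exact Continuous.subtype_mk h3 _

theorem mem_cochains_iff {k : ℕ} {σ : Fun 1 k} :
    σ ∈ cochains 1 k ↔ IsAlt k σ ∧ Continuous σ := by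
  constructor
  · rintro ⟨τ, hτ⟩
    obtain rfl : ⇑τ = σ := funext hτ
    exact ⟨isAlt_alternatingMap τ.toAlternatingMap, τ.cont⟩
  · rintro ⟨h, hc⟩
    obtain ⟨τ, rfl⟩ := h.exists_alternatingMap
    exact ⟨{ τ with cont := hc }, fun f => rfl⟩

theorem isAlt_of_mem {k : ℕ} {σ : Fun 1 k} (h : σ ∈ cochains 1 k) : IsAlt k σ :=
  (mem_cochains_iff.1 h).1

theorem continuous_finCons {k : ℕ} {T : Type*} [TopologicalSpace T] {g : T → ham0 1}
    {f : T → Fin k → ham0 1} (hg : Continuous g) (hf : Continuous f) :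
    Continuous fun t => (Fin.cons (g t) (f t) : Fin (k + 1) → ham0 1) := by
  refine continuous_pi fun i => ?_
  refine Fin.cases ?_ (fun i => ?_) i
  · simpa using hg
  · simpa [Function.comp_def] using (continuous_apply i).comp hf

theorem lieD_mem {k : ℕ} {σ : Fun 1 k} (h : σ ∈ cochains 1 k) (X : ham0 1) :
    lieD X σ ∈ cochains 1 k := by
  rw [mem_cochains_iff] at h ⊢
  refine ⟨h.1.lieD X, ?_⟩
  unfold lieD
  refine continuous_finsetSum _ fun j _ => ?_
  have hb : Continuous fun f : Fin k → ham0 1 => bracket X (f j) :=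
    continuous_bracket (f := fun f : Fin k → ham0 1 => f j) continuous_const (continuous_apply j)
  have hc : Continuous fun f : Fin k → ham0 1 => Function.update f j (bracket X (f j)) :=
    continuous_id.update j hb
  exact h.2.comp hc

/-- The coboundary of a continuous form is continuous, since the bracket is. -/
theorem coboundary_mem {k : ℕ} {σ : Fun 1 k} (h : σ ∈ cochains 1 k) :
    coboundary 1 k σ ∈ cochains 1 (k + 1) := by
  rw [mem_cochains_iff] at h ⊢
  refine ⟨h.1.coboundary, ?_⟩
  cases k with
  | zero => exact continuous_const
  | succ k =>
    have e : coboundary 1 (k + 1) σ = fun f => _ := funext fun f => coboundary_succ_apply σ f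
    rw [e]
    refine continuous_finsetSum _ fun j _ => continuous_finsetSum _ fun i _ => ?_
    split_ifs
    · have h1 : Continuous fun f : Fin (k + 2) → ham0 1 => bracket (f i.castSucc) (f j) :=
        continuous_bracket (g := fun f : Fin (k + 2) → ham0 1 => f i.castSucc)
          (f := fun f : Fin (k + 2) → ham0 1 => f j) (continuous_apply _) (continuous_apply _)
      have h2 : Continuous fun f : Fin (k + 2) → ham0 1 => i.removeNth (j.removeNth f) :=
        continuous_pi fun s => continuous_apply _
      have h3 : Continuous fun f : Fin (k + 2) → ham0 1 =>
          (Fin.cons (bracket (f i.castSucc) (f j)) (i.removeNth (j.removeNth f)) :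
            Fin (k + 1) → ham0 1) := continuous_finCons h1 h2
      have h4 : Continuous fun f : Fin (k + 2) → ham0 1 =>
          σ (Fin.cons (bracket (f i.castSucc) (f j)) (i.removeNth (j.removeNth f))) := h.2.comp h3
      exact continuous_const.mul h4
    · exact continuous_const

theorem hasSum_mono (f : ham0 1) : HasSum (fun d : (Fin 1 ⊕ Fin 1) →₀ ℕ =>
    coeff d (f : Series 1) • mono (d (Sum.inl 0)) (d (Sum.inr 0))) f := by
  have hi : Topology.IsInducing (ham0 1).subtype := Topology.IsInducing.subtypeVal
  rw [← hi.hasSum_iff]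
  have h := WithPiTopology.hasSum_of_monomials_self (f : Series 1)
  rw [Submodule.subtype_apply]
  convert h using 1
  funext d
  simp only [Function.comp, Submodule.subtype_apply, Submodule.coe_smul]
  by_cases hd : 2 ≤ d (Sum.inl 0) + d (Sum.inr 0)
  · rw [coe_mono hd, expo_apply, ← map_smul, smul_eq_mul, mul_one]
  · have h0 : coeff d (f : Series 1) = 0 := f.2 d (by
      rw [← expo_apply d, expo_degree]; omega)
    rw [h0, zero_smul, map_zero]

/-- The value of a cochain is an infinite combination of its values on the monomials that occur in
the arguments. -/
theorem eq_zero_of_forall_coeff {k : ℕ} {σ : Fun 1 k} (h : σ ∈ cochains 1 k) (g : Fin k → ham0 1)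
    (h0 : ∀ i j : Fin k → ℕ, (∀ t, coeff (expo (i t) (j t)) (g t : Series 1) ≠ 0) →
      σ (fun t => mono (i t) (j t)) = 0) : σ g = 0 := by
  obtain ⟨τ, hτ⟩ := h
  obtain rfl : ⇑τ = σ := funext hτ
  have key : ∀ s : Finset (Fin k), ∀ f : Fin k → ham0 1, (∀ t ∈ s, f t = g t) →
      (∀ t ∉ s, ∃ i j, coeff (expo i j) (g t : Series 1) ≠ 0 ∧ f t = mono i j) → τ f = 0 := by
    intro s
    induction s using Finset.induction_on with
    | empty =>
      intro f _ hf
      choose i j hc hij using fun t => hf t (Finset.notMem_empty t)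
      obtain rfl : f = _ := funext hij
      exact h0 i j hc
    | insert a s ha ih =>
      intro f hg hf
      have hs := ((hasSum_mono (f a)).map
        (τ.toContinuousMultilinearMap.toContinuousLinearMap f a)
        (τ.toContinuousMultilinearMap.toContinuousLinearMap f a).continuous)
      have hz : ∀ d : (Fin 1 ⊕ Fin 1) →₀ ℕ,
          τ.toContinuousMultilinearMap.toContinuousLinearMap f a
            (coeff d (f a : Series 1) • mono (d (Sum.inl 0)) (d (Sum.inr 0))) = 0 := by
        intro d
        by_cases hd : coeff d (f a : Series 1) = 0
        · rw [hd, zero_smul, map_zero]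
        rw [map_smul]
        have : τ.toContinuousMultilinearMap.toContinuousLinearMap f a
            (mono (d (Sum.inl 0)) (d (Sum.inr 0))) = 0 := by
          refine ih (Function.update f a _) (fun t ht => ?_) fun t ht => ?_
          · rw [Function.update_of_ne (by rintro rfl; exact ha ht)]
            exact hg t (by simp [ht])
          · by_cases hta : t = a
            · subst hta
              refine ⟨_, _, ?_, Function.update_self ..⟩
              rwa [expo_apply, ← hg t (by simp)]
            · rw [Function.update_of_ne hta]
              exact hf t (by simp [hta, ht])
        rw [this, smul_zero]
      have hfun : (⇑(τ.toContinuousMultilinearMap.toContinuousLinearMap f a) ∘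
          fun d : (Fin 1 ⊕ Fin 1) →₀ ℕ =>
            coeff d (f a : Series 1) • mono (d (Sum.inl 0)) (d (Sum.inr 0))) = fun _ => 0 :=
        funext hz
      rw [hfun] at hs
      have h1 := hs.unique hasSum_zero
      have h2 : τ (Function.update f a (f a)) = 0 := h1
      rwa [Function.update_eq_self] at h2
  exact key Finset.univ g (fun _ _ => rfl) fun t ht => absurd (Finset.mem_univ t) ht

/-- A cochain is determined by its values on monomials: these span a dense subspace. -/
theorem eq_zero_of_mono {k : ℕ} {σ : Fun 1 k} (h : σ ∈ cochains 1 k)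
    (h0 : ∀ i j : Fin k → ℕ, σ (fun t => mono (i t) (j t)) = 0) : σ = 0 :=
  funext fun g => eq_zero_of_forall_coeff h g fun i j _ => h0 i j

/-! ### Linear substitutions -/

/-- The image of the variable `x_i` under the linear change of variables `a`. -/
def linForm (a : Matrix (Fin 1 ⊕ Fin 1) (Fin 1 ⊕ Fin 1) ℝ) (i : Fin 1 ⊕ Fin 1) : Series 1 :=
  ∑ j, a i j • (MvPowerSeries.X j : Series 1)

theorem constantCoeff_linForm (a : Matrix (Fin 1 ⊕ Fin 1) (Fin 1 ⊕ Fin 1) ℝ) (i : Fin 1 ⊕ Fin 1) :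
    constantCoeff (linForm a i) = 0 := by
  rw [linForm, map_sum]
  refine Finset.sum_eq_zero fun j _ => ?_
  rw [smul_eq_C_mul, map_mul, constantCoeff_X, mul_zero]

theorem hasSubst_linForm (a : Matrix (Fin 1 ⊕ Fin 1) (Fin 1 ⊕ Fin 1) ℝ) :
    HasSubst (linForm a) := hasSubst_of_constantCoeff_zero (constantCoeff_linForm a)

theorem compLinear_eq (a : Matrix (Fin 1 ⊕ Fin 1) (Fin 1 ⊕ Fin 1) ℝ) (f : Series 1) :
    compLinear a f = subst (linForm a) f := rfl

/-- The substitution `f ↦ f ∘ a` as a linear map. -/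
def compSpL (a : Matrix (Fin 1 ⊕ Fin 1) (Fin 1 ⊕ Fin 1) ℝ) : ham0 1 →ₗ[ℝ] ham0 1 where
  toFun := compSp a
  map_add' f g := by
    ext1
    simp only [compSp, compLinear_eq, Submodule.coe_add]
    exact subst_add (hasSubst_linForm a) _ _
  map_smul' c f := by
    ext1
    simp only [compSp, compLinear_eq, Submodule.coe_smul, RingHom.id_apply]
    exact subst_smul (hasSubst_linForm a) _ _

@[simp] theorem compSpL_apply (a : Matrix (Fin 1 ⊕ Fin 1) (Fin 1 ⊕ Fin 1) ℝ) (f : ham0 1) :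
    compSpL a f = compSp a f := rfl

theorem compSp_compSp (a b : Matrix (Fin 1 ⊕ Fin 1) (Fin 1 ⊕ Fin 1) ℝ) (f : ham0 1) :
    compSp a (compSp b f) = compSp (b * a) f := by
  ext1
  simp only [compSp, compLinear_eq]
  rw [subst_comp_subst_apply (hasSubst_linForm b) (hasSubst_linForm a)]
  congr 1
  funext i
  rw [← coe_substAlgHom (hasSubst_linForm a), linForm, map_sum]
  simp only [map_smul, substAlgHom_X, linForm, Finset.smul_sum, Matrix.mul_apply, Finset.sum_smul,
    mul_smul]
  rw [Finset.sum_comm]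

theorem compLinear_monomial (a : Matrix (Fin 1 ⊕ Fin 1) (Fin 1 ⊕ Fin 1) ℝ) (i j : ℕ) :
    compLinear a (monomial (expo i j) 1) =
      linForm a (Sum.inl 0) ^ i * linForm a (Sum.inr 0) ^ j := by
  rw [compLinear_eq, subst_monomial (hasSubst_linForm a), map_one, one_mul, Finsupp.prod_fintype]
  · simp
  · simp

theorem continuous_compSp (a : Matrix (Fin 1 ⊕ Fin 1) (Fin 1 ⊕ Fin 1) ℝ) :
    Continuous (compSp a) := by
  have h : Continuous fun f : ham0 1 => compLinear a (f : Series 1) := by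
    refine continuous_pi fun e => ?_
    -- only the coefficients of degree at most that of `e` enter the coefficient at `e`
    let S : Finset ((Fin 1 ⊕ Fin 1) →₀ ℕ) :=
      (Finset.range (e.degree + 1) ×ˢ Finset.range (e.degree + 1)).image fun x => expo x.1 x.2
    have hS : ∀ f : Series 1, compLinear a f e =
        ∑ d ∈ S, coeff d f • coeff e (d.prod fun s n => linForm a s ^ n) := by
      intro f
      have h1 : compLinear a f e = coeff e (subst (linForm a) f) := rfl
      rw [h1, coeff_subst (hasSubst_linForm a)]
      refine finsum_eq_sum_of_support_subset _ fun d hd => ?_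
      by_contra hdS
      refine hd ?_
      have hdeg : e.degree < d.degree := by
        by_contra hle
        refine hdS (Finset.mem_coe.2 (Finset.mem_image.2
          ⟨(d (Sum.inl 0), d (Sum.inr 0)), ?_, expo_apply d⟩))
        rw [← expo_apply d, expo_degree] at hle
        simp only [Finset.mem_product, Finset.mem_range]
        omega
      have h2 : (d.prod fun s n => linForm a s ^ n) = subst (linForm a) (monomial d (1 : ℝ)) := by
        rw [subst_monomial (hasSubst_linForm a), map_one, one_mul]
      have h3 : ((d.degree : ℕ) : ℕ∞) ≤ (d.prod fun s n => linForm a s ^ n).order := by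
        rw [h2]
        refine le_trans ?_ (le_order_subst (hasSubst_linForm a) _)
        rw [order_monomial_of_ne_zero one_ne_zero]
        have h4 : (1 : ℕ∞) ≤ ⨅ i : Fin 1 ⊕ Fin 1, (linForm a i).order :=
          le_iInf fun i => one_le_order_iff_constCoeff_eq_zero.mpr (constantCoeff_linForm a i)
        calc ((d.degree : ℕ) : ℕ∞) = 1 * (d.degree : ℕ) := by rw [one_mul]
          _ ≤ _ := mul_le_mul' h4 le_rfl
      show coeff d f • coeff e (d.prod fun s n => linForm a s ^ n) = 0
      rw [coeff_of_lt_order (lt_of_lt_of_le (by exact_mod_cast hdeg) h3), smul_zero]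
    have e1 : (fun f : ham0 1 => compLinear a (f : Series 1) e) = fun f : ham0 1 =>
        ∑ d ∈ S, coeff d (f : Series 1) • coeff e (d.prod fun s n => linForm a s ^ n) :=
      funext fun f => hS f
    rw [e1]
    refine continuous_finsetSum _ fun d _ => ?_
    exact ((WithPiTopology.continuous_coeff ℝ d).comp continuous_subtype_val).smul continuous_const
  exact Continuous.subtype_mk h _

theorem coe_compSp_mono (a : Matrix (Fin 1 ⊕ Fin 1) (Fin 1 ⊕ Fin 1) ℝ) {i j : ℕ} (h : 2 ≤ i + j) :
    (compSp a (mono i j) : Series 1) = linForm a (Sum.inl 0) ^ i * linForm a (Sum.inr 0) ^ j := by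
  rw [← compLinear_monomial, ← coe_mono h]
  rfl

/-- The shear `q ↦ q, p ↦ p + s q`. -/
def shearP (s : ℝ) : Matrix (Fin 1 ⊕ Fin 1) (Fin 1 ⊕ Fin 1) ℝ :=
  Matrix.fromBlocks 1 0 (s • 1) 1

/-- The shear `q ↦ q + s p, p ↦ p`. -/
def shearQ (s : ℝ) : Matrix (Fin 1 ⊕ Fin 1) (Fin 1 ⊕ Fin 1) ℝ :=
  Matrix.fromBlocks 1 (s • 1) 0 1

theorem X_inl_eq (n : ℕ) :
    (MvPowerSeries.X (Sum.inl 0) : Series 1) ^ n = monomial (expo n 0) 1 := by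
  rw [X_pow_eq, expo, Finsupp.single_zero, add_zero]

theorem X_inr_eq (n : ℕ) :
    (MvPowerSeries.X (Sum.inr 0) : Series 1) ^ n = monomial (expo 0 n) 1 := by
  rw [X_pow_eq, expo, Finsupp.single_zero, zero_add]

theorem compSp_shearP (s : ℝ) {i j : ℕ} (h : 2 ≤ i + j) : compSp (shearP s) (mono i j) =
    ∑ n ∈ Finset.range (j + 1), s ^ n • ((j.choose n : ℝ) • mono (i + n) (j - n)) := by
  ext1
  rw [coe_compSp_mono _ h]
  simp only [AddSubmonoidClass.coe_finsetSum, Submodule.coe_smul]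
  have h1 : linForm (shearP s) (Sum.inl 0) = MvPowerSeries.X (Sum.inl 0) := by
    simp [linForm, shearP]
  have h2 : linForm (shearP s) (Sum.inr 0) =
      s • MvPowerSeries.X (Sum.inl 0) + MvPowerSeries.X (Sum.inr 0) := by
    simp [linForm, shearP]
  rw [h1, h2, add_pow, Finset.mul_sum]
  refine Finset.sum_congr rfl fun n hn => ?_
  have hn' := Finset.mem_range.1 hn
  rw [coe_mono (by omega), smul_pow, X_inl_eq, X_inl_eq, X_inr_eq]
  have h3 : (monomial (expo i 0) (1 : ℝ) * (s ^ n • monomial (expo n 0) (1 : ℝ) *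
      monomial (expo 0 (j - n)) (1 : ℝ) * ((j.choose n : ℕ) : Series 1)) : Series 1) =
      s ^ n • (j.choose n • (monomial (expo i 0) (1 : ℝ) * monomial (expo n 0) (1 : ℝ) *
        monomial (expo 0 (j - n)) (1 : ℝ))) := by
    rw [nsmul_eq_mul, smul_mul_assoc, smul_mul_assoc, mul_smul_comm]
    congr 1
    ring
  rw [h3, monomial_mul_monomial, monomial_mul_monomial, expo_add, expo_add, Nat.cast_smul_eq_nsmul]
  simp

theorem compSp_shearQ (s : ℝ) {i j : ℕ} (h : 2 ≤ i + j) : compSp (shearQ s) (mono i j) =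
    ∑ n ∈ Finset.range (i + 1), s ^ n • ((i.choose n : ℝ) • mono (i - n) (j + n)) := by
  ext1
  rw [coe_compSp_mono _ h]
  simp only [AddSubmonoidClass.coe_finsetSum, Submodule.coe_smul]
  have h1 : linForm (shearQ s) (Sum.inr 0) = MvPowerSeries.X (Sum.inr 0) := by
    simp [linForm, shearQ]
  have h2 : linForm (shearQ s) (Sum.inl 0) =
      s • MvPowerSeries.X (Sum.inr 0) + MvPowerSeries.X (Sum.inl 0) := by
    simp [linForm, shearQ, add_comm]
  rw [h1, h2, add_pow, Finset.sum_mul]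
  refine Finset.sum_congr rfl fun n hn => ?_
  have hn' := Finset.mem_range.1 hn
  rw [coe_mono (by omega), smul_pow, X_inl_eq, X_inr_eq, X_inr_eq]
  have h3 : (s ^ n • monomial (expo 0 n) (1 : ℝ) *
      monomial (expo (i - n) 0) (1 : ℝ) * ((i.choose n : ℕ) : Series 1) *
        monomial (expo 0 j) (1 : ℝ) : Series 1) =
      s ^ n • (i.choose n • (monomial (expo (i - n) 0) (1 : ℝ) * monomial (expo 0 j) (1 : ℝ) *
        monomial (expo 0 n) (1 : ℝ))) := by
    rw [nsmul_eq_mul, smul_mul_assoc, smul_mul_assoc, smul_mul_assoc]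
    congr 1
    ring
  rw [h3, monomial_mul_monomial, monomial_mul_monomial, expo_add, expo_add, Nat.cast_smul_eq_nsmul]
  simp

/-- The shears generate `SL(2, ℝ)`. -/
theorem compSp_of_mem_symplecticGroup {P : (ham0 1 → ham0 1) → Prop}
    (hmul : ∀ u v, P u → P v → P (u ∘ v)) (hP : ∀ s, P (compSp (shearP s)))
    (hQ : ∀ s, P (compSp (shearQ s))) {a : Matrix (Fin 1 ⊕ Fin 1) (Fin 1 ⊕ Fin 1) ℝ}
    (ha : a ∈ Matrix.symplecticGroup (Fin 1) ℝ) : P (compSp a) := by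
  have hcomp : ∀ a b, P (compSp a) → P (compSp b) → P (compSp (a * b)) := by
    intro a b h1 h2
    have : compSp (a * b) = compSp b ∘ compSp a := funext fun f => (compSp_compSp b a f).symm
    rw [this]
    exact hmul _ _ h2 h1
  have hdet : ∀ a : Matrix (Fin 1 ⊕ Fin 1) (Fin 1 ⊕ Fin 1) ℝ, a.det =
      a (Sum.inl 0) (Sum.inl 0) * a (Sum.inr 0) (Sum.inr 0) -
        a (Sum.inl 0) (Sum.inr 0) * a (Sum.inr 0) (Sum.inl 0) := by
    intro a
    rw [← Matrix.det_reindex_self finSumFinEquiv a, Matrix.det_fin_two]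
    rfl
  have hext : ∀ a b : Matrix (Fin 1 ⊕ Fin 1) (Fin 1 ⊕ Fin 1) ℝ,
      a (Sum.inl 0) (Sum.inl 0) = b (Sum.inl 0) (Sum.inl 0) →
      a (Sum.inl 0) (Sum.inr 0) = b (Sum.inl 0) (Sum.inr 0) →
      a (Sum.inr 0) (Sum.inl 0) = b (Sum.inr 0) (Sum.inl 0) →
      a (Sum.inr 0) (Sum.inr 0) = b (Sum.inr 0) (Sum.inr 0) → a = b := by
    intro a b h1 h2 h3 h4
    ext x y
    rcases x with x | x <;> rcases y with y | y <;> obtain rfl := Subsingleton.elim x 0 <;>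
      obtain rfl := Subsingleton.elim y 0 <;> assumption
  -- a nonzero lower left entry is the middle factor of a product of three shears
  have main : ∀ a : Matrix (Fin 1 ⊕ Fin 1) (Fin 1 ⊕ Fin 1) ℝ, a.det = 1 →
      a (Sum.inr 0) (Sum.inl 0) ≠ 0 → P (compSp a) := by
    intro a h1 h0
    rw [hdet] at h1
    have : a = shearQ ((a (Sum.inl 0) (Sum.inl 0) - 1) / a (Sum.inr 0) (Sum.inl 0)) *
        shearP (a (Sum.inr 0) (Sum.inl 0)) *
        shearQ ((a (Sum.inr 0) (Sum.inr 0) - 1) / a (Sum.inr 0) (Sum.inl 0)) := by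
      apply hext <;> simp [shearP, shearQ, Matrix.mul_apply] <;> field_simp <;>
        first | ring1 | linear_combination -h1
    rw [this]
    exact hcomp _ _ (hcomp _ _ (hQ _) (hP _)) (hQ _)
  have h1 : a.det = 1 := SymplecticGroup.det_eq_one ha
  by_cases h0 : a (Sum.inr 0) (Sum.inl 0) = 0
  · have h2 : (shearP 1 * a).det = 1 := by
      rw [Matrix.det_mul, h1, hdet]
      simp [shearP]
    have h3 : (shearP 1 * a) (Sum.inr 0) (Sum.inl 0) ≠ 0 := by
      have h4 : a (Sum.inl 0) (Sum.inl 0) ≠ 0 := by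
        intro h4
        rw [hdet, h0, h4] at h1
        simp at h1
      simpa [shearP, Matrix.mul_apply, h0] using h4
    have h5 : a = shearP (-1) * (shearP 1 * a) := by
      apply hext <;> simp [shearP, Matrix.mul_apply]
    rw [h5]
    exact hcomp _ _ (hP _) (main _ h2 h3)
  · exact main a h1 h0

/-! ### Infinitesimal invariance -/

theorem IsAlt.contract_sum {k : ℕ} {σ : Fun 1 (k + 1)} (h : IsAlt (k + 1) σ) {ι : Type*}
    (s : Finset ι) (a : ι → ℝ) (v : ι → ham0 1) :
    GKF.contract (∑ n ∈ s, a n • v n) σ = ∑ n ∈ s, a n • GKF.contract (v n) σ := by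
  classical
  induction s using Finset.induction_on with
  | empty => simpa using h.2.2.1 0 0
  | insert b s hb ih => rw [Finset.sum_insert hb, Finset.sum_insert hb, h.2.1, h.2.2.1, ih]

/-- The Leibniz rule along polynomial curves. It is stated for these because no norm on `ham0 1` is
available. -/
theorem hasDerivAt_polynomial_curve : ∀ {k : ℕ} {σ : Fun 1 k}, IsAlt k σ → ∀ (N : Fin k → ℕ)
    (v : Fin k → ℕ → ham0 1) (t : ℝ),
    HasDerivAt (fun t : ℝ => σ fun j => ∑ n ∈ Finset.range (N j), t ^ n • v j n)
      (∑ j, σ (Function.update (fun j => ∑ n ∈ Finset.range (N j), t ^ n • v j n) j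
        (∑ n ∈ Finset.range (N j), ((n : ℝ) * t ^ (n - 1)) • v j n))) t
  | 0, σ, _, N, v, t => by
    simp only [Finset.univ_eq_empty, Finset.sum_empty]
    have : (fun t : ℝ => σ fun j => ∑ n ∈ Finset.range (N j), t ^ n • v j n) =
        fun _ => σ default := funext fun t => congrArg σ (Subsingleton.elim _ _)
    rw [this]
    exact hasDerivAt_const ..
  | k + 1, σ, h, N, v, t => by
    have hc : ∀ (a : ℕ → ℝ) (f : Fin k → ham0 1),
        σ (Fin.cons (∑ n ∈ Finset.range (N 0), a n • v 0 n) f) =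
          ∑ n ∈ Finset.range (N 0), a n * GKF.contract (v 0 n) σ f := by
      intro a f
      have := congrFun (h.contract_sum (Finset.range (N 0)) a (v 0)) f
      simpa [GKF.contract] using this
    have hcons : ∀ t : ℝ, (fun j => ∑ n ∈ Finset.range (N j), t ^ n • v j n) =
        (Fin.cons (∑ n ∈ Finset.range (N 0), t ^ n • v 0 n)
          fun j : Fin k => ∑ n ∈ Finset.range (N j.succ), t ^ n • v j.succ n :
            Fin (k + 1) → ham0 1) := by
      intro t
      funext j
      refine Fin.cases ?_ (fun j => ?_) j <;> simp
    rw [Fin.sum_univ_succ]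
    simp only [hcons, Fin.update_cons_zero, ← Fin.cons_update, hc]
    have hd : HasDerivAt (fun t : ℝ => ∑ n ∈ Finset.range (N 0), t ^ n * GKF.contract (v 0 n) σ
        fun j : Fin k => ∑ n ∈ Finset.range (N j.succ), t ^ n • v j.succ n) _ t :=
      HasDerivAt.fun_sum fun n _ => (hasDerivAt_pow n t).mul
        (hasDerivAt_polynomial_curve (h.1 (v 0 n)) (fun j => N j.succ) (fun j => v j.succ) t)
    convert hd using 1
    rw [Finset.sum_add_distrib, Finset.sum_comm]
    simp only [Finset.mul_sum]

/-- For a one-parameter family `u` of substitutions that on each monomial is a polynomial curve with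
derivative the bracket with `X`, invariance under `u` amounts to invariance under `X`. -/
theorem lieD_eq_zero_iff {k : ℕ} {σ : Fun 1 k} (h : σ ∈ cochains 1 k) (X : ham0 1)
    (u : ℝ → ham0 1 →ₗ[ℝ] ham0 1) (hu : ∀ t, Continuous (u t))
    (hp : ∀ i j : ℕ, ∃ (N : ℕ) (v : ℕ → ham0 1),
      u 0 (mono i j) = mono i j ∧
      (∀ t, u t (mono i j) = ∑ n ∈ Finset.range N, t ^ n • v n) ∧
      ∀ t, bracket X (u t (mono i j)) = ∑ n ∈ Finset.range N, ((n : ℝ) * t ^ (n - 1)) • v n) :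
    lieD X σ = 0 ↔ ∀ t f, σ (fun j => u t (f j)) = σ f := by
  have hder : ∀ (i j : Fin k → ℕ) (t : ℝ), HasDerivAt
      (fun t : ℝ => σ fun s => u t (mono (i s) (j s)))
      (lieD X σ fun s => u t (mono (i s) (j s))) t := by
    intro i j t
    choose N v _ hv hb using fun s => hp (i s) (j s)
    have := hasDerivAt_polynomial_curve (isAlt_of_mem h) N v t
    simp only [← hv, ← hb] at this
    exact this
  constructor
  · intro hX t
    have hconst : ∀ i j : Fin k → ℕ, ∀ t, σ (fun s => u t (mono (i s) (j s))) =
        σ fun s => mono (i s) (j s) := by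
      intro i j t
      have hd : ∀ t, HasDerivAt (fun t : ℝ => σ fun s => u t (mono (i s) (j s))) 0 t := by
        intro t
        have := hder i j t
        rwa [hX] at this
      have := is_const_of_deriv_eq_zero (fun t => (hd t).differentiableAt)
        (fun t => (hd t).deriv) t 0
      rw [this]
      congr 1
      funext s
      obtain ⟨_, _, h0, _⟩ := hp (i s) (j s)
      exact h0
    have hmem : (fun f : Fin k → ham0 1 => σ fun j => u t (f j)) - σ ∈ cochains 1 k := by
      refine Submodule.sub_mem _ ?_ h
      rw [mem_cochains_iff] at h ⊢
      refine ⟨?_, ?_⟩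
      · obtain ⟨τ, rfl⟩ := h.1.exists_alternatingMap
        exact isAlt_alternatingMap (τ.compLinearMap (u t))
      · have : Continuous fun f : Fin k → ham0 1 => fun j => u t (f j) :=
          continuous_pi fun j => (hu t).comp (continuous_apply j)
        exact h.2.comp this
    have := eq_zero_of_mono hmem fun i j => by
      simp only [Pi.sub_apply, hconst, sub_self]
    intro f
    have h1 := congrFun this f
    simpa [sub_eq_zero] using h1
  · intro hinv
    refine eq_zero_of_mono (lieD_mem h X) fun i j => ?_
    have h1 := hder i j 0
    simp only [hinv] at h1
    have h2 := h1.unique (hasDerivAt_const _ _)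
    have h3 : (fun s => u 0 (mono (i s) (j s))) = fun s => mono (i s) (j s) := by
      funext s
      obtain ⟨_, _, h0, _⟩ := hp (i s) (j s)
      exact h0
    rwa [h3] at h2

/-- The Hamiltonian `q² / 2`, whose bracket is the derivation `p ↦ q, q ↦ 0`. -/
def raiseX : ham0 1 := (1 / 2 : ℝ) • mono 2 0

/-- The Hamiltonian `-p² / 2`, whose bracket is the derivation `q ↦ p, p ↦ 0`. -/
def lowerX : ham0 1 := (-1 / 2 : ℝ) • mono 0 2

theorem bracket_raiseX {i j : ℕ} (h : 2 ≤ i + j) :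
    bracket raiseX (mono i j) = (j : ℝ) • mono (i + 1) (j - 1) := by
  rw [raiseX, bracket_smul_left, bracket_mono (by norm_num) h, smul_smul,
    show 2 + i - 1 = i + 1 by omega, zero_add]
  congr 1
  push_cast
  ring

theorem bracket_lowerX {i j : ℕ} (h : 2 ≤ i + j) :
    bracket lowerX (mono i j) = (i : ℝ) • mono (i - 1) (j + 1) := by
  rw [lowerX, bracket_smul_left, bracket_mono (by norm_num) h, smul_smul,
    show 2 + j - 1 = j + 1 by omega, zero_add]
  congr 1
  push_cast
  ring

theorem sum_choose_shift (j : ℕ) (t : ℝ) (m : ℕ → ham0 1) :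
    ∑ n ∈ Finset.range (j + 1), t ^ n • ((j.choose n : ℝ) • (((j - n : ℕ) : ℝ) • m (n + 1))) =
      ∑ n ∈ Finset.range (j + 1), ((n : ℝ) * t ^ (n - 1)) • ((j.choose n : ℝ) • m n) := by
  rw [Finset.sum_range_succ, Finset.sum_range_succ' (fun n : ℕ =>
    ((n : ℝ) * t ^ (n - 1)) • ((j.choose n : ℝ) • m n))]
  simp only [Nat.sub_self, Nat.cast_zero, zero_smul, smul_zero, add_zero, zero_mul]
  refine Finset.sum_congr rfl fun n _ => ?_
  have h := Nat.choose_succ_right_eq j n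
  have h' : (j.choose (n + 1) : ℝ) * (n + 1) = j.choose n * ((j - n : ℕ) : ℝ) := by exact_mod_cast h
  simp only [smul_smul]
  congr 1
  rw [Nat.add_sub_cancel]
  push_cast
  linear_combination -t ^ n * h'

theorem lieD_raiseX_eq_zero_iff {k : ℕ} {σ : Fun 1 k} (h : σ ∈ cochains 1 k) :
    lieD raiseX σ = 0 ↔ ∀ s f, σ (fun j => compSp (shearP s) (f j)) = σ f := by
  refine lieD_eq_zero_iff h raiseX (fun s => compSpL (shearP s)) (fun t => continuous_compSp _)
    fun i j => ?_
  by_cases hij : 2 ≤ i + j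
  · refine ⟨j + 1, fun n => (j.choose n : ℝ) • mono (i + n) (j - n), ?_, fun t => ?_, fun t => ?_⟩
    · rw [compSpL_apply, compSp_shearP 0 hij, Finset.sum_range_succ']
      simp
    · rw [compSpL_apply, compSp_shearP t hij]
    · rw [compSpL_apply, compSp_shearP t hij, ← sum_choose_shift, ← ad_apply, map_sum]
      refine Finset.sum_congr rfl fun n hn => ?_
      have := Finset.mem_range.1 hn
      rw [map_smul, map_smul, ad_apply, bracket_raiseX (by omega), add_assoc, Nat.sub_sub]
  · refine ⟨0, fun _ => 0, ?_, fun t => ?_, fun t => ?_⟩ <;>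
      simp [-compSpL_apply, -ad_apply, mono_of_lt (not_le.1 hij), ← ad_apply]

theorem lieD_lowerX_eq_zero_iff {k : ℕ} {σ : Fun 1 k} (h : σ ∈ cochains 1 k) :
    lieD lowerX σ = 0 ↔ ∀ s f, σ (fun j => compSp (shearQ s) (f j)) = σ f := by
  refine lieD_eq_zero_iff h lowerX (fun s => compSpL (shearQ s)) (fun t => continuous_compSp _)
    fun i j => ?_
  by_cases hij : 2 ≤ i + j
  · refine ⟨i + 1, fun n => (i.choose n : ℝ) • mono (i - n) (j + n), ?_, fun t => ?_, fun t => ?_⟩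
    · rw [compSpL_apply, compSp_shearQ 0 hij, Finset.sum_range_succ']
      simp
    · rw [compSpL_apply, compSp_shearQ t hij]
    · have := sum_choose_shift i t fun n => mono (i - n) (j + n)
      rw [compSpL_apply, compSp_shearQ t hij, ← this, ← ad_apply, map_sum]
      refine Finset.sum_congr rfl fun n hn => ?_
      have := Finset.mem_range.1 hn
      rw [map_smul, map_smul, ad_apply, bracket_lowerX (by omega), add_assoc, Nat.sub_sub]
  · refine ⟨0, fun _ => 0, ?_, fun t => ?_, fun t => ?_⟩ <;>
      simp [-compSpL_apply, -ad_apply, mono_of_lt (not_le.1 hij), ← ad_apply]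

theorem shearP_mem (s : ℝ) : shearP s ∈ Matrix.symplecticGroup (Fin 1) ℝ := by
  rw [SymplecticGroup.mem_iff]
  ext x y
  rcases x with x | x <;> rcases y with y | y <;> obtain rfl := Subsingleton.elim x 0 <;>
      obtain rfl := Subsingleton.elim y 0 <;> simp [shearP, Matrix.J, Matrix.mul_apply]

theorem shearQ_mem (s : ℝ) : shearQ s ∈ Matrix.symplecticGroup (Fin 1) ℝ := by
  rw [SymplecticGroup.mem_iff]
  ext x y
  rcases x with x | x <;> rcases y with y | y <;> obtain rfl := Subsingleton.elim x 0 <;>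
      obtain rfl := Subsingleton.elim y 0 <;> simp [shearQ, Matrix.J, Matrix.mul_apply]

/-- Relative cochains in terms of the Lie algebra `sp(2, ℝ)` alone. -/
theorem mem_relCochains_iff {k : ℕ} {σ : Fun 1 k} : σ ∈ relCochains 1 k ↔ σ ∈ cochains 1 k ∧
    (∀ (f : Fin k → ham0 1) (i : Fin k), IsHom (f i) 2 → σ f = 0) ∧
    lieD raiseX σ = 0 ∧ lieD lowerX σ = 0 := by
  constructor
  · rintro ⟨h1, h2, h3⟩
    exact ⟨h1, h2, (lieD_raiseX_eq_zero_iff h1).2 fun s f => h3 _ (shearP_mem s) f,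
      (lieD_lowerX_eq_zero_iff h1).2 fun s f => h3 _ (shearQ_mem s) f⟩
  · rintro ⟨h1, h2, h3, h4⟩
    refine ⟨h1, h2, fun a ha => ?_⟩
    refine compSp_of_mem_symplecticGroup (P := fun u => ∀ f : Fin k → ham0 1,
      σ (fun i => u (f i)) = σ f) ?_ ?_ ?_ ha
    · intro u v hu hv f
      rw [← hv f]
      exact hu fun i => v (f i)
    · exact (lieD_raiseX_eq_zero_iff h1).1 h3
    · exact (lieD_lowerX_eq_zero_iff h1).1 h4

/-! ### The relative cochains form a complex -/

theorem weight_one_apply (d : (Fin 1 ⊕ Fin 1) →₀ ℕ) :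
    Finsupp.weight (1 : Fin 1 ⊕ Fin 1 → ℕ) d = d.degree := by
  rw [Finsupp.degree_eq_weight_one]; rfl

theorem degree_of_isHom {f : ham0 1} {l : ℕ} (h : IsHom f l) {i j : ℕ}
    (hc : coeff (expo i j) (f : Series 1) ≠ 0) : i + j = l := by
  have := h hc
  rwa [weight_one_apply, expo_degree] at this

theorem ham0_ext {f g : ham0 1} (h : ∀ i j, 2 ≤ i + j →
    coeff (expo i j) (f : Series 1) = coeff (expo i j) (g : Series 1)) : f = g := by
  ext1
  ext d
  rw [← expo_apply d]
  by_cases hd : 2 ≤ d (Sum.inl 0) + d (Sum.inr 0)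
  · exact h _ _ hd
  · rw [f.2 _ (by rw [expo_degree]; omega), g.2 _ (by rw [expo_degree]; omega)]

theorem eq_zero_of_isHom {f : ham0 1} {l : ℕ} (h : IsHom f l) (hl : l < 2) : f = 0 := by
  refine ham0_ext fun i j hij => ?_
  by_contra hc
  have := degree_of_isHom h (i := i) (j := j) (by simpa using hc)
  omega

/-- `S^2` is spanned by `q²`, `qp`, `p²`, that is, by the two Hamiltonians and their bracket. -/
theorem IsHom.eq_sum {X : ham0 1} (h : IsHom X 2) : ∃ a b c : ℝ,
    X = a • raiseX + b • lowerX + c • bracket raiseX lowerX := by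
  have hb : bracket raiseX lowerX = (-1 : ℝ) • mono 1 1 := by
    rw [lowerX, bracket_smul_right, bracket_raiseX (by norm_num), smul_smul]
    norm_num
    exact (neg_one_smul ℝ _).symm
  refine ⟨2 * coeff (expo 2 0) (X : Series 1), -2 * coeff (expo 0 2) (X : Series 1),
    -coeff (expo 1 1) (X : Series 1), ham0_ext fun i j hij => ?_⟩
  rw [hb, raiseX, lowerX]
  simp only [Submodule.coe_add, Submodule.coe_smul, map_add, map_smul, smul_eq_mul,
    coeff_mono (show 2 ≤ 2 + 0 by norm_num), coeff_mono (show 2 ≤ 0 + 2 by norm_num),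
    coeff_mono (show 2 ≤ 1 + 1 by norm_num)]
  by_cases hc : coeff (expo i j) (X : Series 1) = 0
  · have h1 : ∀ i' j', (if i = i' ∧ j = j' then (1 : ℝ) else 0) * coeff (expo i' j') (X : Series 1)
        = 0 := by
      intro i' j'
      split_ifs with h
      · rw [← h.1, ← h.2, hc, mul_zero]
      · rw [zero_mul]
    linear_combination hc - h1 2 0 - h1 0 2 - h1 1 1
  · have hd := degree_of_isHom h hc
    have : (i = 2 ∧ j = 0) ∨ (i = 1 ∧ j = 1) ∨ (i = 0 ∧ j = 2) := by omega
    rcases this with ⟨rfl, rfl⟩ | ⟨rfl, rfl⟩ | ⟨rfl, rfl⟩ <;> norm_num <;> ring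

theorem lieD_add_left {k : ℕ} {σ : Fun 1 k} (h : IsAlt k σ) (X Y : ham0 1) :
    lieD (X + Y) σ = lieD X σ + lieD Y σ := by
  obtain ⟨τ, rfl⟩ := h.exists_alternatingMap
  funext f
  simp only [lieD, bracket_add_left, Pi.add_apply, AlternatingMap.map_update_add,
    Finset.sum_add_distrib]

theorem lieD_smul_left {k : ℕ} {σ : Fun 1 k} (h : IsAlt k σ) (c : ℝ) (X : ham0 1) :
    lieD (c • X) σ = c • lieD X σ := by
  obtain ⟨τ, rfl⟩ := h.exists_alternatingMap
  funext f
  simp only [lieD, bracket_smul_left, Pi.smul_apply, AlternatingMap.map_update_smul,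
    Finset.smul_sum]

theorem lieD_eq_zero_of_isHom {k : ℕ} {σ : Fun 1 k} (h : IsAlt k σ) (h1 : lieD raiseX σ = 0)
    (h2 : lieD lowerX σ = 0) {X : ham0 1} (hX : IsHom X 2) : lieD X σ = 0 := by
  obtain ⟨a, b, c, rfl⟩ := hX.eq_sum
  have h3 : lieD (bracket raiseX lowerX) σ = 0 := by
    have := lieD_lieD h raiseX lowerX
    rw [h1, h2, lieD_zero, lieD_zero, zero_sub, eq_comm, neg_eq_zero] at this
    exact this
  rw [lieD_add_left h, lieD_add_left h, lieD_smul_left h, lieD_smul_left h, lieD_smul_left h, h1,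
    h2, h3]
  simp

theorem contract_eq_zero_iff {k : ℕ} {σ : Fun 1 (k + 1)} (h : IsAlt (k + 1) σ)
    (P : ham0 1 → Prop) : (∀ (f : Fin (k + 1) → ham0 1) (i : Fin (k + 1)), P (f i) → σ f = 0) ↔
      ∀ X, P X → contract X σ = 0 := by
  constructor
  · intro h1 X hX
    funext f
    exact h1 (Fin.cons X f) 0 (by simpa using hX)
  · intro h1 f i hi
    have h2 := h.map_cons_removeNth f i (f i)
    rw [Function.update_eq_self] at h2
    have h3 : σ (Fin.cons (f i) (i.removeNth f)) = 0 := congrFun (h1 _ hi) _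
    rw [h3] at h2
    rcases mul_eq_zero.1 h2.symm with h4 | h4
    · exact absurd h4 (pow_ne_zero _ (by norm_num))
    · exact h4

theorem coboundary_mem_relCochains {k : ℕ} {σ : Fun 1 k} (h : σ ∈ relCochains 1 k) :
    coboundary 1 k σ ∈ relCochains 1 (k + 1) := by
  rw [mem_relCochains_iff] at h ⊢
  obtain ⟨h1, h2, h3, h4⟩ := h
  have ha := isAlt_of_mem h1
  refine ⟨coboundary_mem h1, ?_, by rw [lieD_coboundary ha, h3, map_zero],
    by rw [lieD_coboundary ha, h4, map_zero]⟩
  cases k with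
  | zero => exact fun f i _ => rfl
  | succ k =>
    rw [contract_eq_zero_iff ha (fun X => IsHom X 2)] at h2
    rw [contract_eq_zero_iff ha.coboundary (fun X => IsHom X 2)]
    intro X hX
    rw [contract_coboundary ha, h2 X hX, map_zero, sub_zero,
      lieD_eq_zero_of_isHom ha h3 h4 hX, neg_zero]

theorem isComplex_relCochains : IsComplex (relCochains 1) := fun _ _ hσ =>
  ⟨coboundary_mem_relCochains hσ, coboundary_coboundary (isAlt_of_mem (mem_relCochains_iff.1 hσ).1)⟩

theorem IsHom.bracket {f g : ham0 1} {l m : ℕ} (hf : IsHom f l) (hg : IsHom g m)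
    (h : 2 ≤ l + m) : IsHom (GKF.bracket f g) (l + m - 2) := by
  have hp : ∀ (f : ham0 1) (l : ℕ), IsHom f l → ∀ (i : Fin 1 ⊕ Fin 1) (d : (Fin 1 ⊕ Fin 1) →₀ ℕ),
      coeff d (pderiv ℝ i (f : Series 1)) ≠ 0 → d.degree + 1 = l := by
    intro f l hf i d hd
    rw [coeff_pderiv] at hd
    have := hf (left_ne_zero_of_mul hd)
    rw [weight_one_apply] at this
    simpa [Finsupp.degree_single] using this
  have hm : ∀ (i j : Fin 1 ⊕ Fin 1) (d : (Fin 1 ⊕ Fin 1) →₀ ℕ),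
      coeff d (pderiv ℝ i (f : Series 1) * pderiv ℝ j (g : Series 1)) ≠ 0 →
        d.degree + 2 = l + m := by
    classical
    intro i j d hd
    rw [coeff_mul] at hd
    obtain ⟨x, hx, hne⟩ := Finset.exists_ne_zero_of_sum_ne_zero hd
    have h1 := hp f l hf i _ (left_ne_zero_of_mul hne)
    have h2 := hp g m hg j _ (right_ne_zero_of_mul hne)
    rw [← Finset.HasAntidiagonal.mem_antidiagonal.mp hx, map_add]
    omega
  intro d hd
  simp only [GKF.bracket, poisson_one, map_sub] at hd
  have h3 : d.degree + 2 = l + m := by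
    by_contra hne
    have h1 := not_imp_comm.1 (hm (Sum.inl 0) (Sum.inr 0) d) hne
    have h2 := not_imp_comm.1 (hm (Sum.inr 0) (Sum.inl 0) d) hne
    rw [h1, h2, sub_zero] at hd
    exact hd rfl
  rw [weight_one_apply]
  omega

theorem coboundary_mem_ofWeight {k : ℕ} {w : ℤ} {σ : Fun 1 k} (h : IsAlt k σ)
    (hw : σ ∈ ofWeight 1 w k) : coboundary 1 k σ ∈ ofWeight 1 w (k + 1) := by
  cases k with
  | zero => exact Submodule.zero_mem _
  | succ k =>
    intro f l hf hl
    rw [coboundary_succ_apply]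
    refine Finset.sum_eq_zero fun j _ => Finset.sum_eq_zero fun i _ => ?_
    split_ifs with hij
    swap; · rfl
    rw [mul_eq_zero]
    right
    have hji : j.succAbove i = i.castSucc := Fin.succAbove_of_castSucc_lt j i hij
    by_cases h2 : 2 ≤ l i.castSucc + l j
    · refine hw _ (Fin.cons (l i.castSucc + l j - 2) (i.removeNth (j.removeNth l))) ?_ ?_
      · intro s
        refine Fin.cases ?_ (fun s => ?_) s
        · simpa using IsHom.bracket (hf i.castSucc) (hf j) h2
        · simpa [Fin.removeNth] using hf (j.succAbove (i.succAbove s))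
      · rw [Fin.sum_univ_succAbove _ j, Fin.sum_univ_succAbove _ i, hji] at hl
        rw [Fin.sum_univ_succ]
        simp only [Fin.cons_zero, Fin.cons_succ, Fin.removeNth]
        rw [Nat.cast_sub h2]
        push_cast
        intro h3
        exact hl (by rw [← h3]; ring)
    · have h0 : bracket (f i.castSucc) (f j) = 0 := by
        rcases (by omega : l i.castSucc < 2 ∨ l j < 2) with h3 | h3
        · rw [eq_zero_of_isHom (hf _) h3, bracket_skew, ← ad_apply, map_zero, neg_zero]
        · rw [eq_zero_of_isHom (hf _) h3, ← ad_apply, map_zero]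
      rw [h0]
      have h4 := h.2.2.1 0 0
      rw [zero_smul, zero_smul] at h4
      exact congrFun h4 _

theorem isComplex_relCochainsOfWeight (w : ℤ) : IsComplex (relCochainsOfWeight 1 w) := by
  intro k σ hσ
  obtain ⟨h1, h2⟩ := isComplex_relCochains k σ hσ.1
  exact ⟨⟨h1, coboundary_mem_ofWeight (isAlt_of_mem (mem_relCochains_iff.1 hσ.1).1) hσ.2⟩, h2⟩

theorem relCochains_zero : relCochains 1 0 = ⊤ := by
  rw [eq_top_iff]
  intro σ _
  rw [mem_relCochains_iff, mem_cochains_iff]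
  refine ⟨⟨trivial, ?_⟩, fun f i => i.elim0, ?_, ?_⟩
  · exact continuous_of_const fun x y => congrArg σ (Subsingleton.elim x y)
  · funext f; simp [lieD]
  · funext f; simp [lieD]

theorem finrank_cohomology_zero : Module.finrank ℝ (Cohomology (relCochains 1) 0) = 1 := by
  have h1 : (coboundaries (relCochains 1) 0).submoduleOf (cocycles (relCochains 1) 0) = ⊥ := by
    rw [coboundaries, Submodule.submoduleOf, Submodule.comap_bot, Submodule.ker_subtype]
  have h2 : cocycles (relCochains 1) 0 = ⊤ := by
    rw [cocycles, relCochains_zero, top_inf_eq, coboundary, LinearMap.ker_zero]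
  rw [(Submodule.quotEquivOfEqBot _ h1).finrank_eq, h2, finrank_top]
  exact (Module.finrank_fintype_fun_eq_card ℝ).trans Fintype.card_unique

/-! ### Weight spaces and the action of `sl(2)` -/

/-- If `E`, `F` raise and lower the index of the weight spaces `W t` by `2`, satisfy
`E F - F E = t` on `W t`, and the `W t` with large `t` vanish, then `E F` is injective on `W 2`:
from `E F v = 0` it follows that `F E^(n+1) v = -(n+1)(n+2) E^n v` for all `n`. -/
theorem eq_zero_of_raise_lower {V : Type*} [AddCommGroup V] [Module ℝ V] (E F : V →ₗ[ℝ] V)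
    (W : ℤ → Submodule ℝ V) (hE : ∀ t, ∀ v ∈ W t, E v ∈ W (t + 2))
    (hEF : ∀ t, ∀ v ∈ W t, E (F v) = F (E v) + (t : ℝ) • v) (N : ℤ)
    (hN : ∀ t, N < t → ∀ v ∈ W t, v = 0) {v : V} (hv : v ∈ W 2) (h : E (F v) = 0) : v = 0 := by
  have hmem : ∀ n : ℕ, (E ^ n) v ∈ W (2 + 2 * n) := by
    intro n
    induction n with
    | zero => simpa using hv
    | succ n ih =>
      rw [pow_succ', Module.End.mul_apply]
      convert hE _ _ ih using 2
      push_cast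
      ring
  have hF : ∀ n : ℕ, F ((E ^ (n + 1)) v) = (-((n + 1) * (n + 2)) : ℝ) • (E ^ n) v := by
    intro n
    induction n with
    | zero =>
      have := hEF 2 v hv
      rw [h] at this
      simp only [zero_add, pow_one, pow_zero, Module.End.one_apply]
      rw [eq_neg_of_add_eq_zero_left this.symm, ← neg_smul]
      norm_num
    | succ n ih =>
      have := hEF _ _ (hmem (n + 1))
      rw [ih, map_smul, ← Module.End.mul_apply E, ← pow_succ', ← Module.End.mul_apply E,
        ← pow_succ'] at this
      rw [eq_sub_of_add_eq this.symm, ← sub_smul]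
      congr 1
      push_cast
      ring
  have hdesc : ∀ n : ℕ, (E ^ n) v = 0 → v = 0 := by
    intro n
    induction n with
    | zero => exact fun h => h
    | succ n ih =>
      intro h0
      refine ih ?_
      have := hF n
      rw [h0, map_zero, eq_comm, smul_eq_zero] at this
      refine this.resolve_left ?_
      refine neg_ne_zero.2 ?_
      positivity
  refine hdesc (N.toNat) (hN _ ?_ _ (hmem _))
  have := Int.self_le_toNat N
  omega

/-- The Lie derivative as a linear map. -/
def lieDL (k : ℕ) (X : ham0 1) : Fun 1 k →ₗ[ℝ] Fun 1 k where
  toFun := lieD X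
  map_add' := lieD_add X
  map_smul' := lieD_smul X

@[simp] theorem lieDL_apply {k : ℕ} (X : ham0 1) (σ : Fun 1 k) : lieDL k X σ = lieD X σ := rfl

/-- The cochains that vanish on `S^2`, have weight `w`, and on which `diag(a, a⁻¹)` in `Sp(2, ℝ)`
acts with weight `t`; all in terms of the values on monomials. -/
def wtSpace (k w : ℕ) (t : ℤ) : Submodule ℝ (Fun 1 k) where
  carrier := {σ | σ ∈ cochains 1 k ∧ ∀ i j : Fin k → ℕ, σ (fun s => mono (i s) (j s)) ≠ 0 →
    (∀ s, 3 ≤ i s + j s) ∧ ∑ s, (i s + j s) = w + 2 * k ∧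
      (∑ s, (j s : ℤ)) - ∑ s, (i s : ℤ) = t}
  add_mem' := by
    rintro σ τ ⟨h1, h2⟩ ⟨h3, h4⟩
    refine ⟨Submodule.add_mem _ h1 h3, fun i j h => ?_⟩
    by_cases h0 : σ (fun s => mono (i s) (j s)) = 0
    · refine h4 i j fun h5 => h ?_
      rw [Pi.add_apply, h0, h5, add_zero]
    · exact h2 i j h0
  zero_mem' := ⟨Submodule.zero_mem _, fun _ _ h => absurd rfl h⟩
  smul_mem' := by
    rintro c σ ⟨h1, h2⟩
    refine ⟨Submodule.smul_mem _ c h1, fun i j h => h2 i j fun h5 => h ?_⟩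
    rw [Pi.smul_apply, h5, smul_zero]

theorem sum_update {k : ℕ} (g : Fin k → ℕ) (a : Fin k) (v : ℕ) :
    (∑ s, Function.update g a v s) + g a = (∑ s, g s) + v := by
  classical
  rw [Finset.sum_update_of_mem (Finset.mem_univ a), ← Finset.add_sum_erase _ g (Finset.mem_univ a),
    Finset.sdiff_singleton_eq_erase]
  ring

theorem map_eq_zero_of_mono {k : ℕ} {σ : Fun 1 k} (h : IsAlt k σ) {i j : Fin k → ℕ} {s : Fin k}
    (hs : i s + j s < 2) : σ (fun s => mono (i s) (j s)) = 0 := by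
  obtain ⟨τ, rfl⟩ := h.exists_alternatingMap
  exact τ.map_coord_zero s (mono_of_lt hs)

theorem lieD_mono {k : ℕ} {σ : Fun 1 k} (h : IsAlt k σ) {X : ham0 1} {u v : ℕ → ℕ}
    {c : ℕ → ℕ → ℕ}
    (hX : ∀ {i j : ℕ}, 2 ≤ i + j → bracket X (mono i j) = (c i j : ℝ) • mono (u i) (v j))
    {i j : Fin k → ℕ} (hij : ∀ s, 2 ≤ i s + j s) : lieD X σ (fun s => mono (i s) (j s)) =
      ∑ a, (c (i a) (j a) : ℝ) * σ (fun s => mono (Function.update i a (u (i a)) s)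
        (Function.update j a (v (j a)) s)) := by
  obtain ⟨τ, rfl⟩ := h.exists_alternatingMap
  rw [lieD]
  refine Finset.sum_congr rfl fun a _ => ?_
  rw [hX (hij a), AlternatingMap.map_update_smul, smul_eq_mul]
  congr 2
  funext s
  by_cases hs : s = a
  · subst hs; simp
  · simp [Function.update_of_ne hs]

theorem lieD_raiseX_mem {k w : ℕ} {t : ℤ} {σ : Fun 1 k} (h : σ ∈ wtSpace k w t) :
    lieD raiseX σ ∈ wtSpace k w (t + 2) := by
  refine ⟨lieD_mem h.1 _, fun i j h0 => ?_⟩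
  have hij : ∀ s, 2 ≤ i s + j s := fun s => not_lt.1 fun hs =>
    h0 (map_eq_zero_of_mono ((isAlt_of_mem h.1).lieD _) hs)
  rw [lieD_mono (isAlt_of_mem h.1) (c := fun _ j => j) bracket_raiseX hij] at h0
  obtain ⟨a, -, ha⟩ := Finset.exists_ne_zero_of_sum_ne_zero h0
  have ha0 : j a ≠ 0 := by
    rintro hz
    rw [hz, Nat.cast_zero, zero_mul] at ha
    exact ha rfl
  obtain ⟨h1, h2, h3⟩ := h.2 _ _ (right_ne_zero_of_mul ha)
  have e1 := sum_update i a (i a + 1)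
  have e2 := sum_update j a (j a - 1)
  rw [Finset.sum_add_distrib] at h2 ⊢
  rw [← Nat.cast_sum, ← Nat.cast_sum] at h3 ⊢
  refine ⟨fun s => ?_, by omega, by omega⟩
  have := h1 s
  by_cases hs : s = a
  · subst hs; simp only [Function.update_self] at this; omega
  · simpa [Function.update_of_ne hs] using this

theorem lieD_lowerX_mem {k w : ℕ} {t : ℤ} {σ : Fun 1 k} (h : σ ∈ wtSpace k w t) :
    lieD lowerX σ ∈ wtSpace k w (t - 2) := by
  refine ⟨lieD_mem h.1 _, fun i j h0 => ?_⟩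
  have hij : ∀ s, 2 ≤ i s + j s := fun s => not_lt.1 fun hs =>
    h0 (map_eq_zero_of_mono ((isAlt_of_mem h.1).lieD _) hs)
  rw [lieD_mono (isAlt_of_mem h.1) (c := fun i _ => i) bracket_lowerX hij] at h0
  obtain ⟨a, -, ha⟩ := Finset.exists_ne_zero_of_sum_ne_zero h0
  have ha0 : i a ≠ 0 := by
    rintro hz
    rw [hz, Nat.cast_zero, zero_mul] at ha
    exact ha rfl
  obtain ⟨h1, h2, h3⟩ := h.2 _ _ (right_ne_zero_of_mul ha)
  have e1 := sum_update i a (i a - 1)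
  have e2 := sum_update j a (j a + 1)
  rw [Finset.sum_add_distrib] at h2 ⊢
  rw [← Nat.cast_sum, ← Nat.cast_sum] at h3 ⊢
  refine ⟨fun s => ?_, by omega, by omega⟩
  have := h1 s
  by_cases hs : s = a
  · subst hs; simp only [Function.update_self] at this; omega
  · simpa [Function.update_of_ne hs] using this

theorem bracket_raiseX_lowerX {i j : ℕ} (h : 2 ≤ i + j) :
    bracket (bracket raiseX lowerX) (mono i j) = ((i : ℝ) - j) • mono i j := by
  have hb : bracket raiseX lowerX = (-1 : ℝ) • mono 1 1 := by
    rw [lowerX, bracket_smul_right, bracket_raiseX (by norm_num), smul_smul]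
    norm_num
    exact (neg_one_smul ℝ _).symm
  rw [hb, bracket_smul_left, bracket_mono (by norm_num) h, smul_smul, Nat.add_sub_cancel_left,
    Nat.add_sub_cancel_left]
  congr 1
  push_cast
  ring

theorem lieD_torus_mono {k : ℕ} {σ : Fun 1 k} (h : IsAlt k σ) {i j : Fin k → ℕ}
    (hij : ∀ s, 2 ≤ i s + j s) :
    lieD (bracket raiseX lowerX) σ (fun s => mono (i s) (j s)) =
      (((∑ s, (i s : ℤ)) - ∑ s, (j s : ℤ) : ℤ) : ℝ) * σ (fun s => mono (i s) (j s)) := by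
  obtain ⟨τ, rfl⟩ := h.exists_alternatingMap
  rw [lieD]
  simp only [bracket_raiseX_lowerX (hij _), AlternatingMap.map_update_smul,
    Function.update_eq_self, smul_eq_mul]
  rw [← Finset.sum_mul, Finset.sum_sub_distrib]
  push_cast
  rfl

theorem lieD_torus {k w : ℕ} {t : ℤ} {σ : Fun 1 k} (h : σ ∈ wtSpace k w t) :
    lieD (bracket raiseX lowerX) σ = -((t : ℝ) • σ) := by
  have ha := isAlt_of_mem h.1
  rw [← sub_eq_zero, sub_neg_eq_add]
  refine eq_zero_of_mono (Submodule.add_mem _ (lieD_mem h.1 _) (Submodule.smul_mem _ _ h.1))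
    fun i j => ?_
  rw [Pi.add_apply, Pi.smul_apply]
  by_cases h0 : σ (fun s => mono (i s) (j s)) = 0
  · by_cases hij : ∀ s, 2 ≤ i s + j s
    · rw [lieD_torus_mono ha hij, h0, mul_zero, smul_zero, add_zero]
    · push Not at hij
      obtain ⟨s, hs⟩ := hij
      rw [map_eq_zero_of_mono (ha.lieD _) hs, h0, smul_zero, add_zero]
  · obtain ⟨h1, h2, h3⟩ := h.2 i j h0
    rw [lieD_torus_mono ha fun s => (by have := h1 s; omega), ← h3, smul_eq_mul]
    push_cast
    ring

theorem lieD_raiseX_lowerX {k w : ℕ} {t : ℤ} {σ : Fun 1 k} (h : σ ∈ wtSpace k w t) :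
    lieD raiseX (lieD lowerX σ) = lieD lowerX (lieD raiseX σ) + (t : ℝ) • σ := by
  rw [lieD_lieD (isAlt_of_mem h.1), lieD_torus h, sub_neg_eq_add]

theorem eq_zero_of_mem_wtSpace {k w : ℕ} {t : ℤ} (ht : (w + 2 * k : ℤ) < t ∨ t < -(w + 2 * k : ℤ))
    {σ : Fun 1 k} (h : σ ∈ wtSpace k w t) : σ = 0 := by
  refine eq_zero_of_mono h.1 fun i j => ?_
  by_contra h0
  obtain ⟨h1, h2, h3⟩ := h.2 i j h0
  rw [Finset.sum_add_distrib] at h2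
  rw [← Nat.cast_sum, ← Nat.cast_sum] at h3
  omega

/-- A vector of torus weight `0` that the raising operator kills is killed by the lowering operator
too, because `E F` is injective on the opposite weight space. -/
theorem lieD_lowerX_eq_zero {k w : ℕ} {σ : Fun 1 k} (h : σ ∈ wtSpace k w 0)
    (h1 : lieD raiseX σ = 0) : lieD lowerX σ = 0 := by
  refine eq_zero_of_raise_lower (lieDL k lowerX) (lieDL k raiseX) (fun t => wtSpace k w (-t))
    (fun t v hv => ?_) (fun t v hv => ?_) (w + 2 * k) (fun t ht v hv => ?_) (v := lieD lowerX σ)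
    ?_ ?_
  · have := lieD_lowerX_mem hv
    rwa [show -t - 2 = -(t + 2) by ring] at this
  · rw [lieDL_apply, lieDL_apply, lieDL_apply, lieDL_apply, lieD_raiseX_lowerX hv]
    push_cast
    rw [neg_smul, add_assoc, neg_add_cancel, add_zero]
  · exact eq_zero_of_mem_wtSpace (Or.inr (by omega)) hv
  · exact lieD_lowerX_mem h
  · simp only [lieDL_apply]
    rw [lieD_raiseX_lowerX h, h1, lieD_zero, Int.cast_zero, zero_smul, add_zero, lieD_zero]

/-- Relative cochains are the highest weight vectors of torus weight `0`. -/
theorem relCochainsOfWeight_eq (k w : ℕ) :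
    relCochainsOfWeight 1 w k = wtSpace k w 0 ⊓ LinearMap.ker (lieDL k raiseX) := by
  ext σ
  simp only [relCochainsOfWeight, Submodule.mem_inf, mem_relCochains_iff, LinearMap.mem_ker,
    lieDL_apply]
  constructor
  · rintro ⟨⟨h1, h2, h3, h4⟩, h5⟩
    refine ⟨⟨h1, fun i j h0 => ?_⟩, h3⟩
    have ha := isAlt_of_mem h1
    have hij : ∀ s, 2 ≤ i s + j s := fun s => not_lt.1 fun hs => h0 (map_eq_zero_of_mono ha hs)
    refine ⟨fun s => ?_, ?_, ?_⟩
    · by_contra hs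
      refine h0 (h2 _ s ?_)
      have : IsHom (mono (i s) (j s)) (i s + j s) := isHom_mono _ _
      rwa [show i s + j s = 2 by have := hij s; omega] at this
    · by_contra hw
      refine h0 (h5 _ (fun s => i s + j s) (fun s => isHom_mono _ _) fun h => hw ?_)
      rw [Finset.sum_sub_distrib, ← Nat.cast_sum] at h
      simp only [Finset.sum_const, Finset.card_univ, Fintype.card_fin, nsmul_eq_mul] at h
      omega
    · have h6 : lieD (bracket raiseX lowerX) σ = 0 := by
        have := lieD_lieD ha raiseX lowerX
        rw [h3, h4, lieD_zero, lieD_zero, zero_sub, eq_comm, neg_eq_zero] at this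
        exact this
      have h7 := congrFun h6 fun s => mono (i s) (j s)
      rw [lieD_torus_mono ha hij, Pi.zero_apply] at h7
      have h8 := (mul_eq_zero.1 h7).resolve_right h0
      have h9 : (∑ s, (i s : ℤ)) - ∑ s, (j s : ℤ) = 0 := by exact_mod_cast h8
      omega
  · rintro ⟨h, h1⟩
    refine ⟨⟨h.1, fun f a hf => ?_, h1, lieD_lowerX_eq_zero h h1⟩, fun f l hf hl => ?_⟩
    · refine eq_zero_of_forall_coeff h.1 f fun i j hc => ?_
      by_contra h0
      have h2 := (h.2 i j h0).1 a
      have h3 := degree_of_isHom hf (hc a)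
      omega
    · refine eq_zero_of_forall_coeff h.1 f fun i j hc => ?_
      by_contra h0
      refine hl ?_
      have h2 := (h.2 i j h0).2.1
      have h3 : ∀ s, i s + j s = l s := fun s => degree_of_isHom (hf s) (hc s)
      simp only [h3] at h2
      rw [Finset.sum_sub_distrib, ← Nat.cast_sum, h2]
      simp
      ring

/-- Since `E : W 0 → W 2` is onto, its kernel has dimension `dim W 0 - dim W 2`. -/
theorem finrank_relCochainsOfWeight (k w : ℕ) [FiniteDimensional ℝ (wtSpace k w 0)]
    [FiniteDimensional ℝ (wtSpace k w 2)] :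
    FiniteDimensional ℝ (relCochainsOfWeight 1 w k) ∧
      Module.finrank ℝ (relCochainsOfWeight 1 w k) + Module.finrank ℝ (wtSpace k w 2) =
      Module.finrank ℝ (wtSpace k w 0) := by
  let e : wtSpace k w 0 →ₗ[ℝ] wtSpace k w 2 :=
    (lieDL k raiseX).restrict (fun σ hσ => by simpa using lieD_raiseX_mem hσ)
  let f : wtSpace k w 2 →ₗ[ℝ] wtSpace k w 0 :=
    (lieDL k lowerX).restrict (fun σ hσ => by simpa using lieD_lowerX_mem hσ)
  have hinj : Function.Injective (e ∘ₗ f) := by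
    rw [← LinearMap.ker_eq_bot, LinearMap.ker_eq_bot']
    intro σ hσ
    ext1
    refine eq_zero_of_raise_lower (lieDL k raiseX) (lieDL k lowerX) (wtSpace k w)
      (fun t v hv => lieD_raiseX_mem hv) (fun t v hv => lieD_raiseX_lowerX hv) (w + 2 * k)
      (fun t ht v hv => eq_zero_of_mem_wtSpace (Or.inl ht) hv) σ.2 ?_
    exact congrArg Subtype.val hσ
  have hsurj : Function.Surjective e := by
    have := LinearMap.injective_iff_surjective.1 hinj
    exact Function.Surjective.of_comp (g := f) this
  have hker : relCochainsOfWeight 1 w k = (LinearMap.ker e).map (wtSpace k w 0).subtype := by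
    rw [relCochainsOfWeight_eq]
    ext σ
    simp only [Submodule.mem_inf, Submodule.mem_map, LinearMap.mem_ker]
    constructor
    · rintro ⟨h1, h2⟩
      exact ⟨⟨σ, h1⟩, Subtype.ext h2, rfl⟩
    · rintro ⟨τ, h1, rfl⟩
      exact ⟨τ.2, congrArg Subtype.val h1⟩
  refine ⟨by rw [hker]; infer_instance, ?_⟩
  have h1 := LinearMap.finrank_range_add_finrank_ker e
  rw [LinearMap.range_eq_top.2 hsurj, finrank_top] at h1
  rw [hker, Submodule.finrank_map_subtype_eq, ← h1, add_comm]

/-! ### Bases of the weight spaces -/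

/-- The number `32 l + i` encodes the monomial `q^i p^(l - i)` of degree `l`. -/
def codeMono (c : ℕ) : ham0 1 := mono (c % 32) (c / 32 - c % 32)

/-- The codes of the monomials of degrees `3` to `20`. -/
def codeSet : Finset ℕ := (Finset.range 672).filter fun c => 96 ≤ c ∧ c % 32 ≤ c / 32

theorem mem_codeSet {c : ℕ} : c ∈ codeSet ↔ c < 672 ∧ 96 ≤ c ∧ c % 32 ≤ c / 32 := by
  rw [codeSet, Finset.mem_filter, Finset.mem_range]

/-- The sets of `k` monomials of weight `w` with total exponent `s` of `q`. -/
def monoSets (k w s : ℕ) : Finset (Finset ℕ) :=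
  (codeSet.powersetCard k).filter fun S =>
    ∑ c ∈ S, c / 32 = w + 2 * k ∧ ∑ c ∈ S, c % 32 = s

theorem mem_monoSets {k w s : ℕ} {S : Finset ℕ} : S ∈ monoSets k w s ↔
    (S ⊆ codeSet ∧ S.card = k) ∧ ∑ c ∈ S, c / 32 = w + 2 * k ∧ ∑ c ∈ S, c % 32 = s := by
  rw [monoSets, Finset.mem_filter, Finset.mem_powersetCard]

/-- The determinant of the coefficients of the arguments at the monomials with codes `c`. -/
def detCochain {k : ℕ} (c : Fin k → ℕ) : Fun 1 k := fun f =>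
  Matrix.det (Matrix.of fun a b => coeff (expo (c b % 32) (c b / 32 - c b % 32)) (f a : Series 1))

theorem detCochain_mem {k : ℕ} (c : Fin k → ℕ) : detCochain c ∈ cochains 1 k := by
  rw [mem_cochains_iff]
  constructor
  · let L : ham0 1 →ₗ[ℝ] (Fin k → ℝ) := LinearMap.pi fun b =>
      (coeff (expo (c b % 32) (c b / 32 - c b % 32))).comp (ham0 1).subtype
    exact isAlt_alternatingMap
      ((Matrix.detRowAlternating (n := Fin k) (R := ℝ)).compLinearMap L)
  · refine Continuous.matrix_det ?_
    refine continuous_pi fun a => continuous_pi fun b => ?_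
    exact (WithPiTopology.continuous_coeff ℝ _).comp
      (continuous_subtype_val.comp (continuous_apply a))

theorem exists_perm_of_detCochain_ne_zero {k : ℕ} {c : Fin k → ℕ} {i j : Fin k → ℕ}
    (h : detCochain c (fun s => mono (i s) (j s)) ≠ 0) :
    ∃ π : Equiv.Perm (Fin k), ∀ s, i (π s) = c s % 32 ∧ j (π s) = c s / 32 - c s % 32 := by
  have hij : ∀ s, 2 ≤ i s + j s := fun s => not_lt.1 fun hs =>
    h (map_eq_zero_of_mono (isAlt_of_mem (detCochain_mem c)) hs)
  rw [detCochain, Matrix.det_apply] at h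
  obtain ⟨π, -, hπ⟩ := Finset.exists_ne_zero_of_sum_ne_zero h
  refine ⟨π, fun s => ?_⟩
  have h1 : ∏ s, (Matrix.of fun a b => coeff (expo (c b % 32) (c b / 32 - c b % 32))
      (mono (i a) (j a) : Series 1)) (π s) s ≠ 0 := by
    intro h0
    rw [h0, smul_zero] at hπ
    exact hπ rfl
  have h2 := Finset.prod_ne_zero_iff.1 h1 s (Finset.mem_univ s)
  rw [Matrix.of_apply, coeff_mono (hij _)] at h2
  split_ifs at h2 with h3
  · exact ⟨h3.1.symm, h3.2.symm⟩
  · exact absurd rfl h2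

theorem code_eq {c c' : ℕ} (hc : c ∈ codeSet) (hc' : c' ∈ codeSet) (h1 : c % 32 = c' % 32)
    (h2 : c / 32 - c % 32 = c' / 32 - c' % 32) : c = c' := by
  rw [mem_codeSet] at hc hc'
  omega

theorem detCochain_self {k : ℕ} {c : Fin k → ℕ} (hc : ∀ s, c s ∈ codeSet)
    (hinj : Function.Injective c) : detCochain c (fun s => codeMono (c s)) = 1 := by
  have : (Matrix.of fun a b => coeff (expo (c b % 32) (c b / 32 - c b % 32))
      (codeMono (c a) : Series 1)) = 1 := by
    ext a b
    have ha := mem_codeSet.1 (hc a)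
    rw [Matrix.of_apply, codeMono, coeff_mono (by omega), Matrix.one_apply]
    congr 1
    rw [eq_iff_iff]
    constructor
    · rintro ⟨h1, h2⟩
      exact hinj (code_eq (hc _) (hc _) h1.symm h2.symm)
    · rintro rfl
      exact ⟨rfl, rfl⟩
  rw [detCochain, this, Matrix.det_one]

theorem detCochain_mem_wtSpace {k w s : ℕ} {c : Fin k → ℕ} (hc : ∀ s, c s ∈ codeSet)
    (hw : ∑ s, c s / 32 = w + 2 * k) (hs : ∑ s, c s % 32 = s) {t : ℤ}
    (ht : t = w + 2 * k - 2 * s) : detCochain c ∈ wtSpace k w t := by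
  refine ⟨detCochain_mem c, fun i j h => ?_⟩
  obtain ⟨π, hπ⟩ := exists_perm_of_detCochain_ne_zero h
  have hi : ∑ a, i a = s := by
    rw [← Equiv.sum_comp π, ← hs]
    exact Finset.sum_congr rfl fun a _ => (hπ a).1
  have hj : ∑ a, (i a + j a) = w + 2 * k := by
    rw [← Equiv.sum_comp π, ← hw]
    refine Finset.sum_congr rfl fun a _ => ?_
    have := mem_codeSet.1 (hc a)
    rw [(hπ a).1, (hπ a).2]
    omega
  refine ⟨fun a => ?_, hj, ?_⟩
  · have h1 := hπ (π.symm a)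
    rw [Equiv.apply_symm_apply] at h1
    have := mem_codeSet.1 (hc (π.symm a))
    omega
  · rw [Finset.sum_add_distrib] at hj
    rw [← Nat.cast_sum, ← Nat.cast_sum]
    omega

/-- The elements of a set of `k` codes, in increasing order. -/
def codesOf {k w s : ℕ} (S : monoSets k w s) : Fin k → ℕ :=
  S.1.orderEmbOfFin (mem_monoSets.1 S.2).1.2

theorem codesOf_mem {k w s : ℕ} (S : monoSets k w s) (a : Fin k) : codesOf S a ∈ S.1 :=
  Finset.orderEmbOfFin_mem ..

theorem codesOf_mem_codeSet {k w s : ℕ} (S : monoSets k w s) (a : Fin k) :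
    codesOf S a ∈ codeSet := (mem_monoSets.1 S.2).1.1 (codesOf_mem S a)

theorem codesOf_injective {k w s : ℕ} (S : monoSets k w s) : Function.Injective (codesOf S) :=
  (S.1.orderEmbOfFin _).injective

theorem image_codesOf {k w s : ℕ} (S : monoSets k w s) :
    Finset.univ.image (codesOf S) = S.1 := Finset.image_orderEmbOfFin_univ ..

theorem sum_codesOf {k w s : ℕ} (S : monoSets k w s) (g : ℕ → ℕ) :
    ∑ a, g (codesOf S a) = ∑ c ∈ S.1, g c := by
  conv_rhs => rw [← image_codesOf S]
  rw [Finset.sum_image fun a _ b _ h => codesOf_injective S h]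

theorem detCochain_codesOf {k w s : ℕ} (S S' : monoSets k w s) :
    detCochain (codesOf S) (fun a => codeMono (codesOf S' a)) = if S = S' then 1 else 0 := by
  split_ifs with h
  · subst h
    exact detCochain_self (codesOf_mem_codeSet S) (codesOf_injective S)
  · by_contra h0
    obtain ⟨π, hπ⟩ := exists_perm_of_detCochain_ne_zero h0
    have h1 : ∀ a, codesOf S' (π a) = codesOf S a := fun a =>
      code_eq (codesOf_mem_codeSet _ _) (codesOf_mem_codeSet _ _) (hπ a).1
        (by rw [(hπ a).2])
    refine h (Subtype.ext ?_)
    rw [← image_codesOf S, ← image_codesOf S']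
    ext c
    simp only [Finset.mem_image, Finset.mem_univ, true_and]
    constructor
    · rintro ⟨a, rfl⟩
      exact ⟨π a, h1 a⟩
    · rintro ⟨a, rfl⟩
      exact ⟨π.symm a, by rw [← h1, Equiv.apply_symm_apply]⟩

/-- The values of a cochain on the sets of monomials of the right weights. -/
def evalSets (k w s : ℕ) (t : ℤ) : wtSpace k w t →ₗ[ℝ] (monoSets k w s → ℝ) where
  toFun σ S := σ.1 fun a => codeMono (codesOf S a)
  map_add' _ _ := rfl
  map_smul' _ _ := rfl

/-- The cochains dual to the sets of monomials are determinants, so that they form a basis of the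
weight space. Weight `18` is the largest for which all monomials that occur have degree at most
`20`. -/
theorem evalSets_bijective {k w s : ℕ} {t : ℤ} (hw : w ≤ 18) (ht : t = w + 2 * k - 2 * s) :
    Function.Bijective (evalSets k w s t) := by
  constructor
  · rw [← LinearMap.ker_eq_bot, LinearMap.ker_eq_bot']
    rintro ⟨σ, hσ⟩ h0
    ext1
    refine eq_zero_of_mono hσ.1 fun i j => ?_
    by_contra hne
    change ¬σ (fun t => mono (i t) (j t)) = 0 at hne
    obtain ⟨h1, h2, h3⟩ := hσ.2 i j hne
    have hle : ∀ a, i a + j a ≤ 20 := by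
      intro a
      have h4 : ∑ s, (i s + j s - 2) = w := by
        have h5 : ∑ s, (i s + j s) = ∑ s, ((i s + j s - 2) + 2) :=
          Finset.sum_congr rfl fun s _ => by have := h1 s; omega
        rw [h2, Finset.sum_add_distrib] at h5
        simp at h5
        omega
      have h6 := Finset.single_le_sum (f := fun s => i s + j s - 2) (fun _ _ => Nat.zero_le _)
        (Finset.mem_univ a)
      simp only [h4] at h6
      omega
    obtain ⟨τ, hτ⟩ := (isAlt_of_mem hσ.1).exists_alternatingMap
    let c : Fin k → ℕ := fun a => 32 * (i a + j a) + i a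
    have hc32 : ∀ a, c a % 32 = i a ∧ c a / 32 = i a + j a := fun a => by
      have := hle a
      simp only [c]
      omega
    have hcm : ∀ a, codeMono (c a) = mono (i a) (j a) := fun a => by
      rw [codeMono, (hc32 a).1, (hc32 a).2, Nat.add_sub_cancel_left]
    have hcs : ∀ a, c a ∈ codeSet := fun a => by
      have h4 := hle a
      have h5 := h1 a
      rw [mem_codeSet, (hc32 a).1, (hc32 a).2]
      simp only [c]
      omega
    by_cases hinj : Function.Injective c
    · have hcard : (Finset.univ.image c).card = k := by
        rw [Finset.card_image_of_injective _ hinj, Finset.card_univ, Fintype.card_fin]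
      have hS : Finset.univ.image c ∈ monoSets k w s := by
        rw [mem_monoSets, Finset.sum_image fun a _ b _ h => hinj h,
          Finset.sum_image fun a _ b _ h => hinj h]
        refine ⟨⟨?_, hcard⟩, ?_, ?_⟩
        · intro x hx
          obtain ⟨a, -, rfl⟩ := Finset.mem_image.1 hx
          exact hcs a
        · rw [← h2]
          exact Finset.sum_congr rfl fun a _ => (hc32 a).2
        · have : ∑ a, c a % 32 = ∑ a, i a := Finset.sum_congr rfl fun a _ => (hc32 a).1
          rw [this]
          rw [Finset.sum_add_distrib] at h2
          rw [← Nat.cast_sum, ← Nat.cast_sum] at h3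
          omega
      have hmem : ∀ a, ∃ b, codesOf ⟨_, hS⟩ b = c a := by
        intro a
        have : c a ∈ Finset.univ.image (codesOf ⟨_, hS⟩) := by
          rw [image_codesOf]
          exact Finset.mem_image_of_mem _ (Finset.mem_univ a)
        obtain ⟨b, -, hb⟩ := Finset.mem_image.1 this
        exact ⟨b, hb⟩
      choose π hπ using hmem
      have hπi : Function.Injective π := fun a b hab => hinj (by rw [← hπ, ← hπ, hab])
      let e : Equiv.Perm (Fin k) := Equiv.ofBijective π (Finite.injective_iff_bijective.1 hπi)
      have h7 := τ.map_perm (fun a => codeMono (codesOf ⟨_, hS⟩ a)) e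
      have h8 : τ (fun a => codeMono (codesOf ⟨_, hS⟩ a)) = 0 := by
        rw [hτ]
        exact congrFun h0 ⟨_, hS⟩
      rw [h8, smul_zero, hτ] at h7
      refine hne ?_
      rw [← h7]
      refine congrArg σ (funext fun a => ?_)
      rw [← hcm, ← hπ a]
      rfl
    · refine hne ?_
      rw [← hτ]
      refine τ.map_eq_zero_of_not_injective _ fun h => hinj fun a b hab => h ?_
      show mono (i a) (j a) = mono (i b) (j b)
      rw [← hcm, ← hcm, hab]
  · intro g
    have hmem : ∀ S : monoSets k w s, detCochain (codesOf S) ∈ wtSpace k w t := fun S =>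
      detCochain_mem_wtSpace (codesOf_mem_codeSet S)
        ((sum_codesOf S (· / 32)).trans (mem_monoSets.1 S.2).2.1)
        ((sum_codesOf S (· % 32)).trans (mem_monoSets.1 S.2).2.2) ht
    refine ⟨∑ S, g S • ⟨_, hmem S⟩, ?_⟩
    rw [map_sum]
    funext S'
    simp only [map_smul, Finset.sum_apply, Pi.smul_apply, evalSets, LinearMap.coe_mk,
      AddHom.coe_mk, detCochain_codesOf, smul_eq_mul, mul_ite, mul_one, mul_zero]
    simp

theorem finrank_wtSpace {k w s : ℕ} {t : ℤ} (hw : w ≤ 18) (ht : t = w + 2 * k - 2 * s) :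
    FiniteDimensional ℝ (wtSpace k w t) ∧
      Module.finrank ℝ (wtSpace k w t) = (monoSets k w s).card := by
  let e := LinearEquiv.ofBijective _ (evalSets_bijective (s := s) hw ht)
  refine ⟨e.symm.finiteDimensional, ?_⟩
  rw [e.finrank_eq, Module.finrank_fintype_fun_eq_card, Fintype.card_coe]

theorem finrank_relCochainsOfWeight_add {k w : ℕ} (hw : w ≤ 18) (h2 : w % 2 = 0)
    (h0 : 2 ≤ w) :
    FiniteDimensional ℝ (relCochainsOfWeight 1 w k) ∧
      Module.finrank ℝ (relCochainsOfWeight 1 w k) + (monoSets k w (w / 2 + k - 1)).card =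
        (monoSets k w (w / 2 + k)).card := by
  obtain ⟨f0, e0⟩ := finrank_wtSpace (k := k) (w := w) (s := w / 2 + k) (t := 0) hw (by omega)
  obtain ⟨f2, e2⟩ := finrank_wtSpace (k := k) (w := w) (s := w / 2 + k - 1) (t := 2) hw (by omega)
  have := finrank_relCochainsOfWeight k w
  rwa [e0, e2] at this

/-! ### Counting monomials -/

/-- Evaluates `v` to a numeral before it is handed to `f`. -/
def force {α : Type} (v : Nat) (f : Nat → α) : α := Nat.rec (f 0) (fun m _ => f (Nat.succ m)) v

@[simp] theorem force_eq {α : Type} (v : Nat) (f : Nat → α) : force v f = f v := by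
  cases v <;> rfl

/-- Evaluates all entries of `l` to numerals before it is handed to `f`. -/
def forceList {α : Type} : List ℕ → (List ℕ → α) → α
  | [], f => f []
  | x :: l, f => force x fun y => forceList l fun m => f (y :: m)

@[simp] theorem forceList_eq {α : Type} : ∀ (l : List ℕ) (f : List ℕ → α), forceList l f = f l
  | [], _ => rfl
  | x :: l, f => by rw [forceList, force_eq, forceList_eq l]

/-- A number that exceeds all numbers of sets of monomials, so that these can be digits. -/
def tableBase : ℕ := 2 ^ 700

/-- Entry number `w` of a table is a polynomial in `tableBase` that has a term
`tableBase ^ (64 k + s)` for each set of `k` monomials of weight `w` with total exponent `s` of `q`.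
Here one more monomial becomes available. -/
def stepTable (c : ℕ) (L : List ℕ) : List ℕ :=
  List.zipWith (fun x y => x + y <<< (700 * (64 + c % 32))) L (List.replicate (c / 32 - 2) 0 ++ L)

/-- The table for the monomials in the first list together with those counted by the second. -/
def table : List ℕ → List ℕ → List ℕ
  | [], L => L
  | c :: cs, L => forceList (stepTable c L) (table cs)

/-- The sets of elements of `T` of weight `w`. -/
def setsOfWeight (T : Finset ℕ) (w : ℕ) : Finset (Finset ℕ) :=
  T.powerset.filter fun S => ∑ c ∈ S, (c / 32 - 2) = w

/-- `L` is the table of the monomials in `T`, up to weight `18`. -/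
def IsTable (T : Finset ℕ) (L : List ℕ) : Prop := L.length = 19 ∧ ∀ w < 19,
  L.getD w 0 = ∑ S ∈ setsOfWeight T w, tableBase ^ (∑ c ∈ S, (64 + c % 32))

/-- The sets that do not contain `c` and those that do give the two summands of `stepTable`. -/
theorem sum_setsOfWeight_insert {T : Finset ℕ} {c : ℕ} (hc : c ∉ T) (w : ℕ) :
    ∑ S ∈ setsOfWeight (insert c T) w, tableBase ^ (∑ c ∈ S, (64 + c % 32)) =
      ∑ S ∈ setsOfWeight T w, tableBase ^ (∑ c ∈ S, (64 + c % 32)) +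
      if c / 32 - 2 ≤ w then (∑ S ∈ setsOfWeight T (w - (c / 32 - 2)),
        tableBase ^ (∑ c ∈ S, (64 + c % 32))) * tableBase ^ (64 + c % 32) else 0 := by
  simp only [setsOfWeight, Finset.sum_filter]
  rw [Finset.sum_powerset_insert hc]
  congr 1
  have h : ∀ S ∈ T.powerset, c ∉ S := fun S hS hcS => hc (Finset.mem_powerset.1 hS hcS)
  split_ifs with hw
  · rw [Finset.sum_mul]
    refine Finset.sum_congr rfl fun S hS => ?_
    rw [Finset.sum_insert (h S hS), Finset.sum_insert (h S hS)]
    by_cases h1 : ∑ c ∈ S, (c / 32 - 2) = w - (c / 32 - 2)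
    · rw [if_pos (by omega), if_pos h1, pow_add, mul_comm]
    · rw [if_neg (by omega), if_neg h1, zero_mul]
  · refine Finset.sum_eq_zero fun S hS => ?_
    rw [Finset.sum_insert (h S hS), if_neg (by omega)]

theorem IsTable.step {T : Finset ℕ} {L : List ℕ} (h : IsTable T L) {c : ℕ} (hc : c ∉ T) :
    IsTable (insert c T) (stepTable c L) := by
  refine ⟨by simp [stepTable, h.1], fun w hw => ?_⟩
  rw [sum_setsOfWeight_insert hc, ← h.2 w hw, ← h.2 (w - (c / 32 - 2)) (by omega)]
  have h1 : w < L.length := by rw [h.1]; exact hw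
  have h2 : w < (List.replicate (c / 32 - 2) 0 ++ L).length := by
    rw [List.length_append]; omega
  have h3 : w < (stepTable c L).length := by
    rw [stepTable, List.length_zipWith]; omega
  rw [List.getD_eq_getElem _ _ h3, List.getD_eq_getElem _ _ h1]
  simp only [stepTable, List.getElem_zipWith, List.getElem_append, List.length_replicate]
  congr 1
  split_ifs with h4 h5 h5
  · omega
  · simp
  · rw [List.getD_eq_getElem _ _ (by omega), Nat.shiftLeft_eq, pow_mul, tableBase]
  · omega

theorem IsTable.table : ∀ {cs : List ℕ} {T : Finset ℕ} {L : List ℕ}, IsTable T L → cs.Nodup →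
    (∀ c ∈ cs, c ∉ T) → IsTable (T ∪ cs.toFinset) (GKF.table cs L)
  | [], T, L, h, _, _ => by simpa [GKF.table] using h
  | c :: cs, T, L, h, hn, hd => by
    rw [GKF.table, forceList_eq, List.toFinset_cons, Finset.union_insert, ← Finset.insert_union]
    rw [List.nodup_cons] at hn
    refine (h.step (hd c (by simp))).table hn.2 fun x hx => ?_
    rw [Finset.mem_insert, not_or]
    refine ⟨?_, hd x (by simp [hx])⟩
    rintro rfl
    exact hn.1 hx

/-- The elements of `codeSet`. -/
def codeList : List ℕ := (List.range 672).filter fun c => Nat.ble 96 c && Nat.ble (c % 32) (c / 32)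

/-- The table for all monomials of degrees `3` to `20`. -/
def fullTable : List ℕ := table codeList (1 :: List.replicate 18 0)

theorem isTable_fullTable : IsTable codeSet fullTable := by
  have h0 : IsTable ∅ (1 :: List.replicate 18 0) := by
    refine ⟨by simp, fun w hw => ?_⟩
    have : setsOfWeight ∅ w = if w = 0 then {∅} else ∅ := by
      split_ifs with h <;> ext S <;> simp [setsOfWeight, Finset.mem_filter] <;> grind
    rw [this]
    split_ifs with h
    · subst h; simp
    · obtain ⟨w, rfl⟩ := Nat.exists_eq_succ_of_ne_zero h
      rw [List.getD_cons_succ, Finset.sum_empty,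
        List.getD_eq_getElem _ _ (by rw [List.length_replicate]; omega), List.getElem_replicate]
  have h1 := h0.table (cs := codeList) (List.nodup_range.filter _) (by simp)
  have h2 : codeList.toFinset = codeSet := by
    ext c
    simp [codeList, mem_codeSet]
  rwa [h2, Finset.empty_union] at h1

/-- A digit of a sum of powers of the base counts how often that power occurs, provided there are
fewer summands than the base. -/
theorem sum_pow_div_mod {ι : Type*} (P : Finset ι) (enc : ι → ℕ) (B e : ℕ) (hB : P.card < B) :
    (∑ S ∈ P, B ^ enc S) / B ^ e % B = (P.filter fun S => enc S = e).card := by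
  have hB0 : 0 < B := by omega
  have h1 : ∑ S ∈ P, B ^ enc S = ∑ S ∈ P.filter (fun S => enc S < e), B ^ enc S +
      B ^ e * ((P.filter fun S => enc S = e).card +
        B * ∑ S ∈ P.filter (fun S => e < enc S), B ^ (enc S - (e + 1))) := by
    rw [← Finset.sum_filter_add_sum_filter_not P (fun S => enc S < e), add_right_inj,
      ← Finset.sum_filter_add_sum_filter_not (P.filter fun S => ¬enc S < e) (fun S => enc S = e),
      Finset.filter_filter, Finset.filter_filter, mul_add, ← mul_assoc, ← pow_succ, Finset.mul_sum]
    congr 1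
    · have h2 : (P.filter fun S => ¬enc S < e ∧ enc S = e) = P.filter fun S => enc S = e :=
        Finset.filter_congr fun S _ => by omega
      rw [h2, Finset.sum_congr rfl fun S hS => by rw [(Finset.mem_filter.1 hS).2],
        Finset.sum_const, smul_eq_mul, mul_comm]
    · refine Finset.sum_congr (Finset.filter_congr fun S _ => by omega) fun S hS => ?_
      have := (Finset.mem_filter.1 hS).2
      rw [← pow_add]
      congr 1
      omega
  have h3 : ∑ S ∈ P.filter (fun S => enc S < e), B ^ enc S < B ^ e := by
    rcases Nat.eq_zero_or_pos e with rfl | he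
    · simp
    · calc ∑ S ∈ P.filter (fun S => enc S < e), B ^ enc S
          ≤ ∑ S ∈ P.filter (fun S => enc S < e), B ^ (e - 1) :=
            Finset.sum_le_sum fun S hS => Nat.pow_le_pow_right hB0 (by
              have := (Finset.mem_filter.1 hS).2; omega)
        _ ≤ P.card * B ^ (e - 1) := by
            rw [Finset.sum_const, smul_eq_mul]
            exact Nat.mul_le_mul_right _ (Finset.card_filter_le _ _)
        _ < B * B ^ (e - 1) := Nat.mul_lt_mul_of_pos_right hB (by positivity)
        _ = B ^ e := by rw [← pow_succ', Nat.sub_add_cancel he]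
  rw [h1, Nat.add_mul_div_left _ _ (by positivity), Nat.div_eq_of_lt h3, zero_add,
    Nat.add_mul_mod_self_left, Nat.mod_eq_of_lt]
  exact lt_of_le_of_lt (Finset.card_filter_le _ _) hB

/-- The number of sets of `k` monomials of weight `w` with total exponent `s` of `q`, read off from
the table. -/
def countFrom (T : List ℕ) (w k s : ℕ) : ℕ := T.getD w 0 / tableBase ^ (64 * k + s) % tableBase

theorem card_monoSets {k w s : ℕ} (hw : w ≤ 18) (hs : s < 64) :
    (monoSets k w s).card = countFrom fullTable w k s := by
  rw [countFrom, isTable_fullTable.2 w (by omega), sum_pow_div_mod]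
  · refine congrArg Finset.card ?_
    ext S
    rw [mem_monoSets, setsOfWeight, Finset.mem_filter, Finset.mem_filter, Finset.mem_powerset]
    simp only [Finset.sum_add_distrib, Finset.sum_const, smul_eq_mul]
    by_cases hS : S ⊆ codeSet
    · have h1 : ∑ c ∈ S, c / 32 = ∑ c ∈ S, (c / 32 - 2) + 2 * S.card := by
        rw [mul_comm, ← smul_eq_mul, ← Finset.sum_const, ← Finset.sum_add_distrib]
        refine Finset.sum_congr rfl fun c hc => ?_
        have := mem_codeSet.1 (hS hc)
        omega
      have h2 : ∑ c ∈ S, c % 32 ≤ ∑ c ∈ S, c / 32 :=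
        Finset.sum_le_sum fun c hc => (mem_codeSet.1 (hS hc)).2.2
      have h3 : S.card ≤ ∑ c ∈ S, (c / 32 - 2) := by
        rw [Finset.card_eq_sum_ones]
        refine Finset.sum_le_sum fun c hc => ?_
        have := mem_codeSet.1 (hS hc)
        omega
      constructor
      · rintro ⟨⟨-, h4⟩, h5, h6⟩
        refine ⟨⟨hS, by omega⟩, by omega⟩
      · rintro ⟨⟨-, h4⟩, h5⟩
        refine ⟨⟨hS, ?_⟩, ?_, ?_⟩ <;> omega
    · exact ⟨fun h => absurd h.1.1 hS, fun h => absurd h.1.1 hS⟩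
  · calc (setsOfWeight codeSet w).card ≤ codeSet.powerset.card := Finset.card_filter_le _ _
      _ = 2 ^ codeSet.card := Finset.card_powerset _
      _ < tableBase := Nat.pow_lt_pow_right (by norm_num) (lt_of_le_of_lt
          ((Finset.card_filter_le _ _).trans (Finset.card_range _).le) (by norm_num))

theorem monoSets_eq_empty {k w s : ℕ} (h : w < k) : monoSets k w s = ∅ := by
  rw [Finset.eq_empty_iff_forall_notMem]
  intro S hS
  rw [mem_monoSets] at hS
  have h1 : ∑ c ∈ S, 3 ≤ ∑ c ∈ S, c / 32 := Finset.sum_le_sum fun c hc => by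
    have := mem_codeSet.1 (hS.1.1 hc)
    omega
  rw [Finset.sum_const, smul_eq_mul] at h1
  omega

/-- The dimensions of the spaces of relative cochains of weight `w`, for `k ≤ 18`. -/
def dimsFrom (T : List ℕ) (w : ℕ) : List ℕ := forceList T fun T => (List.range 19).map fun k =>
  countFrom T w k (w / 2 + k) - countFrom T w k (w / 2 + k - 1)

theorem finrank_relCochainsOfWeight_eq {w : ℕ} (k : ℕ) (hw : w ≤ 18) (h2 : w % 2 = 0)
    (h0 : 2 ≤ w) : FiniteDimensional ℝ (relCochainsOfWeight 1 w k) ∧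
      Module.finrank ℝ (relCochainsOfWeight 1 w k) = (dimsFrom fullTable w).getD k 0 := by
  obtain ⟨h3, h4⟩ := finrank_relCochainsOfWeight_add (k := k) hw h2 h0
  refine ⟨h3, ?_⟩
  rw [dimsFrom, forceList_eq]
  by_cases hk : k < 19
  · rw [card_monoSets hw (by omega), card_monoSets hw (by omega)] at h4
    rw [List.getD_eq_getElem _ _ (by simpa using hk), List.getElem_map, List.getElem_range]
    omega
  · rw [monoSets_eq_empty (by omega), monoSets_eq_empty (by omega)] at h4
    rw [List.getD_eq_default _ _ (by simpa using not_lt.1 hk)]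
    simpa using h4

set_option maxRecDepth 100000 in
theorem dimsFrom_fullTable : [12, 14, 16, 18].map (dimsFrom fullTable) =
    [[0, 0, 0, 8, 23, 22, 13, 5, 0, 0, 0, 0, 0, 0, 0, 0, 0, 0, 0],
      [0, 0, 1, 6, 31, 71, 58, 15, 2, 1, 0, 0, 0, 0, 0, 0, 0, 0, 0],
      [0, 0, 0, 12, 61, 126, 147, 95, 24, 0, 0, 0, 0, 0, 0, 0, 0, 0, 0],
      [0, 0, 1, 10, 80, 262, 380, 268, 100, 21, 1, 0, 0, 0, 0, 0, 0, 0, 0]] := by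
  decide +kernel

/-! ### Packed vectors modulo `8191` -/

instance : Fact (Nat.Prime 8191) := ⟨by norm_num⟩

/-- The number `N`, in base `2^40` and with digits at most `b`, lists the coefficients of a linear
combination of `ts` with value `t`. -/
def Rep (b : ℕ) : List (ZMod 8191) → ℕ → ZMod 8191 → Prop
  | [], N, t => N = 0 ∧ t = 0
  | t₀ :: ts, N, t => ∃ v M s, v ≤ b ∧ N = v + 2 ^ 40 * M ∧ Rep b ts M s ∧ t = v * t₀ + s

theorem Rep.zero (b : ℕ) : ∀ ts, Rep b ts 0 0
  | [] => ⟨rfl, rfl⟩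
  | _ :: ts => ⟨0, 0, 0, Nat.zero_le _, rfl, Rep.zero b ts, by simp⟩

theorem Rep.mono {b b' : ℕ} (h : b ≤ b') : ∀ {ts N t}, Rep b ts N t → Rep b' ts N t
  | [], _, _, h1 => h1
  | _ :: _, _, _, ⟨v, M, s, h1, h2, h3, h4⟩ => ⟨v, M, s, h1.trans h, h2, h3.mono h, h4⟩

theorem Rep.add {b b' : ℕ} : ∀ {ts N N' t t'}, Rep b ts N t → Rep b' ts N' t' →
    Rep (b + b') ts (N + N') (t + t')
  | [], _, _, _, _, ⟨h1, h2⟩, ⟨h3, h4⟩ => ⟨by rw [h1, h3], by rw [h2, h4, add_zero]⟩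
  | _ :: _, _, _, _, _, ⟨v, M, s, h1, h2, h3, h4⟩, ⟨v', M', s', h1', h2', h3', h4'⟩ =>
    ⟨v + v', M + M', s + s', Nat.add_le_add h1 h1', by rw [h2, h2']; ring, h3.add h3',
      by rw [h4, h4']; push_cast; ring⟩

theorem Rep.mul {b : ℕ} (c : ℕ) : ∀ {ts N t}, Rep b ts N t → Rep (c * b) ts (c * N) (c * t)
  | [], _, _, ⟨h1, h2⟩ => ⟨by rw [h1, mul_zero], by rw [h2, mul_zero]⟩
  | _ :: _, _, _, ⟨v, M, s, h1, h2, h3, h4⟩ =>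
    ⟨c * v, c * M, c * s, Nat.mul_le_mul_left c h1, by rw [h2]; ring, h3.mul c,
      by rw [h4]; push_cast; ring⟩

theorem Rep.congr {b : ℕ} {ts N t t'} (h : Rep b ts N t) (e : t = t') : Rep b ts N t' := e ▸ h

theorem land_split {e v m : ℕ} (hv : v < 2 ^ e) (hm : m < 2 ^ e) (M L : ℕ) :
    (v + 2 ^ e * M) &&& (m + 2 ^ e * L) = (v &&& m) + 2 ^ e * (M &&& L) := by
  refine Nat.eq_of_testBit_eq fun j => ?_
  have hvm : v &&& m < 2 ^ e := Nat.and_lt_two_pow _ hm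
  rw [add_comm v, add_comm m, add_comm (v &&& m), Nat.testBit_and,
    Nat.testBit_two_pow_mul_add _ hv, Nat.testBit_two_pow_mul_add _ hm,
    Nat.testBit_two_pow_mul_add _ hvm]
  split_ifs <;> rw [Nat.testBit_and]

/-- The number with `n` digits `1` in base `2^40`. -/
def ones : ℕ → ℕ
  | 0 => 0
  | n + 1 => 1 + 2 ^ 40 * ones n

/-- The mask for the lower `13` bits of each of `512` digits. -/
abbrev lowMask : Nat :=
  Nat.mul (Nat.div (Nat.sub (Nat.pow 2 20480) 1) (Nat.sub (Nat.pow 2 40) 1)) 8191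

/-- The mask for the upper `27` bits of each of `512` digits. -/
abbrev highMask : Nat := Nat.mul (Nat.div (Nat.sub (Nat.pow 2 20480) 1) (Nat.sub (Nat.pow 2 40) 1))
  (Nat.sub (Nat.pow 2 40) 8192)

set_option maxRecDepth 100000 in
theorem masks_eq : lowMask = ones 512 * 8191 ∧ highMask = ones 512 * (2 ^ 40 - 8192) := by
  decide +kernel

/-- Adds the upper bits of each digit to the lower ones, which changes no digit modulo `8191`. -/
def fold (N : Nat) : Nat := Nat.add (Nat.land N lowMask) (Nat.shiftRight (Nat.land N highMask) 13)

/-- Makes all digits small without changing them modulo `8191`. -/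
def red (N : Nat) : Nat := fold (fold N)

/-- Masking splits a packed linear form into the part with the lower bits of all digits and the part
with the upper ones. -/
theorem Rep.land {b : ℕ} (hb : b < 2 ^ 40) : ∀ {ts N t} (n : ℕ), ts.length ≤ n → Rep b ts N t →
    ∃ H r s, N &&& (ones n * (2 ^ 40 - 8192)) = 8192 * H ∧ Rep (b / 8192) ts H s ∧
      Rep 8191 ts (N &&& (ones n * 8191)) r ∧ t = r + s
  | [], _, _, n, _, ⟨h1, h2⟩ =>
    ⟨0, 0, 0, by rw [h1, Nat.zero_and], ⟨rfl, rfl⟩, ⟨by rw [h1, Nat.zero_and], rfl⟩, by simp [h2]⟩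
  | t₀ :: ts, N, t, n + 1, hn, ⟨v, M, s, h1, h2, h3, h4⟩ => by
    obtain ⟨H, r', s', e1, e2, e3, e4⟩ := h3.land hb n (by simpa using hn)
    have hv : v < 2 ^ 40 := by omega
    have f1 : ones (n + 1) * (2 ^ 40 - 8192) = (2 ^ 40 - 8192) +
        2 ^ 40 * (ones n * (2 ^ 40 - 8192)) := by rw [ones]; ring
    have f2 : ones (n + 1) * 8191 = 8191 + 2 ^ 40 * (ones n * 8191) := by rw [ones]; ring
    have f3 : v &&& (2 ^ 40 - 8192) = 8192 * (v / 8192) := by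
      have g1 : v = v % 2 ^ 13 + 2 ^ 13 * (v / 8192) := by omega
      have g2 : 2 ^ 40 - 8192 = 0 + 2 ^ 13 * (2 ^ 27 - 1) := by norm_num
      rw [g2]
      nth_rw 1 [g1]
      rw [land_split (Nat.mod_lt _ (by norm_num)) (by norm_num), Nat.and_zero,
        Nat.and_two_pow_sub_one_eq_mod, Nat.mod_eq_of_lt (a := v / 8192) (by omega)]
      norm_num
    have f4 : v &&& 8191 = v % 8192 := Nat.and_two_pow_sub_one_eq_mod v 13
    refine ⟨v / 8192 + 2 ^ 40 * H, (v % 8192 : ℕ) * t₀ + r', (v / 8192 : ℕ) * t₀ + s',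
      ?_, ?_, ?_, ?_⟩
    · rw [h2, f1, land_split hv (by norm_num), e1, f3]
      ring
    · exact ⟨v / 8192, H, s', by omega, rfl, e2, rfl⟩
    · refine ⟨v % 8192, _, r', by omega, ?_, e3, rfl⟩
      rw [h2, f2, land_split hv (by norm_num), f4]
    · have g : (v : ZMod 8191) = (v % 8192 : ℕ) + (v / 8192 : ℕ) := by
        have g1 : ((v % 8192 + 8192 * (v / 8192) : ℕ) : ZMod 8191) = v := by rw [Nat.mod_add_div]
        rw [← g1]
        push_cast
        have g2 : (8192 : ZMod 8191) = 1 := by decide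
        rw [g2, one_mul]
      rw [h4, e4, g]
      ring

theorem Rep.fold {b : ℕ} (hb : b < 2 ^ 40) {ts N t} (hn : ts.length ≤ 512) (h : Rep b ts N t) :
    Rep (8191 + b / 8192) ts (GKF.fold N) t := by
  obtain ⟨H, r, s, e1, e2, e3, e4⟩ := h.land hb 512 hn
  have : GKF.fold N = (N &&& (ones 512 * 8191)) + H := by
    have g : GKF.fold N = (N &&& lowMask) + (N &&& highMask) >>> 13 := rfl
    rw [g, masks_eq.1, masks_eq.2, e1, Nat.shiftRight_eq_div_pow]
    norm_num
  rw [this, e4]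
  exact e3.add e2

theorem Rep.red {b : ℕ} (hb : b < 2 ^ 40) {ts N t} (hn : ts.length ≤ 512) (h : Rep b ts N t) :
    Rep 32768 ts (GKF.red N) t := by
  refine ((h.fold hb hn).fold ?_ hn).mono ?_ <;> omega

/-- The inverse modulo `8191`, by Fermat's little theorem. -/
def inv (n : Nat) : Nat := Nat.mod (Nat.pow n 8189) 8191

theorem inv_lt (n : ℕ) : inv n < 8191 := Nat.mod_lt _ (by norm_num)

theorem cast_inv_mul {n : ℕ} (h : (n : ZMod 8191) ≠ 0) : (inv n : ZMod 8191) * n = 1 := by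
  have h1 : inv n = n ^ 8189 % 8191 := rfl
  rw [h1, ZMod.natCast_mod, Nat.cast_pow, ← pow_succ]
  exact ZMod.pow_card_sub_one_eq_one h

theorem cast_sub_8191 {c : ℕ} (h : c ≤ 8191) : ((8191 - c : ℕ) : ZMod 8191) = -c := by
  rw [Nat.cast_sub h, ZMod.natCast_self, zero_sub]

theorem Rep.eq_zero {b : ℕ} : ∀ {ts : List (ZMod 8191)} {M s}, Rep b ts M s → (∀ t ∈ ts, t = 0) →
    s = 0
  | [], _, _, h, _ => h.2
  | t :: ts, _, _, ⟨v, M', s', _, _, h3, h4⟩, h => by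
    rw [h4, h3.eq_zero fun t ht => h t (by simp [ht]), h t (by simp), mul_zero, add_zero]

/-! ### Gaussian elimination -/

/-- Eliminates the first unknown from the equations `l` with the help of the equation `P`. -/
def elimStep (P : Nat) (l : List Nat) : List Nat :=
  List.rec [] (fun N _ ih => force (Nat.shiftRight (Nat.add N (Nat.mul (Nat.sub 8191
    (Nat.mod (Nat.mod N (Nat.pow 2 40)) 8191)) P)) 40) (fun N' => N' :: ih)) l

/-- Whether elimination with pivots in the given order leaves no unknown among the first `n`. -/
def elim (n : Nat) : List Nat → Bool :=
  Nat.rec (motive := fun _ => List Nat → Bool) (fun _ => true)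
    (fun _ ih l => List.rec false (fun r rs _ => force (red r) fun r =>
      force (red (Nat.mul (inv (Nat.mod r (Nat.pow 2 40))) r)) fun P =>
        and (Nat.beq (Nat.mod (Nat.mod P (Nat.pow 2 40)) 8191) 1) (ih (elimStep P rs))) l) n

theorem elimStep_cons (P N : ℕ) (l : List ℕ) : elimStep P (N :: l) =
    ((N + (8191 - N % 2 ^ 40 % 8191) * P) >>> 40) :: elimStep P l := by
  have e : elimStep P (N :: l) = force (Nat.shiftRight (Nat.add N (Nat.mul (Nat.sub 8191
    (Nat.mod (Nat.mod N (Nat.pow 2 40)) 8191)) P)) 40) fun N' => N' :: elimStep P l := rfl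
  rw [e, force_eq]
  rfl

theorem elim_succ_cons (n r : ℕ) (rs : List ℕ) : elim (n + 1) (r :: rs) =
    and (Nat.beq (Nat.mod (Nat.mod (red (Nat.mul (inv (Nat.mod (red r) (Nat.pow 2 40))) (red r)))
      (Nat.pow 2 40)) 8191) 1)
      (elim n (elimStep (red (Nat.mul (inv (Nat.mod (red r) (Nat.pow 2 40))) (red r))) rs)) := by
  have e : elim (n + 1) (r :: rs) = force (red r) fun r =>
      force (red (Nat.mul (inv (Nat.mod r (Nat.pow 2 40))) r)) fun P =>
        and (Nat.beq (Nat.mod (Nat.mod P (Nat.pow 2 40)) 8191) 1) (elim n (elimStep P rs)) := rfl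
  rw [e, force_eq, force_eq]

/-- Elimination adds at most `8191` times the pivot row, whose digits are at most `32768`;
`268402688` is the product. -/
theorem elimStep_rep {b : ℕ} (hb : b + 268402688 < 2 ^ 40) {t₀ : ZMod 8191}
    {ts : List (ZMod 8191)} {P : ℕ} (hP : Rep 32768 (t₀ :: ts) P 0)
    (h1 : P % 2 ^ 40 % 8191 = 1) : ∀ {l : List ℕ}, (∀ N ∈ l, Rep b (t₀ :: ts) N 0) →
      ∀ N ∈ elimStep P l, Rep (b + 268402688) ts N 0
  | [], _, N, hN => by simp [elimStep] at hN
  | N₀ :: l, hl, N, hN => by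
    rw [elimStep_cons, List.mem_cons] at hN
    rcases hN with rfl | hN
    swap
    · exact elimStep_rep hb hP h1 (fun N hN => hl N (by simp [hN])) N hN
    obtain ⟨v, M, s, g1, g2, g3, g4⟩ := hP
    obtain ⟨v', M', s', g1', g2', g3', g4'⟩ := hl N₀ (by simp)
    have hv : P % 2 ^ 40 = v := by omega
    have hv' : N₀ % 2 ^ 40 = v' := by omega
    rw [hv] at h1
    rw [hv']
    set c := 8191 - v' % 8191 with hc
    have hcv : c * v ≤ 8191 * 32768 := Nat.mul_le_mul (by omega) g1
    have e1 : (N₀ + c * P) >>> 40 = M' + c * M := by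
      rw [Nat.shiftRight_eq_div_pow, g2, g2', show v' + 2 ^ 40 * M' + c * (v + 2 ^ 40 * M) =
        (v' + c * v) + 2 ^ 40 * (M' + c * M) by ring, Nat.add_mul_div_left _ _ (by norm_num),
        Nat.div_eq_of_lt (by omega), zero_add]
    -- the leading coefficient of the pivot row is `1` modulo `8191`, though perhaps not as a number
    have e2 : (v : ZMod 8191) = 1 := by
      rw [← ZMod.natCast_mod, h1, Nat.cast_one]
    have e3 : (c : ZMod 8191) = -v' := by
      rw [hc, cast_sub_8191 (by omega), ZMod.natCast_mod]
    rw [e1]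
    refine ((g3'.add (g3.mul c)).mono (by omega)).congr ?_
    rw [e3]
    rw [e2] at g4
    linear_combination (v' : ZMod 8191) * g4 - g4'

/-- If elimination succeeds, then the system has only the trivial solution. Digits grow by
`268402688` in each step, and are reduced only in pivot rows; the hypothesis on `b` excludes
overflow. -/
theorem eq_zero_of_elim : ∀ {n b : ℕ} {ts : List (ZMod 8191)} {l : List ℕ},
    b + n * (268402688) < 2 ^ 40 → n ≤ 512 → ts.length ≤ n → (∀ N ∈ l, Rep b ts N 0) →
      elim n l = true → ∀ t ∈ ts, t = 0
  | _, _, [], _, _, _, _, _, _, t, ht => by simp at ht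
  | 0, _, _ :: _, _, _, _, h, _, _, _, _ => by simp at h
  | n + 1, _, _ :: _, [], _, _, _, _, h, _, _ => by simp [elim] at h
  | n + 1, b, t₀ :: ts, r :: rs, hb, hn, hts, hl, h, t, ht => by
    have hb1 : b < 2 ^ 40 := by omega
    have hb2 : b + 268402688 + n * (268402688) < 2 ^ 40 := by omega
    have hb3 : b + 268402688 < 2 ^ 40 := by omega
    have hn1 : n ≤ 512 := by omega
    rw [elim_succ_cons, Bool.and_eq_true] at h
    obtain ⟨h0, h⟩ := h
    have hts' : (t₀ :: ts).length ≤ 512 := hts.trans hn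
    have h1 := (hl r (by simp)).red hb1 hts'
    have h2 : Rep 32768 (t₀ :: ts) (red (Nat.mul (inv (Nat.mod (red r) (Nat.pow 2 40))) (red r)))
        ((inv (Nat.mod (red r) (Nat.pow 2 40)) : ℕ) * 0) :=
      (h1.mul (inv (Nat.mod (red r) (Nat.pow 2 40)))).red (lt_of_le_of_lt
        (Nat.mul_le_mul_right 32768 (inv_lt (Nat.mod (red r) (Nat.pow 2 40))).le) (by norm_num))
        hts'
    rw [mul_zero] at h2
    generalize red (Nat.mul (inv (Nat.mod (red r) (Nat.pow 2 40))) (red r)) = P at h0 h h2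
    have h0' : P % 2 ^ 40 % 8191 = 1 := Nat.eq_of_beq_eq_true h0
    have h3 : ∀ N ∈ elimStep P rs, Rep (b + 268402688) ts N 0 :=
      elimStep_rep hb3 h2 h0' fun N (hN : N ∈ rs) => hl N (by simp [hN])
    have h4 := eq_zero_of_elim (n := n) (b := b + 268402688) hb2 hn1
      (by simpa using hts) h3 h
    rcases List.mem_cons.1 ht with rfl | ht
    · obtain ⟨v, M, s, g1, g2, g3, g4⟩ := h2
      have hv : P % 2 ^ 40 = v := by omega
      rw [hv] at h0'
      have e2 : (v : ZMod 8191) = 1 := by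
        rw [← ZMod.natCast_mod, h0', Nat.cast_one]
      rw [g3.eq_zero h4, e2] at g4
      simpa using g4.symm
    · exact h4 t ht

/-! ### Relations between the values on lists of monomials -/

/-- `c` encodes a monomial of degree `3` to `20`. -/
def ValidCode (c : ℕ) : Prop := 3 ≤ c / 32 ∧ c % 32 ≤ c / 32 ∧ c / 32 ≤ 20

/-- All members of `u` encode monomials of degrees `3` to `20`. -/
def Valid (u : List ℕ) : Prop := ∀ c ∈ u, ValidCode c

theorem Valid.cons {c : ℕ} {u : List ℕ} (h : ValidCode c) (hu : Valid u) : Valid (c :: u) :=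
  fun x hx => by
    rcases List.mem_cons.1 hx with rfl | hx
    · exact h
    · exact hu x hx

theorem Valid.head {c : ℕ} {u : List ℕ} (h : Valid (c :: u)) : ValidCode c := h c (by simp)

theorem Valid.tail {c : ℕ} {u : List ℕ} (h : Valid (c :: u)) : Valid u :=
  fun x hx => h x (by simp [hx])

theorem Valid.append {u v : List ℕ} (hu : Valid u) (hv : Valid v) : Valid (u ++ v) :=
  fun x hx => (List.mem_append.1 hx).elim (hu x) (hv x)

theorem Valid.left {u v : List ℕ} (h : Valid (u ++ v)) : Valid u :=
  fun x hx => h x (by simp [hx])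

theorem Valid.right {u v : List ℕ} (h : Valid (u ++ v)) : Valid v :=
  fun x hx => h x (by simp [hx])

/-- `∑ j, i_j τ(…, q^(i_j - 1) p^(l_j - i_j + 1), …)`, the action of the derivation `q ↦ p`. -/
def lowSum {M : Type*} [AddCommGroup M] : (List ℕ → M) → List ℕ → M
  | _, [] => 0
  | τ, c :: u => (c % 32) • τ ((c - 1) :: u) + lowSum (fun v => τ (c :: v)) u

/-- `∑ j, (l_j - i_j) τ(…, q^(i_j + 1) p^(l_j - i_j - 1), …)`, the action of the derivation
`p ↦ q`. -/
def raiseSum {M : Type*} [AddCommGroup M] : (List ℕ → M) → List ℕ → M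
  | _, [] => 0
  | τ, c :: u => (c / 32 - c % 32) • τ ((c + 1) :: u) + raiseSum (fun v => τ (c :: v)) u

/-- `∑ j, τ(…, {a, c_j}, …)`. -/
def bracketSum {M : Type*} [AddCommGroup M] (a : ℕ) : (List ℕ → M) → List ℕ → M
  | _, [] => 0
  | τ, c :: u => (((a % 32 * (c / 32) : ℕ) : ℤ) - (c % 32 * (a / 32) : ℕ)) • τ ((a + c - 65) :: u) +
      bracketSum a (fun v => τ (c :: v)) u

/-- The coboundary of `τ` on a list of monomials. -/
def dSum {M : Type*} [AddCommGroup M] : (List ℕ → M) → List ℕ → M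
  | _, [] => 0
  | τ, a :: u => -bracketSum a τ u - dSum (fun v => τ (a :: v)) u

/-- Antisymmetry under exchange of neighbours. -/
def Swap {M : Type*} [AddCommGroup M] (τ : List ℕ → M) : Prop :=
  ∀ pre a b post, τ (pre ++ a :: b :: post) = -τ (pre ++ b :: a :: post)

theorem Swap.append {M : Type*} [AddCommGroup M] {τ : List ℕ → M} (h : Swap τ) (l : List ℕ) :
    Swap fun v => τ (l ++ v) := fun pre a b post => by
  simpa using h (l ++ pre) a b post

theorem Swap.adjacent {τ : List ℕ → ZMod 8191} (h : Swap τ) (pre : List ℕ) (a : ℕ)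
    (post : List ℕ) : τ (pre ++ a :: a :: post) = 0 := by
  have h1 := h pre a a post
  have h2 : (2 : ZMod 8191) * τ (pre ++ a :: a :: post) = 0 := by linear_combination h1
  exact (mul_eq_zero.1 h2).resolve_left (by decide)

/-- Moving an entry past a list costs a sign. -/
theorem Swap.move {τ : List ℕ → ZMod 8191} (h : Swap τ) : ∀ (l pre : List ℕ) (x : ℕ)
    (post : List ℕ), τ (pre ++ (l ++ x :: post)) = (-1) ^ l.length * τ (pre ++ x :: (l ++ post))
  | [], _, _, _ => by simp
  | c :: l, pre, x, post => by
    have h1 := h.move l (pre ++ [c]) x post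
    simp only [List.append_assoc, List.singleton_append] at h1
    rw [List.cons_append, h1, h pre c x, List.length_cons, pow_succ, List.cons_append]
    ring

theorem Swap.of_mem {τ : List ℕ → ZMod 8191} (h : Swap τ) (pre : List ℕ) {a : ℕ} {l : List ℕ}
    (ha : a ∈ l) : τ (pre ++ a :: l) = 0 := by
  obtain ⟨s, t, rfl⟩ := List.append_of_mem ha
  have := h.move s (pre ++ [a]) a t
  simp only [List.append_assoc, List.singleton_append] at this
  rw [this, h.adjacent, mul_zero]

/-! ### Straightening -/

/-- The list of digits `l` in base `1024`. -/
def pack (l : List Nat) : Nat := List.rec 0 (fun a _ ih => Nat.add a (Nat.mul 1024 ih)) l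

theorem pack_nil : pack [] = 0 := rfl

theorem pack_cons (a : ℕ) (l : List ℕ) : pack (a :: l) = a + 1024 * pack l := rfl

theorem pack_append (l m : List ℕ) : pack (l ++ m) = pack l + 1024 ^ l.length * pack m := by
  induction l with
  | nil => simp [pack_nil]
  | cons a l ih => rw [List.cons_append, pack_cons, pack_cons, ih, List.length_cons]; ring

/-- The part of `lowSum` for the digits `y` of `z`, starting at the place `pw`; terms that vanish by
antisymmetry are left out. -/
def lowLoop (f : Nat → Nat) (z B : Nat) (n : Nat) : Nat → Nat → Nat :=
  Nat.rec (motive := fun _ => Nat → Nat → Nat) (fun _ _ => 0)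
    (fun _ ih y pw =>
      force (Nat.mod y 1024) fun r => force (Nat.div y 1024) fun y' =>
      cond (or (Nat.beq (Nat.mod r 32) 0)
        (or (Nat.beq (Nat.succ (Nat.mod y' 1024)) r) (Nat.beq (Nat.succ B) r)))
        (ih y' (Nat.mul pw 1024))
        (Nat.add (Nat.mul (Nat.mod r 32) (force (Nat.sub z pw) f)) (ih y' (Nat.mul pw 1024)))) n

/-- The part of `raiseSum` for the digits `y` of `z`, starting at the place `pw`; terms that vanish
by antisymmetry are left out. -/
def upLoop (f : Nat → Nat) (z : Nat) (n : Nat) : Nat → Nat → Nat → Nat :=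
  Nat.rec (motive := fun _ => Nat → Nat → Nat → Nat) (fun _ _ _ => 0)
    (fun _ ih y pw prev =>
      force (Nat.mod y 1024) fun r => force (Nat.div y 1024) fun y' =>
      cond (or (Nat.beq (Nat.mod r 32) (Nat.div r 32)) (Nat.beq (Nat.succ r) prev))
        (ih y' (Nat.mul pw 1024) r)
        (Nat.add (Nat.mul (Nat.sub (Nat.div r 32) (Nat.mod r 32)) (force (Nat.add z pw) f))
          (ih y' (Nat.mul pw 1024) r))) n

theorem lowLoop_succ (f : ℕ → ℕ) (z B n r p pw : ℕ) (hr : r < 1024) :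
    lowLoop f z B (n + 1) (r + 1024 * p) pw =
      if r % 32 = 0 ∨ p % 1024 + 1 = r ∨ B + 1 = r then lowLoop f z B n p (pw * 1024)
      else r % 32 * f (z - pw) + lowLoop f z B n p (pw * 1024) := by
  have e : ∀ y, lowLoop f z B (n + 1) y pw = force (Nat.mod y 1024) fun r =>
      force (Nat.div y 1024) fun y' =>
      cond (or (Nat.beq (Nat.mod r 32) 0)
        (or (Nat.beq (Nat.succ (Nat.mod y' 1024)) r) (Nat.beq (Nat.succ B) r)))
        (lowLoop f z B n y' (Nat.mul pw 1024))
        (Nat.add (Nat.mul (Nat.mod r 32) (force (Nat.sub z pw) f))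
          (lowLoop f z B n y' (Nat.mul pw 1024))) := fun _ => rfl
  have h1 : Nat.mod (r + 1024 * p) 1024 = r := by
    show (r + 1024 * p) % 1024 = r
    omega
  have h2 : Nat.div (r + 1024 * p) 1024 = p := by
    show (r + 1024 * p) / 1024 = p
    omega
  rw [e, force_eq, force_eq, force_eq, h1, h2]
  simp only [Bool.cond_eq_ite, Bool.or_eq_true, Nat.beq_eq]
  rfl

theorem upLoop_succ (f : ℕ → ℕ) (z n r p pw prev : ℕ) (hr : r < 1024) :
    upLoop f z (n + 1) (r + 1024 * p) pw prev =
      if r % 32 = r / 32 ∨ r + 1 = prev then upLoop f z n p (pw * 1024) r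
      else (r / 32 - r % 32) * f (z + pw) + upLoop f z n p (pw * 1024) r := by
  have e : ∀ y, upLoop f z (n + 1) y pw prev = force (Nat.mod y 1024) fun r =>
      force (Nat.div y 1024) fun y' =>
      cond (or (Nat.beq (Nat.mod r 32) (Nat.div r 32)) (Nat.beq (Nat.succ r) prev))
        (upLoop f z n y' (Nat.mul pw 1024) r)
        (Nat.add (Nat.mul (Nat.sub (Nat.div r 32) (Nat.mod r 32)) (force (Nat.add z pw) f))
          (upLoop f z n y' (Nat.mul pw 1024) r)) := fun _ => rfl
  have h1 : Nat.mod (r + 1024 * p) 1024 = r := by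
    show (r + 1024 * p) % 1024 = r
    omega
  have h2 : Nat.div (r + 1024 * p) 1024 = p := by
    show (r + 1024 * p) / 1024 = p
    omega
  rw [e, force_eq, force_eq, force_eq, h1, h2]
  simp only [Bool.cond_eq_ite, Bool.or_eq_true, Nat.beq_eq]
  rfl

theorem lowLoop_rep {f : ℕ → ℕ} {ts : List (ZMod 8191)} {τ : List ℕ → ZMod 8191} (hτ : Swap τ)
    {A B b : ℕ} {D : List ℕ} (hf : ∀ l, l.map (· / 32) = D → Valid l → l.Pairwise (· > ·) →
      Rep b ts (f (pack (A :: B :: l))) (τ (A :: B :: l))) : ∀ (post pre : List ℕ),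
      (pre ++ post).map (· / 32) = D → Valid (pre ++ post) → (pre ++ post).Pairwise (· > ·) →
      Rep (post.length * (31 * b)) ts
        (lowLoop f (pack (A :: B :: (pre ++ post))) B post.length (pack post)
          (1024 ^ (2 + pre.length)))
        (lowSum (fun v => τ (A :: B :: (pre ++ v))) post)
  | [], pre, _, _, _ => Rep.zero _ _
  | r :: post, pre, hD, hv, hs => by
    have ih := lowLoop_rep hτ hf post (pre ++ [r]) (by simpa using hD) (by simpa using hv)
      (by simpa using hs)
    have hr : ValidCode r := hv r (by simp)
    rw [List.length_cons, pack_cons r post, lowLoop_succ _ _ _ _ _ _ _ (by have := hr.2.2; omega),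
      lowSum]
    simp only [List.append_assoc, List.singleton_append, List.length_append, List.length_singleton,
      ← add_assoc, pow_succ (1024 : ℕ) (2 + pre.length)] at ih
    have hs' := (List.pairwise_append.1 hs)
    have hs2 := List.pairwise_cons.1 hs'.2.1
    split_ifs with hc
    · have h0 : (r % 32) • τ (A :: B :: (pre ++ (r - 1) :: post)) = 0 := by
        rcases hc with hc | hc | hc
        · rw [hc, zero_smul]
        · cases post with
          | nil =>
            rw [pack_nil] at hc
            have := hr.1
            omega
          | cons e post =>
            have he : ValidCode e := hv e (by simp)
            rw [pack_cons] at hc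
            have : e = r - 1 := by have := he.2.2; omega
            rw [this]
            have h1 := hτ.adjacent (A :: B :: pre) (r - 1) post
            rw [List.cons_append, List.cons_append] at h1
            rw [h1, smul_zero]
        · have h1 := hτ.of_mem [A] (a := B) (l := pre ++ (r - 1) :: post)
            (by simp; right; left; omega)
          rw [List.singleton_append] at h1
          rw [h1, smul_zero]
      rw [h0, zero_add]
      exact ih.mono (Nat.mul_le_mul_right _ (Nat.le_succ _))
    · push Not at hc
      have hlist : Rep b ts (f (pack (A :: B :: (pre ++ (r - 1) :: post))))
          (τ (A :: B :: (pre ++ (r - 1) :: post))) := by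
        refine hf _ ?_ ?_ ?_
        · rw [← hD, List.map_append, List.map_append, List.map_cons, List.map_cons,
            show (r - 1) / 32 = r / 32 by omega]
        · refine hv.left.append (Valid.cons ?_ hv.right.tail)
          obtain ⟨h1, h2, h3⟩ := hr
          refine ⟨?_, ?_, ?_⟩ <;> omega
        · refine List.pairwise_append.2 ⟨hs'.1, List.pairwise_cons.2 ⟨fun e he => ?_, hs2.2⟩,
            fun a ha e he => ?_⟩
          · cases post with
            | nil => simp at he
            | cons e' post =>
              have he' : ValidCode e' := hv e' (by simp)
              have h1 := hs2.1 e' (by simp)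
              have h2 := hc.2.1
              rw [pack_cons] at h2
              have h3 : e' < r - 1 := by have := he'.2.2; omega
              rcases List.mem_cons.1 he with rfl | he
              · exact h3
              · have := (List.pairwise_cons.1 hs2.2).1 e he
                omega
          · have h1 := hs'.2.2 a ha r (by simp)
            rcases List.mem_cons.1 he with rfl | he
            · omega
            · exact hs'.2.2 a ha e (by simp [he])
      have hz : pack (A :: B :: (pre ++ r :: post)) - 1024 ^ (2 + pre.length) =
          pack (A :: B :: (pre ++ (r - 1) :: post)) := by
        simp only [pack_cons, pack_append]
        obtain ⟨r, rfl⟩ : ∃ r', r = r' + 1 := ⟨r - 1, by omega⟩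
        rw [Nat.add_sub_cancel]
        refine Nat.sub_eq_of_eq_add ?_
        ring
      rw [hz, Nat.succ_mul, add_comm _ (31 * b), nsmul_eq_mul]
      exact ((hlist.mul (r % 32)).mono (Nat.mul_le_mul_right _ (by omega))).add ih

theorem upLoop_rep {f : ℕ → ℕ} {ts : List (ZMod 8191)} {τ : List ℕ → ZMod 8191} (hτ : Swap τ)
    {A B b : ℕ} {D : List ℕ} (hf : ∀ l, l.map (· / 32) = D → Valid l → l.Pairwise (· > ·) →
      Rep b ts (f (pack (A :: B :: l))) (τ (A :: B :: l))) : ∀ (post pre : List ℕ) (prev : ℕ),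
      (pre = [] ∧ prev = A ∨ ∃ pre', pre = pre' ++ [prev]) →
      (pre ++ post).map (· / 32) = D → Valid (pre ++ post) → (pre ++ post).Pairwise (· > ·) →
      Rep (post.length * (31 * b)) ts
        (upLoop f (pack (A :: B :: (pre ++ post))) post.length (pack post)
          (1024 ^ (2 + pre.length)) prev)
        (raiseSum (fun v => τ (A :: B :: (pre ++ v))) post)
  | [], pre, _, _, _, _, _ => Rep.zero _ _
  | r :: post, pre, prev, hp, hD, hv, hs => by
    have ih := upLoop_rep hτ hf post (pre ++ [r]) r (Or.inr ⟨pre, rfl⟩) (by simpa using hD)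
      (by simpa using hv) (by simpa using hs)
    have hr : ValidCode r := hv r (by simp)
    rw [List.length_cons, pack_cons r post, upLoop_succ _ _ _ _ _ _ _ (by have := hr.2.2; omega),
      raiseSum]
    simp only [List.append_assoc, List.singleton_append, List.length_append, List.length_singleton,
      ← add_assoc, pow_succ (1024 : ℕ) (2 + pre.length)] at ih
    have hs' := (List.pairwise_append.1 hs)
    have hs2 := List.pairwise_cons.1 hs'.2.1
    split_ifs with hc
    · have h0 : (r / 32 - r % 32) • τ (A :: B :: (pre ++ (r + 1) :: post)) = 0 := by
        rcases hc with hc | hc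
        · rw [hc, Nat.sub_self, zero_smul]
        · rcases hp with ⟨rfl, h2⟩ | ⟨pre', rfl⟩
          · have h1 := hτ.of_mem [] (a := A) (l := B :: (r + 1) :: post) (by simp; omega)
            rw [List.nil_append] at h1
            rw [List.nil_append, h1, smul_zero]
          · have h1 := hτ.adjacent (A :: B :: pre') prev post
            rw [List.cons_append, List.cons_append] at h1
            rw [List.append_assoc, List.singleton_append, hc, h1, smul_zero]
      rw [h0, zero_add]
      exact ih.mono (Nat.mul_le_mul_right _ (Nat.le_succ _))
    · push Not at hc
      obtain ⟨h1, h2, h3⟩ := hr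
      have hlist : Rep b ts (f (pack (A :: B :: (pre ++ (r + 1) :: post))))
          (τ (A :: B :: (pre ++ (r + 1) :: post))) := by
        refine hf _ ?_ ?_ ?_
        · rw [← hD, List.map_append, List.map_append, List.map_cons, List.map_cons,
            show (r + 1) / 32 = r / 32 by omega]
        · refine hv.left.append (Valid.cons ?_ hv.right.tail)
          refine ⟨?_, ?_, ?_⟩ <;> omega
        · refine List.pairwise_append.2 ⟨hs'.1, List.pairwise_cons.2 ⟨fun e he => ?_, hs2.2⟩,
            fun a ha e he => ?_⟩
          · have := hs2.1 e he
            omega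
          · rcases List.mem_cons.1 he with rfl | he
            · have h4 := hs'.2.2 a ha r (by simp)
              rcases hp with ⟨rfl, -⟩ | ⟨pre', rfl⟩
              · simp at ha
              · have h5 := hs'.2.2 prev (by simp) r (by simp)
                rcases List.mem_append.1 ha with ha | ha
                · have := (List.pairwise_append.1 hs'.1).2.2 a ha prev (by simp)
                  omega
                · rw [List.mem_singleton] at ha
                  omega
            · exact hs'.2.2 a ha e (by simp [he])
      have hz : pack (A :: B :: (pre ++ r :: post)) + 1024 ^ (2 + pre.length) =
          pack (A :: B :: (pre ++ (r + 1) :: post)) := by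
        simp only [pack_cons, pack_append]
        ring
      rw [hz, Nat.succ_mul, add_comm _ (31 * b), nsmul_eq_mul]
      exact ((hlist.mul (r / 32 - r % 32)).mono (Nat.mul_le_mul_right _ (by omega))).add ih

/-- Expresses the value at `[A, B, …]`, where `A` is a power of `q`, through values at lists where
moreover `B` is a power of `p`, lowering the exponent `n` of `q` in `B` with `raiseSum`. -/
def straightenB (k : Nat) (u : Nat → Nat) (n : Nat) : Nat → Nat :=
  Nat.rec (motive := fun _ => Nat → Nat) u
    (fun _ ih x => force (Nat.mod (Nat.div x 1024) 1024) fun b =>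
      red (Nat.mul (Nat.sub 8191 (inv (Nat.succ (Nat.sub (Nat.div b 32) (Nat.mod b 32)))))
        (upLoop ih (Nat.sub x 1024) (Nat.sub k 2) (Nat.div x 1048576) 1048576 (Nat.mod x 1024)))) n

/-- Expresses the value at `[A, B, …]` through values at lists where `A` is a power of `q` and `B`
is a power of `p`, lowering the exponent `n` of `p` in `A` with `lowSum`. -/
def straightenA (k : Nat) (u : Nat → Nat) (n : Nat) : Nat → Nat :=
  Nat.rec (motive := fun _ => Nat → Nat)
    (fun x => force (Nat.mod (Nat.div x 1024) 32) fun i => straightenB k u i x)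
    (fun _ ih x =>
      red (Nat.mul (Nat.sub 8191 (inv (Nat.succ (Nat.mod x 32))))
        (force (Nat.mod (Nat.div x 1024) 1024) fun B => Nat.add
          (cond (Nat.beq (Nat.mod B 32) 0) 0 (Nat.mul (Nat.mod B 32) (force (Nat.sub x 1023) ih)))
          (lowLoop ih (Nat.succ x) B (Nat.sub k 2) (Nat.div x 1048576) 1048576)))) n

/-- Expresses the value at the list `x` through values at lists that begin with a power of `q` and a
power of `p`. -/
def straighten (k : Nat) (u : Nat → Nat) (x : Nat) : Nat :=
  force (Nat.sub (Nat.mod (Nat.div x 32) 32) (Nat.mod x 32)) fun i => straightenA k u i x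

/-- `[A, B] ++ l` consists of monomials of degrees `D`, and `l` is decreasing. -/
def Shape (D : List ℕ) (A B : ℕ) (l : List ℕ) : Prop :=
  (A :: B :: l).map (· / 32) = D ∧ Valid (A :: B :: l) ∧ l.Pairwise (· > ·)

theorem cast_ne_zero {n : ℕ} (h0 : n ≠ 0) (h : n < 8191) : (n : ZMod 8191) ≠ 0 := by
  rw [Ne, ZMod.natCast_eq_zero_iff]
  exact fun h1 => absurd (Nat.le_of_dvd (by omega) h1) (by omega)

theorem pack_digits {A B : ℕ} (hA : ValidCode A) (hB : ValidCode B) (l : List ℕ) :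
    pack (A :: B :: l) % 1024 = A ∧ pack (A :: B :: l) / 1024 % 1024 = B ∧
      pack (A :: B :: l) / 1048576 = pack l := by
  obtain ⟨-, -, h1⟩ := hA
  obtain ⟨-, -, h2⟩ := hB
  simp only [pack_cons]
  omega

theorem straightenB_rep {k : ℕ} {u : ℕ → ℕ} {ts : List (ZMod 8191)} (hts : ts.length ≤ 512)
    {τ : List ℕ → ZMod 8191} (hτ : Swap τ) (hk : k ≤ 18)
    (hraise : ∀ v, Valid v → v.length = k → raiseSum τ v = 0) {D : List ℕ} (hD : D.length = k)
    (hu : ∀ A B l, Shape D A B l → A % 32 = A / 32 → B % 32 = 0 →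
      Rep 32768 ts (u (pack (A :: B :: l))) (τ (A :: B :: l))) :
    ∀ (n A B : ℕ) (l : List ℕ), Shape D A B l → A % 32 = A / 32 → B % 32 = n →
      Rep 32768 ts (straightenB k u n (pack (A :: B :: l))) (τ (A :: B :: l))
  | 0, A, B, l, h, hA, hB => hu A B l h hA hB
  | n + 1, A, B, l, h, hA, hB => by
    obtain ⟨h1, h2, h3⟩ := h
    have hvB := h2.tail.head
    obtain ⟨e1, e2, e3⟩ := pack_digits h2.head hvB l
    have hlen : l.length + 2 = k := by rw [← hD, ← h1]; simp
    have e : straightenB k u (n + 1) (pack (A :: B :: l)) =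
        force (pack (A :: B :: l) / 1024 % 1024) fun b =>
          red ((8191 - inv (b / 32 - b % 32 + 1)) * upLoop (straightenB k u n)
            (pack (A :: B :: l) - 1024) (k - 2) (pack (A :: B :: l) / 1048576) 1048576
              (pack (A :: B :: l) % 1024)) := rfl
    have e4 : pack (A :: B :: l) - 1024 = pack (A :: (B - 1) :: l) := by
      simp only [pack_cons]; omega
    have hvB' : ValidCode (B - 1) := by
      obtain ⟨g1, g2, g3⟩ := hvB
      refine ⟨?_, ?_, ?_⟩ <;> omega
    rw [e, force_eq, e1, e2, e3, e4, show k - 2 = l.length by omega]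
    have hrec := upLoop_rep (A := A) (B := B - 1) (D := l.map (· / 32)) (b := 32768)
      (f := straightenB k u n) (ts := ts) hτ (fun l' hl' hv' hs' =>
        straightenB_rep hts hτ hk hraise hD hu n A (B - 1) l'
          ⟨by rw [← h1]; simp only [List.map_cons, hl', List.cons.injEq, and_true, true_and]; omega,
            Valid.cons h2.head (Valid.cons hvB' hv'), hs'⟩ hA (by omega))
      l [] A (Or.inl ⟨rfl, rfl⟩) rfl h2.tail.tail h3
    rw [List.nil_append] at hrec
    -- the relation `raiseSum = 0` at the list with `B - 1` contains the value at `A :: B :: l`; the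
    -- term in which `A` is raised vanishes, `A` being a power of `q`
    have hrel := hraise (A :: (B - 1) :: l)
      (Valid.cons h2.head (Valid.cons hvB' h2.tail.tail)) (by simpa using hlen)
    rw [raiseSum, raiseSum, hA, Nat.sub_self, zero_smul, zero_add, Nat.sub_add_cancel (by omega),
      nsmul_eq_mul, show (B - 1) / 32 - (B - 1) % 32 = B / 32 - B % 32 + 1 by
        have := hvB.2.1
        have : (B - 1) / 32 = B / 32 := by omega
        omega] at hrel
    have hne : ((B / 32 - B % 32 + 1 : ℕ) : ZMod 8191) ≠ 0 :=
      cast_ne_zero (by omega) (by have := hvB.2.2; omega)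
    refine ((hrec.mul _).red ?_ hts).congr ?_
    · calc (8191 - inv (B / 32 - B % 32 + 1)) * (l.length * (31 * 32768))
          ≤ 8191 * (18 * (31 * 32768)) :=
            Nat.mul_le_mul (Nat.sub_le _ _) (Nat.mul_le_mul_right _ (by omega))
        _ < 2 ^ 40 := by norm_num
    · rw [cast_sub_8191 (inv_lt _).le]
      simp only [List.nil_append]
      linear_combination (-(inv (B / 32 - B % 32 + 1) : ZMod 8191)) * hrel +
        τ (A :: B :: l) * cast_inv_mul hne

theorem straightenA_rep {k : ℕ} {u : ℕ → ℕ} {ts : List (ZMod 8191)} (hts : ts.length ≤ 512)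
    {τ : List ℕ → ZMod 8191} (hτ : Swap τ) (hk : k ≤ 18)
    (hraise : ∀ v, Valid v → v.length = k → raiseSum τ v = 0)
    (hlow : ∀ v, Valid v → v.length = k → lowSum τ v = 0) {D : List ℕ} (hD : D.length = k)
    (hu : ∀ A B l, Shape D A B l → A % 32 = A / 32 → B % 32 = 0 →
      Rep 32768 ts (u (pack (A :: B :: l))) (τ (A :: B :: l))) :
    ∀ (n A B : ℕ) (l : List ℕ), Shape D A B l → A / 32 - A % 32 = n →
      Rep 32768 ts (straightenA k u n (pack (A :: B :: l))) (τ (A :: B :: l))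
  | 0, A, B, l, h, hA => by
    have e : straightenA k u 0 (pack (A :: B :: l)) =
        force (pack (A :: B :: l) / 1024 % 32) fun i =>
          straightenB k u i (pack (A :: B :: l)) := rfl
    have hvA := h.2.1.head
    rw [e, force_eq]
    refine straightenB_rep hts hτ hk hraise hD hu _ A B l h (by have := hvA.2.1; omega) ?_
    have := (pack_digits hvA h.2.1.tail.head l).2.1
    omega
  | n + 1, A, B, l, h, hA => by
    obtain ⟨h1, h2, h3⟩ := h
    have hvB := h2.tail.head
    obtain ⟨e1, e2, e3⟩ := pack_digits h2.head hvB l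
    have hlen : l.length + 2 = k := by rw [← hD, ← h1]; simp
    have e : ∀ x, straightenA k u (n + 1) x = red ((8191 - inv (x % 32 + 1)) *
        (force (x / 1024 % 1024) fun B => Nat.add
          (cond (Nat.beq (Nat.mod B 32) 0) 0 (Nat.mul (Nat.mod B 32)
            (force (Nat.sub x 1023) (straightenA k u n))))
          (lowLoop (straightenA k u n) (x + 1) B (k - 2) (x / 1048576) 1048576))) := fun _ => rfl
    have hvA := h2.head
    have hvA' : ValidCode (A + 1) := by
      obtain ⟨g1, g2, g3⟩ := hvA
      refine ⟨?_, ?_, ?_⟩ <;> omega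
    have e4 : pack (A :: B :: l) + 1 = pack ((A + 1) :: B :: l) := by
      simp only [pack_cons]; omega
    have e5 : pack (A :: B :: l) % 32 = A % 32 := by omega
    rw [e, force_eq, force_eq, e2, e3, e4, e5, show k - 2 = l.length by omega]
    have hstep : ∀ B' l', Shape D (A + 1) B' l' → Rep 32768 ts
        (straightenA k u n (pack ((A + 1) :: B' :: l'))) (τ ((A + 1) :: B' :: l')) :=
      fun B' l' hsh => straightenA_rep hts hτ hk hraise hlow hD hu n (A + 1) B' l' hsh (by
        have := hvA.2.1; have := hvA.2.2; omega)
    have hdA : (A + 1) / 32 = A / 32 := by have := hvA.2.2; omega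
    have hrec := lowLoop_rep (A := A + 1) (B := B) (D := l.map (· / 32)) (b := 32768)
      (f := straightenA k u n) (ts := ts) hτ (fun l' hl' hv' hs' => hstep B l'
          ⟨by rw [← h1]; simp only [List.map_cons, hl', hdA],
            Valid.cons hvA' (Valid.cons hvB hv'), hs'⟩)
      l [] rfl h2.tail.tail h3
    rw [List.nil_append] at hrec
    have hB : Rep (31 * 32768) ts (cond (Nat.beq (Nat.mod B 32) 0) 0 (Nat.mul (Nat.mod B 32)
        (straightenA k u n (Nat.sub (pack (A :: B :: l)) 1023))))
        ((B % 32 : ℕ) * τ ((A + 1) :: (B - 1) :: l)) := by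
      rw [Bool.cond_eq_ite]
      split_ifs with hc
      · have hc' : B % 32 = 0 := Nat.eq_of_beq_eq_true hc
        rw [hc', Nat.cast_zero, zero_mul]
        exact Rep.zero _ _
      · have hc' : B % 32 ≠ 0 := fun h0 => hc (by rw [show Nat.mod B 32 = 0 from h0]; rfl)
        have hvB' : ValidCode (B - 1) := by
          obtain ⟨g1, g2, g3⟩ := hvB
          refine ⟨?_, ?_, ?_⟩ <;> omega
        have e6 : Nat.sub (pack (A :: B :: l)) 1023 = pack ((A + 1) :: (B - 1) :: l) := by
          show pack (A :: B :: l) - 1023 = _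
          simp only [pack_cons]; omega
        rw [e6]
        refine ((hstep (B - 1) l ⟨?_, Valid.cons hvA' (Valid.cons hvB' h2.tail.tail), h3⟩).mul
          (B % 32)).mono (Nat.mul_le_mul_right _ (by omega))
        rw [← h1]
        simp only [List.map_cons, hdA, List.cons.injEq, and_true, true_and]
        omega
    -- the relation `lowSum = 0` at the list with `A + 1` contains the value at `A :: B :: l`
    have hrel := hlow ((A + 1) :: B :: l)
      (Valid.cons hvA' h2.tail) (by simpa using hlen)
    rw [lowSum, lowSum, Nat.add_sub_cancel, nsmul_eq_mul, nsmul_eq_mul,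
      show (A + 1) % 32 = A % 32 + 1 by have := hvA.2.1; have := hvA.2.2; omega] at hrel
    have hne : ((A % 32 + 1 : ℕ) : ZMod 8191) ≠ 0 := cast_ne_zero (by omega) (by omega)
    refine (((hB.add hrec).mul _).red ?_ hts).congr ?_
    · calc (8191 - inv (A % 32 + 1)) * (31 * 32768 + l.length * (31 * 32768))
          ≤ 8191 * (31 * 32768 + 18 * (31 * 32768)) :=
            Nat.mul_le_mul (Nat.sub_le _ _)
              (Nat.add_le_add_left (Nat.mul_le_mul_right _ (by omega)) _)
        _ < 2 ^ 40 := by norm_num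
    · rw [cast_sub_8191 (inv_lt _).le]
      simp only [List.nil_append]
      linear_combination (-(inv (A % 32 + 1) : ZMod 8191)) * hrel +
        τ (A :: B :: l) * cast_inv_mul hne

/-- All values at lists of degrees `D` are determined by those at lists that begin with a power of
`q` and a power of `p`. -/
theorem straighten_rep {k : ℕ} {u : ℕ → ℕ} {ts : List (ZMod 8191)} (hts : ts.length ≤ 512)
    {τ : List ℕ → ZMod 8191} (hτ : Swap τ) (hk : k ≤ 18)
    (hraise : ∀ v, Valid v → v.length = k → raiseSum τ v = 0)
    (hlow : ∀ v, Valid v → v.length = k → lowSum τ v = 0) {D : List ℕ} (hD : D.length = k)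
    (hu : ∀ A B l, Shape D A B l → A % 32 = A / 32 → B % 32 = 0 →
      Rep 32768 ts (u (pack (A :: B :: l))) (τ (A :: B :: l)))
    {A B : ℕ} {l : List ℕ} (h : Shape D A B l) :
    Rep 32768 ts (straighten k u (pack (A :: B :: l))) (τ (A :: B :: l)) := by
  have e : straighten k u (pack (A :: B :: l)) = force (pack (A :: B :: l) / 32 % 32 -
    pack (A :: B :: l) % 32) fun i => straightenA k u i (pack (A :: B :: l)) := rfl
  rw [e, force_eq]
  refine straightenA_rep hts hτ hk hraise hlow hD hu _ A B l h ?_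
  have h1 := (pack_digits h.2.1.head h.2.1.tail.head l).1
  have h2 := h.2.1.head.2.2
  omega

/-! ### The system of linear equations -/

/-- The first place in `l` where a degree different from its neighbours occurs; the left neighbour
of the first place is the second argument. -/
def singlePos (l : List Nat) : Nat → Option Nat :=
  List.rec (motive := fun _ => Nat → Option Nat) (fun _ => none)
    (fun d t ih prev => cond (Nat.beq d prev) (Option.map Nat.succ (ih d))
      (cond (List.rec true (fun e _ _ => not (Nat.beq d e)) t) (some 0)
        (Option.map Nat.succ (ih d)))) l

/-- The number of repetitions at the beginning of `l`. -/
def repeatPos (l : List Nat) : Nat :=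
  List.rec 0 (fun d t ih => List.rec 0 (fun e _ _ => cond (Nat.beq d e) (Nat.succ ih) 0) t) l

/-- The place in `l` of the monomial that is straightened to a power of `p` when the first one, of
degree `d`, is straightened to a power of `q`. Any choice is correct; this one yields few and simple
equations. -/
def position (d : Nat) (l : List Nat) : Nat :=
  force (Option.rec (repeatPos l) (fun p => p) (singlePos l d)) fun p =>
    cond (Nat.blt p (List.length l)) p 0

theorem position_lt (d : ℕ) {l : List ℕ} (h : l ≠ []) : position d l < l.length := by
  rw [position, force_eq, Bool.cond_eq_ite]
  split_ifs with h1
  · exact Nat.le_of_ble_eq_true h1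
  · exact List.length_pos_of_ne_nil h

/-- The first `n` digits of `y` in base `1024`. -/
def unpack (n : Nat) : Nat → List Nat :=
  Nat.rec (motive := fun _ => Nat → List Nat) (fun _ => [])
    (fun _ ih y => force (Nat.mod y 1024) fun a => force (Nat.div y 1024) fun y' => a :: ih y') n

theorem unpack_succ (n y : ℕ) : unpack (n + 1) y = y % 1024 :: unpack n (y / 1024) := by
  have e : unpack (n + 1) y = force (Nat.mod y 1024) fun a => force (Nat.div y 1024) fun y' =>
    a :: unpack n y' := rfl
  rw [e, force_eq, force_eq]
  rfl

theorem length_unpack (n : ℕ) : ∀ y, (unpack n y).length = n := by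
  induction n with
  | zero => exact fun y => rfl
  | succ n ih => intro y; rw [unpack_succ, List.length_cons, ih]

theorem unpack_pack : ∀ {l : List ℕ}, Valid l → unpack l.length (pack l) = l
  | [], _ => rfl
  | a :: l, h => by
    have h1 := h.head.2.2
    rw [List.length_cons, unpack_succ, pack_cons, show (a + 1024 * pack l) % 1024 = a by omega,
      show (a + 1024 * pack l) / 1024 = pack l by omega, unpack_pack h.tail]

/-- Hands the member number `p` of `l` and the list of the other members to the last argument. -/
def pull {α : Type} (z : α) (l : List Nat) : Nat → (Nat → List Nat → α) → α :=
  List.rec (motive := fun _ => Nat → (Nat → List Nat → α) → α) (fun _ _ => z)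
    (fun a t ih p c => Nat.rec (c a t) (fun p' _ => ih p' (fun b r => c b (a :: r))) p) l

theorem pull_append {α : Type} (z : α) : ∀ (l : List ℕ) (b : ℕ) (r : List ℕ)
    (f : ℕ → List ℕ → α), pull z (l ++ b :: r) l.length f = f b (l ++ r)
  | [], _, _, _ => rfl
  | a :: l, b, r, f => pull_append z l b r fun b r => f b (a :: r)

/-- The value at the decreasing list `l`, times `c`. -/
def sortedValue (k : Nat) (u : Nat → Nat) (c : Nat) (l : List Nat) : Nat :=
  List.rec 0 (fun a t _ =>
    force (position (Nat.div a 32) (List.map (fun c => Nat.div c 32) t)) fun p =>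
      pull 0 t p fun b r => Nat.mul (cond (Nat.beq (Nat.mod p 2) 0) c (Nat.sub 8191 c))
        (force (pack (a :: b :: r)) (straighten k u))) l

/-- Inserts `x` into the decreasing list `l` with the sign of the permutation, and yields `0` if `x`
occurs in `l`. -/
def insertSorted (x : Nat) (l : List Nat) : Nat → (Nat → List Nat → Nat) → Nat :=
  List.rec (motive := fun _ => Nat → (Nat → List Nat → Nat) → Nat) (fun c f => f c [x])
    (fun a t ih c f => cond (Nat.beq a x) 0 (cond (Nat.ble a x) (f c (x :: a :: t))
      (ih (Nat.sub 8191 c) (fun c' r => f c' (a :: r))))) l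

/-- The part of the equation `dSum τ = 0` that comes from brackets of `a` with members of `t`. -/
def bracketRow (k : Nat) (u : Nat → Nat) (a : Nat) (t : List Nat) : List Nat → Bool → Nat :=
  List.rec (motive := fun _ => List Nat → Bool → Nat) (fun _ _ => 0)
    (fun b t ih pre s => force (Nat.mod (Nat.add (Nat.mul (Nat.mod a 32) (Nat.div b 32))
        (Nat.sub 8191 (Nat.mul (Nat.mod b 32) (Nat.div a 32)))) 8191) fun c =>
      Nat.add (cond (Nat.beq c 0) 0 (force (Nat.sub (Nat.add a b) 65) fun x =>
          insertSorted x (List.append pre t) (cond s c (Nat.sub 8191 c)) (sortedValue k u)))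
        (ih (List.append pre [b]) (not s))) t

/-- The equation `dSum τ = 0`. -/
def dRow (k : Nat) (u : Nat → Nat) (l : List Nat) : List Nat → Nat :=
  List.rec (motive := fun _ => List Nat → Nat) (fun _ => 0)
    (fun a t ih pre => Nat.add (bracketRow k u a t pre false) (ih (List.append pre [a]))) l

/-- The equation `lowSum τ = 0`. -/
def lowRow (k : Nat) (u : Nat → Nat) (l : List Nat) : List Nat → Nat :=
  List.rec (motive := fun _ => List Nat → Nat) (fun _ => 0)
    (fun a t ih pre => Nat.add (cond (or (Nat.beq (Nat.mod a 32) 0)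
        (List.rec false (fun e _ _ => Nat.beq (Nat.succ e) a) t)) 0
      (force (Nat.sub a 1) fun a' =>
        sortedValue k u (Nat.mod a 32) (List.append pre (a' :: t)))) (ih (List.append pre [a]))) l

/-- The equation for the packed list `y`: of length `k` for `lowSum τ = 0`, or `k + 1` for
`dSum τ = 0`. -/
def row (k : Nat) (u : Nat → Nat) (y : Nat) : Nat :=
  cond (Nat.blt y (Nat.pow 1024 k)) (lowRow k u (unpack k y) [])
    (dRow k u (unpack (Nat.succ k) y) [])

/-- `straighten` computes the values at all lists whose degrees are arranged by `position`. -/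
def Straightens (k : ℕ) (u : ℕ → ℕ) (ts : List (ZMod 8191)) (τ : List ℕ → ZMod 8191) : Prop :=
  ∀ d l b r, position d (l ++ b :: r) = l.length → (d :: (l ++ b :: r)).Pairwise (· ≥ ·) →
    (d :: (l ++ b :: r)).length = k → ∀ A B m, Shape (d :: b :: (l ++ r)) A B m →
      Rep 32768 ts (straighten k u (pack (A :: B :: m))) (τ (A :: B :: m))

theorem exists_eq_append_cons {l : List ℕ} {p : ℕ} (h : p < l.length) :
    ∃ s b r, l = s ++ b :: r ∧ s.length = p :=
  ⟨l.take p, l[p], l.drop (p + 1), by rw [← List.drop_eq_getElem_cons, List.take_append_drop],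
    by rw [List.length_take]; omega⟩

theorem pairwise_map_div {l : List ℕ} (h : l.Pairwise (· > ·)) :
    (l.map (· / 32)).Pairwise (· ≥ ·) :=
  List.pairwise_map.2 (h.imp fun hab => Nat.div_le_div_right hab.le)

/-- The bound is that of the digits of a straightened value, times the coefficient `c ≤ 8191`. -/
theorem sortedValue_rep {k : ℕ} {u : ℕ → ℕ} {ts : List (ZMod 8191)} {τ : List ℕ → ZMod 8191}
    (hτ : Swap τ) (hS : Straightens k u ts τ) (hk : 2 ≤ k) {c : ℕ} (hc : c ≤ 8191) {l : List ℕ}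
    (hv : Valid l) (hs : l.Pairwise (· > ·)) (hl : l.length = k) :
    Rep 268402688 ts (sortedValue k u c l) (c * τ l) := by
  obtain - | ⟨a, t⟩ := l
  · simp only [List.length_nil] at hl; omega
  have e : sortedValue k u c (a :: t) = force (position (a / 32) (t.map (· / 32))) fun p =>
    pull 0 t p fun b r => Nat.mul (cond (Nat.beq (Nat.mod p 2) 0) c (Nat.sub 8191 c))
      (force (pack (a :: b :: r)) (straighten k u)) := rfl
  rw [List.length_cons] at hl
  have hp : position (a / 32) (t.map (· / 32)) < t.length := by
    have := position_lt (a / 32) (l := t.map (· / 32)) (by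
      intro h0
      rw [List.map_eq_nil_iff] at h0
      rw [h0, List.length_nil] at hl
      omega)
    rwa [List.length_map] at this
  obtain ⟨s, b, r, rfl, hsl⟩ := exists_eq_append_cons hp
  rw [e, force_eq, ← hsl, pull_append, force_eq]
  have hval := hS (a / 32) (s.map (· / 32)) (b / 32) (r.map (· / 32))
    (by rw [List.length_map, hsl, List.map_append, List.map_cons])
    (by
      have := pairwise_map_div hs
      rwa [List.map_cons, List.map_append, List.map_cons] at this)
    (by
      rw [← hl]
      simp) a b (s ++ r)
    ⟨by simp, fun x hx => hv x (by simp at hx ⊢; tauto), by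
      have h1 := (List.pairwise_cons.1 hs).2
      exact h1.sublist (by simp)⟩
  have hmove := hτ.move s [a] b r
  rw [List.singleton_append, List.singleton_append] at hmove
  have hco : (cond (Nat.beq (Nat.mod s.length 2) 0) c (Nat.sub 8191 c) : ℕ) ≤ 8191 := by
    rw [Bool.cond_eq_ite]
    split_ifs
    · exact hc
    · exact Nat.sub_le _ _
  have hcast : ((cond (Nat.beq (Nat.mod s.length 2) 0) c (Nat.sub 8191 c) : ℕ) : ZMod 8191) =
      c * (-1) ^ s.length := by
    rw [Bool.cond_eq_ite]
    split_ifs with h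
    · have h' : s.length % 2 = 0 := Nat.eq_of_beq_eq_true h
      rw [Even.neg_one_pow (Nat.even_iff.2 h'), mul_one]
    · have h' : s.length % 2 ≠ 0 := fun h0 => h (by
        rw [show Nat.mod s.length 2 = 0 from h0]; rfl)
      rw [Odd.neg_one_pow (Nat.odd_iff.2 (by omega)), mul_neg, mul_one]
      exact cast_sub_8191 hc
  refine ((hval.mul _).mono ?_).congr ?_
  · exact Nat.mul_le_mul_right 32768 hco
  · rw [hcast, hmove]
    ring

theorem insertSorted_cons (x a : ℕ) (t : List ℕ) (c : ℕ) (f : ℕ → List ℕ → ℕ) :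
    insertSorted x (a :: t) c f = if a = x then 0 else if a ≤ x then f c (x :: a :: t)
      else insertSorted x t (8191 - c) fun c' r => f c' (a :: r) := by
  have e : insertSorted x (a :: t) c f = cond (Nat.beq a x) 0 (cond (Nat.ble a x)
      (f c (x :: a :: t))
      (insertSorted x t (Nat.sub 8191 c) (fun c' r => f c' (a :: r)))) := rfl
  rw [e]
  simp only [Bool.cond_eq_ite, Nat.beq_eq, Nat.ble_eq]
  rfl

/-- The value at `x :: l` is, up to sign, that at a decreasing list. -/
theorem insertSorted_rep {ts : List (ZMod 8191)} {b x : ℕ} (hx : ValidCode x) :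
    ∀ {τ : List ℕ → ZMod 8191}, Swap τ → ∀ {l : List ℕ} {c : ℕ}, c ≤ 8191 →
    ∀ {f : ℕ → List ℕ → ℕ}, Valid l → l.Pairwise (· > ·) →
    (∀ c ≤ 8191, ∀ m, Valid m → m.Pairwise (· > ·) → m.length = l.length + 1 →
      (∀ y ∈ m, y ∈ x :: l) → Rep b ts (f c m) (c * τ m)) →
    Rep b ts (insertSorted x l c f) (c * τ (x :: l))
  | τ, hτ, [], c, hc, f, _, _, hf =>
    hf c hc [x] (Valid.cons hx fun _ h => by simp at h) (by simp) rfl (by simp)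
  | τ, hτ, a :: t, c, hc, f, hv, hs, hf => by
    rw [insertSorted_cons]
    have hs' := List.pairwise_cons.1 hs
    split_ifs with h1 h2
    · subst h1
      have := hτ.adjacent [] a t
      rw [List.nil_append] at this
      rw [this, mul_zero]
      exact Rep.zero _ _
    · refine hf c hc _ (Valid.cons hx hv) (List.pairwise_cons.2 ⟨fun y hy => ?_, hs⟩) rfl
        fun _ h => h
      rcases List.mem_cons.1 hy with rfl | hy
      · omega
      · have := hs'.1 y hy
        omega
    · have h3 := hτ [] x a t
      rw [List.nil_append, List.nil_append] at h3
      have := insertSorted_rep hx (hτ.append [a]) (l := t) (c := 8191 - c) (Nat.sub_le _ _)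
        (f := fun c' r => f c' (a :: r)) hv.tail hs'.2 (fun c hc m hm hms hml hmem =>
          hf c hc (a :: m) (Valid.cons hv.head hm) (List.pairwise_cons.2 ⟨fun y hy => by
            rcases List.mem_cons.1 (hmem y hy) with rfl | hy'
            · show y < a
              omega
            · exact hs'.1 y hy', hms⟩) (by rw [List.length_cons, hml, List.length_cons])
            fun y hy => by
              rcases List.mem_cons.1 hy with rfl | hy
              · simp
              · rcases List.mem_cons.1 (hmem y hy) with rfl | hy' <;> simp [*])
      refine this.congr ?_
      rw [cast_sub_8191 hc, h3, List.singleton_append]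
      ring

theorem bracketRow_cons (k : ℕ) (u : ℕ → ℕ) (a b : ℕ) (t pre : List ℕ) (s : Bool) {c : ℕ}
    (hc : c = (a % 32 * (b / 32) + (8191 - b % 32 * (a / 32))) % 8191) :
    bracketRow k u a (b :: t) pre s = (if c = 0 then 0 else insertSorted (a + b - 65) (pre ++ t)
      (cond s c (8191 - c)) (sortedValue k u)) + bracketRow k u a t (pre ++ [b]) (!s) := by
  have e : bracketRow k u a (b :: t) pre s = force ((a % 32 * (b / 32) +
      (8191 - b % 32 * (a / 32))) % 8191) fun c => Nat.add (cond (Nat.beq c 0) 0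
        (force (a + b - 65) fun x => insertSorted x (pre ++ t) (cond s c (8191 - c))
          (sortedValue k u))) (bracketRow k u a t (pre ++ [b]) (!s)) := rfl
  rw [e, ← hc, force_eq, force_eq]
  simp only [Bool.cond_eq_ite, Nat.beq_eq]
  rfl

theorem bracketRow_rep {k : ℕ} {u : ℕ → ℕ} {ts : List (ZMod 8191)} {τ : List ℕ → ZMod 8191}
    (hτ : Swap τ) (hS : Straightens k u ts τ) (hk : 2 ≤ k) {a : ℕ} (ha : ValidCode a) :
    ∀ (t pre : List ℕ) (s : Bool), Valid (pre ++ t) → (pre ++ t).Pairwise (· > ·) →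
      (pre ++ t).length = k → (∀ b ∈ t, a / 32 + b / 32 ≤ 22) →
      Rep (t.length * 268402688) ts (bracketRow k u a t pre s)
        ((if s then 1 else -1) * (-1) ^ pre.length * bracketSum a (fun v => τ (pre ++ v)) t)
  | [], pre, s, _, _, _, _ => by
    rw [bracketSum, mul_zero]
    exact Rep.zero _ _
  | b :: t, pre, s, hv, hs, hl, hab => by
    have ih := bracketRow_rep hτ hS hk ha t (pre ++ [b]) (!s) (by simpa using hv)
      (by simpa using hs) (by simpa using hl) fun b hb => hab b (by simp [hb])
    have hb : ValidCode b := hv b (by simp)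
    set c := (a % 32 * (b / 32) + (8191 - b % 32 * (a / 32))) % 8191 with hc
    rw [bracketRow_cons k u a b t pre s hc, bracketSum, List.length_cons, Nat.succ_mul,
      add_comm (t.length * 268402688)]
    have hle : b % 32 * (a / 32) ≤ 8191 :=
      (Nat.mul_le_mul (hb.2.1.trans hb.2.2) ha.2.2).trans (by norm_num)
    have hcast : ((((a % 32 * (b / 32) : ℕ) : ℤ) - (b % 32 * (a / 32) : ℕ) : ℤ) : ZMod 8191) =
        c := by
      rw [hc, ZMod.natCast_mod, Nat.cast_add, cast_sub_8191 hle, Int.cast_sub, Int.cast_natCast,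
        Int.cast_natCast, sub_eq_add_neg]
    have hsub : (pre ++ t).Sublist (pre ++ b :: t) := by simp
    have hterm : Rep 268402688 ts (if c = 0 then 0 else insertSorted (a + b - 65) (pre ++ t)
        (cond s c (8191 - c)) (sortedValue k u))
        ((if s then 1 else -1) * c * τ ((a + b - 65) :: (pre ++ t))) := by
      split_ifs with h0
      all_goals try rw [h0, Nat.cast_zero, mul_zero, zero_mul]; exact Rep.zero _ _
      all_goals
        -- where the code of the bracket is not valid, its coefficient is zero
        have hx : ValidCode (a + b - 65) := by
          have h22 := hab b (by simp)
          obtain ⟨a1, a2, a3⟩ := ha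
          obtain ⟨b1, b2, b3⟩ := hb
          have h1 : a % 32 + b % 32 ≠ 0 := by
            intro h1
            refine h0 ?_
            rw [hc, show a % 32 = 0 by omega, show b % 32 = 0 by omega, zero_mul, zero_mul,
              Nat.sub_zero, Nat.zero_add, Nat.mod_self]
          have h2 : ¬(a % 32 = a / 32 ∧ b % 32 = b / 32) := by
            rintro ⟨h2, h3⟩
            refine h0 ?_
            rw [hc, h2, h3, mul_comm (b / 32)]
            rw [h3, mul_comm] at hle
            rw [Nat.add_sub_cancel' hle, Nat.mod_self]
          have e1 : (a + b - 65) / 32 = a / 32 + b / 32 - 2 := by omega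
          have e2 : (a + b - 65) % 32 = a % 32 + b % 32 - 1 := by omega
          refine ⟨?_, ?_, ?_⟩ <;> omega
        have hc' : c ≤ 8191 := (Nat.mod_lt _ (by norm_num)).le
        have hins : ∀ c' ≤ 8191, Rep 268402688 ts (insertSorted (a + b - 65) (pre ++ t) c'
            (sortedValue k u)) (c' * τ ((a + b - 65) :: (pre ++ t))) := fun c' hc' =>
          insertSorted_rep hx hτ hc' (fun x hx => hv x (hsub.subset hx)) (hs.sublist hsub)
            fun c hc m hm hms hml _ => sortedValue_rep hτ hS hk hc hm hms (by
              rw [hml, ← hl]; simp; omega)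
      · rename_i hst
        subst hst
        rw [one_mul]
        exact hins c hc'
      · rename_i hst
        rw [Bool.not_eq_true] at hst
        subst hst
        refine (hins (8191 - c) (Nat.sub_le _ _)).congr ?_
        rw [cast_sub_8191 hc', neg_one_mul]
    refine (hterm.add ih).congr ?_
    have hmove := hτ.move pre [] (a + b - 65) t
    rw [List.nil_append, List.nil_append] at hmove
    have hsq : ((-1) ^ pre.length * (-1) ^ pre.length : ZMod 8191) = 1 := by
      rw [← mul_pow, neg_one_mul, neg_neg, one_pow]
    rw [zsmul_eq_mul, hmove, hcast]
    simp only [List.append_assoc, List.singleton_append, List.length_append, List.length_singleton,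
      pow_succ]
    cases s
    · simp
      linear_combination (c : ZMod 8191) * τ ((a + b - 65) :: (pre ++ t)) * hsq
    · simp
      linear_combination -(c : ZMod 8191) * τ ((a + b - 65) :: (pre ++ t)) * hsq

theorem dRow_cons (k : ℕ) (u : ℕ → ℕ) (a : ℕ) (t pre : List ℕ) :
    dRow k u (a :: t) pre = bracketRow k u a t pre false + dRow k u t (pre ++ [a]) := rfl

theorem dRow_rep {k : ℕ} {u : ℕ → ℕ} {ts : List (ZMod 8191)} {τ : List ℕ → ZMod 8191}
    (hS : Straightens k u ts τ) (hk : 2 ≤ k) (hτ : Swap τ) :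
    ∀ (l pre : List ℕ), Valid (pre ++ l) → (pre ++ l).Pairwise (· > ·) →
      (pre ++ l).length = k + 1 → l.Pairwise (fun a b => a / 32 + b / 32 ≤ 22) →
      Rep (l.length * (k * 268402688)) ts (dRow k u l pre)
        ((-1) ^ pre.length * dSum (fun v => τ (pre ++ v)) l)
  | [], pre, _, _, _, _ => by
    rw [dSum, mul_zero]
    exact Rep.zero _ _
  | a :: t, pre, hv, hs, hl, hd => by
    have hd' := List.pairwise_cons.1 hd
    have ih := dRow_rep hS hk hτ t (pre ++ [a]) (by simpa using hv) (by simpa using hs)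
      (by simpa using hl) hd'.2
    have hsub : (pre ++ t).Sublist (pre ++ a :: t) := by simp
    have hl' : pre.length + (t.length + 1) = k + 1 := by simpa using hl
    have h1 := bracketRow_rep hτ hS hk (hv a (by simp)) t pre false
      (fun x hx => hv x (hsub.subset hx)) (hs.sublist hsub) (by rw [List.length_append]; omega)
      hd'.1
    rw [dRow_cons, List.length_cons, Nat.succ_mul, add_comm (t.length * (k * 268402688)), dSum]
    refine ((h1.mono ?_).add ih).congr ?_
    · exact Nat.mul_le_mul_right _ (by omega)
    · simp only [List.append_assoc, List.singleton_append, List.length_append,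
        List.length_singleton, pow_succ]
      simp
      ring

theorem lowRow_cons (k : ℕ) (u : ℕ → ℕ) (a : ℕ) (t pre : List ℕ) :
    lowRow k u (a :: t) pre = (cond (or (Nat.beq (Nat.mod a 32) 0)
      (List.rec false (fun e _ _ => Nat.beq (Nat.succ e) a) t)) 0
      (sortedValue k u (a % 32) (pre ++ (a - 1) :: t))) + lowRow k u t (pre ++ [a]) := by
  have e : lowRow k u (a :: t) pre = (cond (or (Nat.beq (Nat.mod a 32) 0)
      (List.rec false (fun e _ _ => Nat.beq (Nat.succ e) a) t)) 0
      (force (a - 1) fun a' => sortedValue k u (a % 32) (pre ++ a' :: t))) +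
      lowRow k u t (pre ++ [a]) := rfl
  rw [e, force_eq]

theorem lowRow_rep {k : ℕ} {u : ℕ → ℕ} {ts : List (ZMod 8191)} {τ : List ℕ → ZMod 8191}
    (hS : Straightens k u ts τ) (hk : 2 ≤ k) (hτ : Swap τ) :
    ∀ (l pre : List ℕ), Valid (pre ++ l) → (pre ++ l).Pairwise (· > ·) →
      (pre ++ l).length = k →
      Rep (l.length * 268402688) ts (lowRow k u l pre) (lowSum (fun v => τ (pre ++ v)) l)
  | [], pre, _, _, _ => by
    rw [lowSum]
    exact Rep.zero _ _
  | a :: t, pre, hv, hs, hl => by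
    have ih := lowRow_rep hS hk hτ t (pre ++ [a]) (by simpa using hv) (by simpa using hs)
      (by simpa using hl)
    obtain ⟨a1, a2, a3⟩ := hv a (by simp)
    rw [lowRow_cons, List.length_cons, Nat.succ_mul, add_comm (t.length * 268402688), lowSum]
    refine Rep.add ?_ (ih.congr (by simp))
    rw [Bool.cond_eq_ite]
    have hs' := List.pairwise_append.1 hs
    split_ifs with h
    · rw [Bool.or_eq_true, Nat.beq_eq] at h
      refine (Rep.zero _ _).congr ?_
      rcases h with h | h
      · rw [show a % 32 = 0 from h, zero_smul]
      · obtain - | ⟨e, t⟩ := t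
        · simp at h
        · have h' : e + 1 = a := Nat.eq_of_beq_eq_true h
          rw [show a - 1 = e by omega, hτ.adjacent, smul_zero]
    · rw [Bool.or_eq_true, Nat.beq_eq, not_or] at h
      have h1 : a % 32 ≠ 0 := h.1
      have h2 : ∀ x ∈ t, x < a - 1 := by
        intro x hx
        have hcons := List.pairwise_cons.1 hs'.2.1
        have hxa := hcons.1 x hx
        obtain - | ⟨e, t⟩ := t
        · simp at hx
        have he : e + 1 ≠ a := fun h' => h.2 (by rw [← h']; exact Nat.beq_refl _)
        have hea := hcons.1 e (by simp)
        rcases List.mem_cons.1 hx with rfl | hx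
        · omega
        · have := (List.pairwise_cons.1 hcons.2).1 x hx
          omega
      rw [nsmul_eq_mul]
      refine sortedValue_rep hτ hS hk (by omega) ?_ ?_ (by simpa using hl)
      · intro x hx
        rw [List.mem_append, List.mem_cons] at hx
        rcases hx with hx | rfl | hx
        · exact hv x (by simp [hx])
        · exact ⟨by omega, by omega, by omega⟩
        · exact hv x (by simp [hx])
      · refine List.pairwise_append.2 ⟨hs'.1, List.pairwise_cons.2
          ⟨h2, (List.pairwise_cons.1 hs'.2.1).2⟩, fun x hx y hy => ?_⟩
        rcases List.mem_cons.1 hy with rfl | hy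
        · have := hs'.2.2 x hx a (by simp)
          omega
        · exact hs'.2.2 x hx y (by simp [hy])

/-- Whether `l` is a decreasing list of monomials that may serve as the arguments of an equation. -/
def goodList (l : List Nat) : Bool :=
  List.rec true (fun a t ih => and (and (and (Nat.ble 3 (Nat.div a 32))
      (Nat.ble (Nat.mod a 32) (Nat.div a 32))) (Nat.ble (Nat.div a 32) 20))
    (and (List.all t fun b => and (Nat.blt b a)
      (Nat.ble (Nat.add (Nat.div a 32) (Nat.div b 32)) 22)) ih)) l

theorem goodList_cons (a : ℕ) (t : List ℕ) (h : goodList (a :: t) = true) : ValidCode a ∧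
    (∀ b ∈ t, a > b ∧ a / 32 + b / 32 ≤ 22) ∧ goodList t = true := by
  have e : goodList (a :: t) = and (and (and (Nat.ble 3 (a / 32)) (Nat.ble (a % 32) (a / 32)))
    (Nat.ble (a / 32) 20)) (and (List.all t fun b => and (Nat.ble (b + 1) a)
      (Nat.ble (a / 32 + b / 32) 22)) (goodList t)) := rfl
  rw [e] at h
  simp only [Bool.and_eq_true, Nat.ble_eq, List.all_eq_true] at h
  exact ⟨⟨h.1.1.1, h.1.1.2, h.1.2⟩, fun b hb => h.2.1 b hb, h.2.2⟩

theorem of_goodList : ∀ {l : List ℕ}, goodList l = true → Valid l ∧ l.Pairwise (· > ·) ∧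
    l.Pairwise fun a b => a / 32 + b / 32 ≤ 22
  | [], _ => ⟨fun _ h => by simp at h, List.Pairwise.nil, List.Pairwise.nil⟩
  | a :: t, h => by
    obtain ⟨h1, h2, h3⟩ := goodList_cons a t h
    obtain ⟨h4, h5, h6⟩ := of_goodList h3
    exact ⟨h4.cons h1, List.pairwise_cons.2 ⟨fun b hb => (h2 b hb).1, h5⟩,
      List.pairwise_cons.2 ⟨fun b hb => (h2 b hb).2, h6⟩⟩

/-- Whether `row k u y` makes sense. -/
def goodRow (k : Nat) (y : Nat) : Bool :=
  cond (Nat.blt y (Nat.pow 1024 k)) (goodList (unpack k y)) (goodList (unpack (Nat.succ k) y))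

/-- There are at most `19 * 18 = 342` terms in an equation. -/
theorem row_rep {k : ℕ} {u : ℕ → ℕ} {ts : List (ZMod 8191)} {τ : List ℕ → ZMod 8191}
    (hS : Straightens k u ts τ) (hk : 2 ≤ k) (hk' : k ≤ 18) (hτ : Swap τ)
    (hlow : ∀ v, Valid v → v.length = k → lowSum τ v = 0)
    (hd : ∀ v, Valid v → v.Pairwise (fun a b => a / 32 + b / 32 ≤ 22) → v.length = k + 1 →
      dSum τ v = 0) {y : ℕ} (hy : goodRow k y = true) :
    Rep (342 * 268402688) ts (row k u y) 0 := by
  rw [goodRow, Bool.cond_eq_ite] at hy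
  rw [row, Bool.cond_eq_ite]
  split_ifs at hy ⊢ with h
  · have hl := length_unpack k y
    generalize unpack k y = l at hy hl ⊢
    obtain ⟨h1, h2, -⟩ := of_goodList hy
    refine ((lowRow_rep hS hk hτ _ [] h1 h2 hl).mono ?_).congr (hlow _ h1 hl)
    exact Nat.mul_le_mul_right _ (by omega)
  · have hl := length_unpack (k + 1) y
    change goodList (unpack (k + 1) y) = true at hy
    change Rep (342 * 268402688) ts (dRow k u (unpack (k + 1) y) []) 0
    generalize unpack (k + 1) y = l at hy hl ⊢
    obtain ⟨h1, h2, h3⟩ := of_goodList hy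
    refine ((dRow_rep hS hk hτ _ [] h1 h2 hl h3).mono ?_).congr ?_
    · rw [hl, ← mul_assoc]
      exact Nat.mul_le_mul_right _ (Nat.mul_le_mul (show k + 1 ≤ 19 by omega) hk')
    · show (-1) ^ 0 * dSum τ _ = 0
      rw [hd _ h1 h3 hl, mul_zero]

/-! ### The unknowns -/

/-- The decreasing lists of `n` degrees from `3` to `mx + 2` of total weight `w`. -/
def parts (n : Nat) : Nat → Nat → List (List Nat) :=
  Nat.rec (motive := fun _ => Nat → Nat → List (List Nat)) (fun w _ => cond (Nat.beq w 0) [[]] [])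
    (fun _ ih w mx => Nat.rec [] (fun p r => force (Nat.succ p) fun q => cond (Nat.ble q w)
      (List.append r (List.map (fun l => Nat.add q 2 :: l) (ih (Nat.sub w q) q))) r) mx) n

theorem parts_succ_succ (n w m : ℕ) : parts (n + 1) w (m + 1) = if m + 1 ≤ w then
    parts (n + 1) w m ++ (parts n (w - (m + 1)) (m + 1)).map fun l => (m + 3) :: l
    else parts (n + 1) w m := by
  have e : parts (n + 1) w (m + 1) = force (m + 1) fun q => cond (Nat.ble q w)
    (List.append (parts (n + 1) w m) (List.map (fun l => (q + 2) :: l) (parts n (w - q) q)))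
    (parts (n + 1) w m) := rfl
  rw [e, force_eq]
  simp only [Bool.cond_eq_ite, Nat.ble_eq]
  rfl

theorem mem_parts : ∀ {n w m : ℕ} {l : List ℕ}, l.length = n → l.Pairwise (· ≥ ·) →
    (∀ d ∈ l, 3 ≤ d ∧ d ≤ m + 2) → l.sum = w + 2 * n → l ∈ parts n w m
  | 0, w, m, l, hn, _, _, hs => by
    rw [List.length_eq_zero_iff] at hn
    subst hn
    have : w = 0 := by simpa using hs.symm
    subst this
    exact List.mem_singleton.2 rfl
  | n + 1, w, m, [], hn, _, _, _ => by simp at hn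
  | n + 1, w, 0, d :: t, _, _, hd, _ => by
    have := hd d (by simp)
    omega
  | n + 1, w, m + 1, d :: t, hn, hp, hd, hs => by
    have hp' := List.pairwise_cons.1 hp
    rw [List.length_cons] at hn
    rw [List.sum_cons] at hs
    have h1 := hd d (by simp)
    have ht : 2 * n ≤ t.sum := by
      have := List.card_nsmul_le_sum t 2 fun x hx => by
        have := hd x (by simp [hx])
        omega
      rw [smul_eq_mul] at this
      omega
    rw [parts_succ_succ]
    by_cases h : d = m + 3
    · subst h
      rw [if_pos (by omega), List.mem_append]
      refine Or.inr (List.mem_map.2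
        ⟨t, mem_parts (by omega) hp'.2 (fun x hx => ?_) (by omega), rfl⟩)
      exact ⟨(hd x (by simp [hx])).1, hp'.1 x hx⟩
    · have := mem_parts (n := n + 1) (w := w) (m := m) (l := d :: t) hn hp
        (fun x hx => ⟨(hd x hx).1, by
          rcases List.mem_cons.1 hx with rfl | hx
          · omega
          · have := hp'.1 x hx
            omega⟩) (by rw [List.sum_cons, hs])
      split_ifs
      · exact List.mem_append.2 (Or.inl this)
      · exact this

/-- The lists with degrees `ds`, decreasing, below `prev`, with total exponent `s` of `q`, and
without `qa` and `pb`. -/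
def rests (qa pb : Nat) (ds : List Nat) : Nat → Nat → List (List Nat) :=
  List.rec (motive := fun _ => Nat → Nat → List (List Nat))
    (fun _ s => cond (Nat.beq s 0) [[]] [])
    (fun l _ ih prev s => Nat.rec [] (fun i r => force (Nat.add (Nat.mul 32 l) i) fun c =>
      cond (or (Nat.ble prev c) (or (Nat.blt s i) (or (Nat.beq c qa) (Nat.beq c pb)))) r
        (List.append r (List.map (fun l => c :: l) (ih c (Nat.sub s i))))) (Nat.succ l)) ds

/-- The part of `rests` that has a first member with exponent of `q` below `n`. -/
def restsBelow (qa pb l : ℕ) (ds : List ℕ) (prev s n : ℕ) : List (List ℕ) :=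
  Nat.rec [] (fun i r => force (Nat.add (Nat.mul 32 l) i) fun c =>
      cond (or (Nat.ble prev c) (or (Nat.blt s i) (or (Nat.beq c qa) (Nat.beq c pb)))) r
        (List.append r (List.map (fun l => c :: l) (rests qa pb ds c (Nat.sub s i))))) n

theorem restsBelow_succ (qa pb l : ℕ) (ds : List ℕ) (prev s i : ℕ) :
    restsBelow qa pb l ds prev s (i + 1) =
      if prev ≤ 32 * l + i ∨ s < i ∨ 32 * l + i = qa ∨ 32 * l + i = pb then
        restsBelow qa pb l ds prev s i
      else restsBelow qa pb l ds prev s i ++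
        (rests qa pb ds (32 * l + i) (s - i)).map fun m => (32 * l + i) :: m := by
  have e : restsBelow qa pb l ds prev s (i + 1) = force (32 * l + i) fun c =>
      cond (or (Nat.ble prev c) (or (Nat.blt s i)
        (or (Nat.beq c qa) (Nat.beq c pb)))) (restsBelow qa pb l ds prev s i)
        (List.append (restsBelow qa pb l ds prev s i) (List.map (fun l => c :: l)
          (rests qa pb ds c (s - i)))) := rfl
  rw [e, force_eq]
  simp only [Bool.cond_eq_ite, Bool.or_eq_true, Nat.beq_eq, Nat.ble_eq, Nat.blt_eq]
  rfl

theorem mem_restsBelow {qa pb : ℕ} {ds : List ℕ} {prev s c : ℕ} {m : List ℕ} (hc : c < prev)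
    (hqa : c ≠ qa) (hpb : c ≠ pb) (hs : c % 32 ≤ s) (hm : m ∈ rests qa pb ds c (s - c % 32)) :
    ∀ {n : ℕ}, c % 32 < n → c :: m ∈ restsBelow qa pb (c / 32) ds prev s n
  | 0, h => by omega
  | n + 1, h => by
    rw [restsBelow_succ]
    rcases Nat.lt_succ_iff_lt_or_eq.1 h with h | rfl
    · have := mem_restsBelow hc hqa hpb hs hm h
      split_ifs
      · exact this
      · exact List.mem_append.2 (Or.inl this)
    · have e : 32 * (c / 32) + c % 32 = c := Nat.div_add_mod c 32
      rw [e, if_neg (by omega)]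
      exact List.mem_append.2 (Or.inr (List.mem_map.2 ⟨m, hm, rfl⟩))

theorem mem_rests {qa pb : ℕ} : ∀ {m : List ℕ} {prev s : ℕ}, Valid m → m.Pairwise (· > ·) →
    (∀ c ∈ m, c < prev) → qa ∉ m → pb ∉ m → (m.map (· % 32)).sum = s →
    m ∈ rests qa pb (m.map (· / 32)) prev s
  | [], prev, s, _, _, _, _, _, hs => by
    have : s = 0 := by simpa using hs.symm
    subst this
    exact List.mem_singleton.2 rfl
  | c :: m, prev, s, hv, hp, hprev, hqa, hpb, hs => by
    rw [List.mem_cons, not_or] at hqa hpb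
    rw [List.map_cons, List.sum_cons] at hs
    have hp' := List.pairwise_cons.1 hp
    exact mem_restsBelow (hprev c (by simp)) (Ne.symm hqa.1) (Ne.symm hpb.1) (by omega)
      (mem_rests hv.tail hp'.2 hp'.1 hqa.2 hpb.2 (by omega)) (n := c / 32 + 1)
      (Nat.lt_succ_of_le hv.head.2.1)

/-- The lists with degrees `ds`, with total exponent `s` of `q`, that begin with a power of `q` and
a power of `p`, the latter of the degree selected by `position`. -/
def baseOf (s : Nat) (ds : List Nat) : List (List Nat) :=
  List.rec [] (fun a t _ => cond (Nat.ble a s) (force (position a t) fun p => pull [] t p fun b r =>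
    force (Nat.mul 33 a) fun qa => force (Nat.mul 32 b) fun pb =>
      List.map (fun l => qa :: pb :: l) (rests qa pb r 1024 (Nat.sub s a))) []) ds

/-- The packed lists of `k` monomials, of weight `w` and torus weight `0`, to which all others are
reduced by straightening. -/
def bases (w k : Nat) : List Nat :=
  List.flatMap (fun ds => List.map pack (baseOf (Nat.add (Nat.div w 2) k) ds)) (parts k w w)

/-- `bases` contains all lists that can occur at the end of straightening with a nonzero value. -/
theorem mem_bases {w k d b : ℕ} {l r : List ℕ} (hpos : position d (l ++ b :: r) = l.length)
    (hD : (d :: (l ++ b :: r)).Pairwise (· ≥ ·)) (hk : (d :: (l ++ b :: r)).length = k)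
    {A B : ℕ} {m : List ℕ} (h : Shape (d :: b :: (l ++ r)) A B m) (hA : A % 32 = A / 32)
    (hB : B % 32 = 0) (hAm : A ∉ m) (hBm : B ∉ m)
    (hw : ((A :: B :: m).map (· / 32)).sum = w + 2 * k)
    (hs : ((A :: B :: m).map (· % 32)).sum = w / 2 + k) : pack (A :: B :: m) ∈ bases w k := by
  obtain ⟨h1, h2, h3⟩ := h
  have h1' := h1
  rw [List.map_cons, List.map_cons, List.cons.injEq, List.cons.injEq] at h1'
  obtain ⟨e1, e2, e3⟩ := h1'
  rw [h1] at hw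
  have hperm : (d :: b :: (l ++ r)).Perm (d :: (l ++ b :: r)) :=
    List.Perm.cons d List.perm_middle.symm
  have h3d : ∀ x ∈ d :: (l ++ b :: r), 3 ≤ x := fun x hx => by
    rw [← hperm.mem_iff, ← h1] at hx
    obtain ⟨c, hc, rfl⟩ := List.mem_map.1 hx
    exact (h2 c hc).1
  have hsum : (d :: (l ++ b :: r)).sum = w + 2 * k := by rw [← hperm.sum_eq, hw]
  refine List.mem_flatMap.2 ⟨d :: (l ++ b :: r), mem_parts hk hD (fun x hx => ⟨h3d x hx, ?_⟩) hsum,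
    List.mem_map.2 ⟨A :: B :: m, ?_, rfl⟩⟩
  · have hd : d ≤ w + 2 := by
      rw [List.sum_cons] at hsum
      rw [List.length_cons] at hk
      have := List.card_nsmul_le_sum (l ++ b :: r) 2 fun x hx => by
        have := h3d x (by simp only [List.mem_cons]; exact Or.inr hx)
        omega
      rw [smul_eq_mul] at this
      omega
    rcases List.mem_cons.1 hx with rfl | hx
    · exact hd
    · exact ((List.pairwise_cons.1 hD).1 x hx).trans hd
  · have e : baseOf (Nat.add (Nat.div w 2) k) (d :: (l ++ b :: r)) =
        cond (Nat.ble d (w / 2 + k)) (force (position d (l ++ b :: r)) fun p =>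
          pull [] (l ++ b :: r) p fun b r => force (33 * d) fun qa => force (32 * b) fun pb =>
            List.map (fun l => qa :: pb :: l) (rests qa pb r 1024 (w / 2 + k - d))) [] := rfl
    have hA' : 33 * d = A := by omega
    have hB' : 32 * b = B := by omega
    have hle : Nat.ble d (w / 2 + k) = true := by
      rw [List.map_cons, List.sum_cons] at hs
      exact Nat.ble_eq.mpr (by omega)
    rw [e, hle, cond_true, force_eq, hpos, pull_append, force_eq, force_eq, ← e3, hA', hB']
    refine List.mem_map.2 ⟨m, mem_rests h2.tail.tail h3 (fun c hc => ?_) hAm hBm ?_, rfl⟩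
    · have := h2 c (by simp [hc])
      obtain ⟨-, -, h⟩ := this
      omega
    · rw [List.map_cons, List.map_cons, List.sum_cons, List.sum_cons] at hs
      omega

/-- The members of `l` at the places where the binary number `msk` has a `1`. -/
def select (l : List Nat) : Nat → List Nat :=
  List.rec (motive := fun _ => Nat → List Nat) (fun _ => [])
    (fun x _ ih msk => cond (Nat.beq (Nat.mod msk 2) 0) (ih (Nat.div msk 2))
      (x :: ih (Nat.div msk 2))) l

/-- The members of `l` at the places where the binary number `msk` has a `0`. -/
def unselect (l : List Nat) : Nat → List Nat :=
  List.rec (motive := fun _ => Nat → List Nat) (fun _ => [])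
    (fun x _ ih msk => cond (Nat.beq (Nat.mod msk 2) 0) (x :: ih (Nat.div msk 2))
      (ih (Nat.div msk 2))) l

theorem mem_select_or : ∀ {l : List ℕ} (msk : ℕ) {x : ℕ}, x ∈ l →
    x ∈ select l msk ∨ x ∈ unselect l msk
  | [], _, _, h => by simp at h
  | y :: l, msk, x, h => by
    have e : select (y :: l) msk = cond (Nat.beq (Nat.mod msk 2) 0) (select l (Nat.div msk 2))
      (y :: select l (Nat.div msk 2)) := rfl
    have e' : unselect (y :: l) msk = cond (Nat.beq (Nat.mod msk 2) 0)
      (y :: unselect l (Nat.div msk 2)) (unselect l (Nat.div msk 2)) := rfl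
    rw [e, e']
    have ih := fun h => mem_select_or (l := l) (Nat.div msk 2) (x := x) h
    rw [List.mem_cons] at h
    cases Nat.beq (Nat.mod msk 2) 0 <;> simp only [cond_true, cond_false, List.mem_cons] <;> tauto

/-- The unknown `x` as a linear form in the unknowns `l`; zero if it is not among these. -/
def look (l : List Nat) (x : Nat) : Nat :=
  List.rec 0 (fun u _ ih => cond (Nat.beq x u) 1 (Nat.mul (Nat.pow 2 40) ih)) l

theorem look_rep (g : ℕ → ZMod 8191) (x : ℕ) : ∀ l : List ℕ,
    Rep 1 (l.map g) (look l x) (if x ∈ l then g x else 0)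
  | [] => ⟨rfl, by simp⟩
  | u :: l => by
    have e : look (u :: l) x = cond (Nat.beq x u) 1 (2 ^ 40 * look l x) := rfl
    rw [e, Bool.cond_eq_ite]
    by_cases h : x = u
    · rw [if_pos (by rw [h]; exact Nat.beq_refl u), if_pos (by simp [h])]
      exact ⟨1, 0, 0, le_rfl, by norm_num, Rep.zero _ _, by rw [h]; simp⟩
    · rw [if_neg (by rwa [Nat.beq_eq])]
      refine ⟨0, look l x, if x ∈ l then g x else 0, Nat.zero_le _, by omega, look_rep g x l, ?_⟩
      simp [h]

/-- Whether the equations `ys` determine the unknowns in `bases w k`, up to the choice of `nk` of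
them, given by the zeros of `msk`. -/
def check (w k msk : Nat) (ys : List Nat) (nk : Nat) : Bool :=
  forceList (bases w k) fun l => forceList (select l msk) fun us =>
    and (and (Nat.beq (List.length (unselect l msk)) nk) (and (Nat.ble (List.length us) 512)
      (Nat.beq (List.length us) (List.length ys)))) (and (List.all ys (goodRow k))
        (forceList (List.map (fun y => red (row k (look us) y)) ys) (elim (List.length ys))))

theorem Swap.eq_zero_of_perm {τ : List ℕ → ZMod 8191} (h : Swap τ) {u v : List ℕ}
    (huv : u.Perm v) : τ v = 0 → τ u = 0 := by
  suffices H : ∀ pre, τ (pre ++ v) = 0 → τ (pre ++ u) = 0 by simpa using H []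
  induction huv with
  | nil => exact fun _ h => h
  | cons x _ ih =>
    intro pre h0
    have := ih (pre ++ [x])
    simp only [List.append_assoc, List.singleton_append] at this
    exact this h0
  | swap x y l =>
    intro pre h0
    rw [h, h0, neg_zero]
  | trans _ _ ih1 ih2 => exact fun pre h0 => ih1 pre (ih2 pre h0)

/-- An antisymmetric function is determined by its values at decreasing lists. -/
theorem Swap.eq_zero_of_sorted {τ : List ℕ → ZMod 8191} (h : Swap τ) {u : List ℕ}
    (h0 : ∀ v : List ℕ, v.Perm u → v.Pairwise (· > ·) → τ v = 0) : τ u = 0 := by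
  by_cases hu : u.Nodup
  · have h1 := List.perm_insertionSort (· ≥ ·) u
    have h2 := List.pairwise_insertionSort (· ≥ ·) u
    refine h.eq_zero_of_perm h1.symm (h0 _ h1 ?_)
    exact (h2.and (h1.nodup_iff.2 hu)).imp fun h => lt_of_le_of_ne h.1 h.2.symm
  · obtain ⟨x, hx⟩ := List.exists_duplicate_iff_not_nodup.2 hu
    obtain ⟨l, hl⟩ := (List.duplicate_iff_sublist.1 hx).exists_perm_append
    exact h.eq_zero_of_perm hl (h.adjacent [] x l)

/-- A solution of the equations vanishes if it vanishes at the free unknowns. -/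
theorem eq_zero_of_check {w k msk nk : ℕ} {ys : List ℕ} (h : check w k msk ys nk = true)
    (hk : 2 ≤ k) (hk' : k ≤ 18) {τ : List ℕ → ZMod 8191} (hτ : Swap τ)
    (hraise : ∀ v, Valid v → v.length = k → raiseSum τ v = 0)
    (hlow : ∀ v, Valid v → v.length = k → lowSum τ v = 0)
    (hd : ∀ v, Valid v → v.Pairwise (fun a b => a / 32 + b / 32 ≤ 22) → v.length = k + 1 →
      dSum τ v = 0)
    (hsupp : ∀ v, Valid v → τ v ≠ 0 → v.length = k ∧ (v.map (· / 32)).sum = w + 2 * k ∧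
      (v.map (· % 32)).sum = w / 2 + k)
    (hfree : ∀ x ∈ unselect (bases w k) msk, τ (unpack k x) = 0) {v : List ℕ} (hv : Valid v) :
    τ v = 0 := by
  rw [check, forceList_eq, forceList_eq, forceList_eq] at h
  set us := select (bases w k) msk with hus
  simp only [Bool.and_eq_true, Nat.beq_eq, Nat.ble_eq, List.all_eq_true] at h
  obtain ⟨⟨-, hn, hl⟩, hgood, helim⟩ := h
  set ts := us.map fun x => τ (unpack k x) with hts
  have hts' : ts.length ≤ 512 := by rw [hts, List.length_map]; exact hn
  have hS : Straightens k (look us) ts τ := by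
    intro d l b r hpos hD hlen A B m hm
    have hlen' : (d :: b :: (l ++ r)).length = k := by
      rw [← hlen]
      simp only [List.length_cons, List.length_append]
      omega
    refine straighten_rep hts' hτ hk' hraise hlow hlen' ?_ hm
    intro A B m hm hA hB
    have hunp : unpack k (pack (A :: B :: m)) = A :: B :: m := by
      have h1 := unpack_pack hm.2.1
      rwa [← List.length_map (· / 32), hm.1, hlen'] at h1
    refine ((look_rep (fun x => τ (unpack k x)) _ us).mono (by norm_num)).congr ?_
    split_ifs with hx
    · rw [hunp]
    · -- a list that is not in `bases` has the wrong weight or a repeated entry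
      by_contra h0
      have h0' : τ (A :: B :: m) ≠ 0 := fun h => h0 h.symm
      obtain ⟨-, h1, h2⟩ := hsupp _ hm.2.1 h0'
      have hmem := mem_bases hpos hD hlen hm hA hB
        (fun hAm => h0' (hτ.of_mem [] (List.mem_cons_of_mem B hAm)))
        (fun hBm => h0' (hτ.of_mem [A] hBm)) h1 h2
      rcases mem_select_or msk hmem with h3 | h3
      · exact hx h3
      · have := hfree _ h3
        rw [hunp] at this
        exact h0' this
  have hzero : ∀ t ∈ ts, t = 0 := by
    refine eq_zero_of_elim (n := ys.length) (b := 32768) (by omega) (by omega)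
      (by rw [hts, List.length_map, hl]) (fun N hN => ?_) helim
    obtain ⟨y, hy, rfl⟩ := List.mem_map.1 hN
    exact (row_rep hS hk hk' hτ hlow hd (hgood y hy)).red (by norm_num) hts'
  refine hτ.eq_zero_of_sorted fun u hu hs => ?_
  have hu' : Valid u := fun c hc => hv c (hu.mem_iff.1 hc)
  by_contra h0
  refine h0 ?_
  have := (sortedValue_rep hτ hS hk (c := 1) (by norm_num) hu' hs (hsupp u hu' h0).1).eq_zero hzero
  simpa using this

theorem length_of_check {w k msk nk : ℕ} {ys : List ℕ} (h : check w k msk ys nk = true) :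
    (unselect (bases w k) msk).length = nk := by
  rw [check, forceList_eq, forceList_eq, forceList_eq] at h
  simp only [Bool.and_eq_true, Nat.beq_eq] at h
  exact h.1.1

/-! ### Cochains as functions on lists of monomials -/

/-- The value of the cochain `σ` at a list of encoded monomials; `0` if the length is wrong. -/
def evalList : (k : ℕ) → Fun 1 k → List ℕ → ℝ
  | 0, σ, [] => σ Fin.elim0
  | k + 1, σ, c :: u => evalList k (contract (codeMono c) σ) u
  | _, _, _ => 0

theorem evalList_cons (k : ℕ) (σ : Fun 1 (k + 1)) (c : ℕ) (u : List ℕ) :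
    evalList (k + 1) σ (c :: u) = evalList k (contract (codeMono c) σ) u := rfl

theorem evalList_add : ∀ {k : ℕ} (σ τ : Fun 1 k) (u : List ℕ),
    evalList k (σ + τ) u = evalList k σ u + evalList k τ u
  | 0, _, _, [] => rfl
  | 0, _, _, _ :: _ => (add_zero 0).symm
  | _ + 1, _, _, [] => (add_zero 0).symm
  | _ + 1, σ, τ, c :: u => evalList_add (contract (codeMono c) σ) (contract (codeMono c) τ) u

theorem evalList_smul : ∀ {k : ℕ} (r : ℝ) (σ : Fun 1 k) (u : List ℕ),
    evalList k (r • σ) u = r * evalList k σ u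
  | 0, _, _, [] => rfl
  | 0, _, _, _ :: _ => (mul_zero _).symm
  | _ + 1, _, _, [] => (mul_zero _).symm
  | _ + 1, r, σ, c :: u => evalList_smul r (contract (codeMono c) σ) u

theorem evalList_neg {k : ℕ} (σ : Fun 1 k) (u : List ℕ) :
    evalList k (-σ) u = -evalList k σ u := by
  rw [← neg_one_smul ℝ σ, evalList_smul, neg_one_mul]

theorem evalList_sub {k : ℕ} (σ τ : Fun 1 k) (u : List ℕ) :
    evalList k (σ - τ) u = evalList k σ u - evalList k τ u := by
  rw [sub_eq_add_neg, evalList_add, evalList_neg, ← sub_eq_add_neg]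

theorem evalList_zero {k : ℕ} (u : List ℕ) : evalList k 0 u = 0 := by
  rw [← zero_smul ℝ (0 : Fun 1 k), evalList_smul, zero_mul]

theorem evalList_ofFn : ∀ {k : ℕ} (σ : Fun 1 k) (c : Fin k → ℕ),
    evalList k σ (List.ofFn c) = σ fun s => codeMono (c s)
  | 0, σ, c => by
    rw [List.ofFn_zero, evalList]
    exact congrArg σ (Subsingleton.elim _ _)
  | k + 1, σ, c => by
    rw [List.ofFn_succ, evalList_cons, evalList_ofFn, contract]
    congr 1
    funext s
    refine Fin.cases ?_ (fun s => ?_) s <;> simp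

theorem evalList_eq_zero_of_length : ∀ {k : ℕ} (σ : Fun 1 k) {u : List ℕ}, u.length ≠ k →
    evalList k σ u = 0
  | 0, _, [], h => absurd rfl h
  | 0, _, _ :: _, _ => rfl
  | k + 1, _, [], _ => rfl
  | k + 1, σ, c :: u, h => evalList_eq_zero_of_length (contract (codeMono c) σ) (u := u)
      fun h1 => h (by rw [List.length_cons, h1])

/-- An alternating form changes its sign when two neighbouring arguments are exchanged. -/
theorem swap_evalList : ∀ {k : ℕ} {σ : Fun 1 k}, IsAlt k σ → Swap (evalList k σ)
  | 0, _, _ => fun pre a b post => by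
    rw [evalList_eq_zero_of_length _ (by simp), evalList_eq_zero_of_length _ (by simp), neg_zero]
  | 1, σ, _ => fun pre a b post => by
    rw [evalList_eq_zero_of_length _ (by simp; omega),
      evalList_eq_zero_of_length _ (by simp; omega), neg_zero]
  | k + 2, σ, h => fun pre a b post => by
    obtain - | ⟨c, pre⟩ := pre
    · rw [List.nil_append, List.nil_append, evalList_cons, evalList_cons, evalList_cons,
        evalList_cons, h.contract_contract, evalList_neg]
    · exact swap_evalList (h.contract (codeMono c)) pre a b post

theorem bracket_lowerX_codeMono {c : ℕ} (hc : ValidCode c) :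
    bracket lowerX (codeMono c) = ((c % 32 : ℕ) : ℝ) • codeMono (c - 1) := by
  obtain ⟨h1, h2, h3⟩ := hc
  rw [codeMono, bracket_lowerX (by omega)]
  rcases Nat.eq_zero_or_pos (c % 32) with h | h
  · rw [h, Nat.cast_zero, zero_smul, zero_smul]
  · rw [codeMono, show (c - 1) % 32 = c % 32 - 1 by omega, show (c - 1) / 32 = c / 32 by omega,
      show c / 32 - (c % 32 - 1) = c / 32 - c % 32 + 1 by omega]

theorem bracket_raiseX_codeMono {c : ℕ} (hc : ValidCode c) :
    bracket raiseX (codeMono c) = ((c / 32 - c % 32 : ℕ) : ℝ) • codeMono (c + 1) := by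
  obtain ⟨h1, h2, h3⟩ := hc
  rw [codeMono, bracket_raiseX (by omega), codeMono, show (c + 1) % 32 = c % 32 + 1 by omega,
    show (c + 1) / 32 = c / 32 by omega, Nat.sub_add_eq]

/-- The degree is bounded so that the exponent of `q` in the bracket stays below `32`. -/
theorem bracket_codeMono {a c : ℕ} (ha : ValidCode a) (hc : ValidCode c)
    (h : a / 32 + c / 32 ≤ 22) : bracket (codeMono a) (codeMono c) =
      ((((a % 32 * (c / 32) : ℕ) : ℤ) - (c % 32 * (a / 32) : ℕ) : ℤ) : ℝ) •
        codeMono (a + c - 65) := by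
  obtain ⟨a1, a2, a3⟩ := ha
  obtain ⟨c1, c2, c3⟩ := hc
  rw [codeMono, codeMono, bracket_mono (by omega) (by omega)]
  have hco : (((a % 32 : ℕ) : ℝ) * ((c / 32 - c % 32 : ℕ) : ℝ) -
      ((a / 32 - a % 32 : ℕ) : ℝ) * ((c % 32 : ℕ) : ℝ)) =
      ((((a % 32 * (c / 32) : ℕ) : ℤ) - (c % 32 * (a / 32) : ℕ) : ℤ) : ℝ) := by
    rw [Nat.cast_sub a2, Nat.cast_sub c2, Int.cast_sub, Int.cast_natCast, Int.cast_natCast,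
      Nat.cast_mul, Nat.cast_mul]
    ring
  rw [hco]
  by_cases h1 : a % 32 + c % 32 = 0
  · rw [show a % 32 = 0 by omega, show c % 32 = 0 by omega]
    simp
  by_cases h2 : a % 32 = a / 32 ∧ c % 32 = c / 32
  · rw [h2.1, h2.2, mul_comm (c / 32)]
    simp
  rw [codeMono, show (a + c - 65) % 32 = a % 32 + c % 32 - 1 by omega,
    show (a + c - 65) / 32 = a / 32 + c / 32 - 2 by omega,
    show a / 32 - a % 32 + (c / 32 - c % 32) - 1 =
      a / 32 + c / 32 - 2 - (a % 32 + c % 32 - 1) by omega]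

/-- The recursion for the Lie derivative, in terms of lists of monomials. -/
theorem evalList_lieD_cons {k : ℕ} {σ : Fun 1 (k + 1)} (h : IsAlt (k + 1) σ) (X : ham0 1)
    {c c' : ℕ} {r : ℝ} (hX : bracket X (codeMono c) = r • codeMono c') (u : List ℕ) :
    evalList (k + 1) (lieD X σ) (c :: u) =
      r * evalList (k + 1) σ (c' :: u) + evalList k (lieD X (contract (codeMono c) σ)) u := by
  rw [evalList_cons, contract_lieD, hX, h.2.2.1, evalList_add, evalList_smul, add_comm,
    evalList_cons]

theorem evalList_nil_lieD {k : ℕ} (σ : Fun 1 k) (X : ham0 1) : evalList k (lieD X σ) [] = 0 := by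
  cases k with
  | zero => rw [evalList, lieD, Finset.univ_eq_empty, Finset.sum_empty]
  | succ k => rfl

theorem lowSum_evalList : ∀ {k : ℕ} {σ : Fun 1 k}, IsAlt k σ → ∀ {u : List ℕ}, Valid u →
    u.length = k → lowSum (evalList k σ) u = evalList k (lieD lowerX σ) u
  | k, σ, _, [], _, _ => by rw [evalList_nil_lieD, lowSum]
  | 0, _, _, _ :: _, _, h => by simp at h
  | k + 1, σ, h, c :: u, hu, hl => by
    rw [evalList_lieD_cons h _ (bracket_lowerX_codeMono hu.head), lowSum,
      ← lowSum_evalList (h.contract _) hu.tail (by simpa using hl), nsmul_eq_mul]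
    rfl

theorem raiseSum_evalList : ∀ {k : ℕ} {σ : Fun 1 k}, IsAlt k σ → ∀ {u : List ℕ}, Valid u →
    u.length = k → raiseSum (evalList k σ) u = evalList k (lieD raiseX σ) u
  | k, σ, _, [], _, _ => by rw [evalList_nil_lieD, raiseSum]
  | 0, _, _, _ :: _, _, h => by simp at h
  | k + 1, σ, h, c :: u, hu, hl => by
    rw [evalList_lieD_cons h _ (bracket_raiseX_codeMono hu.head), raiseSum,
      ← raiseSum_evalList (h.contract _) hu.tail (by simpa using hl), nsmul_eq_mul]
    rfl

theorem bracketSum_evalList {a : ℕ} (ha : ValidCode a) : ∀ {k : ℕ} {σ : Fun 1 k}, IsAlt k σ →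
    ∀ {u : List ℕ}, Valid u → (∀ c ∈ u, a / 32 + c / 32 ≤ 22) → u.length = k →
      bracketSum a (evalList k σ) u = evalList k (lieD (codeMono a) σ) u
  | k, σ, _, [], _, _, _ => by rw [evalList_nil_lieD, bracketSum]
  | 0, _, _, _ :: _, _, _, h => by simp at h
  | k + 1, σ, h, c :: u, hu, h22, hl => by
    rw [evalList_lieD_cons h _ (bracket_codeMono ha hu.head (h22 c (by simp))), bracketSum,
      ← bracketSum_evalList ha (h.contract _) hu.tail (fun c hc => h22 c (by simp [hc]))
        (by simpa using hl), zsmul_eq_mul]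
    rfl

/-- Cartan's formula is the recursion that defines `dSum`. -/
theorem dSum_evalList : ∀ {k : ℕ} {σ : Fun 1 k}, IsAlt k σ → ∀ {u : List ℕ}, Valid u →
    u.Pairwise (fun a b => a / 32 + b / 32 ≤ 22) → u.length = k + 1 →
      dSum (evalList k σ) u = evalList (k + 1) (coboundary 1 k σ) u
  | _, _, _, [], _, _, h => by simp at h
  | 0, σ, _, a :: u, _, _, h => by
    have : u = [] := by simpa using h
    rw [coboundary_zero_eq, evalList_zero, this, dSum, dSum, bracketSum, neg_zero, sub_zero]
  | k + 1, σ, h, a :: u, hu, h22, hl => by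
    have h22' := List.pairwise_cons.1 h22
    have hl' : u.length = k + 1 := by simpa using hl
    rw [evalList_cons, contract_coboundary h, evalList_sub, evalList_neg, dSum,
      bracketSum_evalList hu.head h hu.tail h22'.1 hl',
      ← dSum_evalList (h.contract _) hu.tail h22'.2 hl']
    rfl

theorem lowSum_map {M N : Type*} [AddCommGroup M] [AddCommGroup N] (φ : M →+ N) :
    ∀ (τ : List ℕ → M) (u : List ℕ), lowSum (fun v => φ (τ v)) u = φ (lowSum τ u)
  | _, [] => φ.map_zero.symm
  | τ, c :: u => by
    rw [lowSum, lowSum, map_add, map_nsmul, lowSum_map φ (fun v => τ (c :: v))]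

theorem raiseSum_map {M N : Type*} [AddCommGroup M] [AddCommGroup N] (φ : M →+ N) :
    ∀ (τ : List ℕ → M) (u : List ℕ), raiseSum (fun v => φ (τ v)) u = φ (raiseSum τ u)
  | _, [] => φ.map_zero.symm
  | τ, c :: u => by
    rw [raiseSum, raiseSum, map_add, map_nsmul, raiseSum_map φ (fun v => τ (c :: v))]

theorem bracketSum_map {M N : Type*} [AddCommGroup M] [AddCommGroup N] (φ : M →+ N) (a : ℕ) :
    ∀ (τ : List ℕ → M) (u : List ℕ), bracketSum a (fun v => φ (τ v)) u = φ (bracketSum a τ u)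
  | _, [] => φ.map_zero.symm
  | τ, c :: u => by
    rw [bracketSum, bracketSum, map_add, map_zsmul, bracketSum_map φ a (fun v => τ (c :: v))]

theorem dSum_map {M N : Type*} [AddCommGroup M] [AddCommGroup N] (φ : M →+ N) :
    ∀ (τ : List ℕ → M) (u : List ℕ), dSum (fun v => φ (τ v)) u = φ (dSum τ u)
  | _, [] => φ.map_zero.symm
  | τ, a :: u => by
    rw [dSum, dSum, map_sub, map_neg, bracketSum_map φ, dSum_map φ (fun v => τ (a :: v))]

/-! ### Reduction modulo `8191` -/

/-- Finitely many real numbers that do not all vanish generate a free abelian group, and some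
coordinate of one of them is not divisible by the prime `p`. -/
theorem exists_addMonoidHom_ne_zero {p : ℕ} [Fact p.Prime] {S : Set ℝ} (hS : S.Finite) {x : ℝ}
    (hx : x ∈ S) (h0 : x ≠ 0) : ∃ φ : AddSubgroup.closure S →+ ZMod p,
      ∃ y, ∃ hy : y ∈ S, φ ⟨y, AddSubgroup.subset_closure hy⟩ ≠ 0 := by
  let G := AddSubgroup.closure S
  have hfg : AddGroup.FG G := by
    rw [AddGroup.fg_iff_addSubgroup_fg]
    exact ⟨hS.toFinset, by rw [hS.coe_toFinset]⟩
  have hfin : Module.Finite ℤ G := Module.Finite.iff_addGroup_fg.2 hfg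
  have hfree : Module.Free ℤ G := Module.free_of_finite_type_torsion_free'
  let b := Module.Free.chooseBasis ℤ G
  have hne : Nonempty (Module.Free.ChooseBasisIndex ℤ G) := by
    by_contra hE
    rw [not_nonempty_iff] at hE
    have : Subsingleton G := b.repr.toEquiv.subsingleton
    exact h0 (congrArg Subtype.val
      (Subsingleton.elim (⟨x, AddSubgroup.subset_closure hx⟩ : G) 0))
  obtain ⟨i⟩ := hne
  let φ : G →+ ZMod p := (Int.castAddHom (ZMod p)).comp (b.coord i).toAddMonoidHom
  refine ⟨φ, ?_⟩
  by_contra! h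
  have h1 : ∀ g : G, φ g = 0 := by
    rintro ⟨g, hg⟩
    induction hg using AddSubgroup.closure_induction with
    | mem y hy => exact h y hy
    | zero => exact φ.map_zero
    | add y z hy hz h1 h2 => 
      have := φ.map_add ⟨y, hy⟩ ⟨z, hz⟩
      rw [h1, h2, add_zero] at this
      exact this
    | neg y hy h1 => 
      have := φ.map_neg ⟨y, hy⟩
      rw [h1, neg_zero] at this
      exact this
  have h2 : φ (b i) = 1 := by
    show (Int.castAddHom (ZMod p)) (b.coord i (b i)) = 1
    rw [Module.Basis.coord_apply, Module.Basis.repr_self, Finsupp.single_eq_same]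
    simp
  rw [h1] at h2
  exact zero_ne_one h2

theorem sum_map_ofFn {k : ℕ} (c : Fin k → ℕ) (g : ℕ → ℕ) :
    ((List.ofFn c).map g).sum = ∑ s, g (c s) := by
  rw [List.map_ofFn, List.sum_ofFn]
  rfl

/-- Nonzero values occur only at lists of the right length, weight and torus weight. -/
theorem support_evalList {k w : ℕ} {σ : Fun 1 k} (h : σ ∈ wtSpace k w 0) {v : List ℕ}
    (hv : Valid v) (h0 : evalList k σ v ≠ 0) : v.length = k ∧ (v.map (· / 32)).sum = w + 2 * k ∧
      2 * (v.map (· % 32)).sum = w + 2 * k := by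
  have hl : v.length = k := by
    by_contra hl
    exact h0 (evalList_eq_zero_of_length σ hl)
  obtain ⟨c, rfl⟩ : ∃ c : Fin k → ℕ, v = List.ofFn c := by
    subst hl
    exact ⟨v.get, (List.ofFn_get v).symm⟩
  rw [evalList_ofFn] at h0
  obtain ⟨-, h2, h3⟩ := h.2 (fun s => c s % 32) (fun s => c s / 32 - c s % 32) h0
  have hc : ∀ s, c s % 32 ≤ c s / 32 := fun s => (hv (c s) (List.mem_ofFn.2 ⟨s, rfl⟩)).2.1
  have h4 : ∑ s, c s / 32 = w + 2 * k := by
    rw [← h2]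
    refine Finset.sum_congr rfl fun s _ => ?_
    have := hc s
    omega
  refine ⟨hl, ?_, ?_⟩
  · rw [sum_map_ofFn, h4]
  · rw [sum_map_ofFn]
    rw [Finset.sum_add_distrib] at h2
    rw [← Nat.cast_sum, ← Nat.cast_sum] at h3
    omega

/-- Nonzero values at monomials occur at encoded monomials only. -/
theorem exists_ofFn_eq {k w : ℕ} (hw : w ≤ 18) {σ : Fun 1 k} (h : σ ∈ wtSpace k w 0)
    {i j : Fin k → ℕ} (h0 : σ (fun s => mono (i s) (j s)) ≠ 0) :
    ∃ c : Fin k → Fin 672, Valid (List.ofFn fun s => (c s : ℕ)) ∧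
      evalList k σ (List.ofFn fun s => (c s : ℕ)) = σ fun s => mono (i s) (j s) := by
  obtain ⟨h1, h2, -⟩ := h.2 i j h0
  have h3 : ∀ s, i s + j s ≤ 20 := by
    intro s
    have h4 : ∑ t ∈ Finset.univ.erase s, 2 ≤ ∑ t ∈ Finset.univ.erase s, (i t + j t) :=
      Finset.sum_le_sum fun t _ => by
        have := h1 t
        omega
    rw [← Finset.add_sum_erase _ _ (Finset.mem_univ s)] at h2
    rw [Finset.sum_const, Finset.card_erase_of_mem (Finset.mem_univ s), Finset.card_univ,
      Fintype.card_fin, smul_eq_mul] at h4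
    have := s.pos
    omega
  refine ⟨fun s => ⟨32 * (i s + j s) + i s, by have := h3 s; omega⟩, fun c hc => ?_, ?_⟩
  · obtain ⟨s, rfl⟩ := List.mem_ofFn.1 hc
    have := h3 s
    have := h1 s
    have e1 : (32 * (i s + j s) + i s) / 32 = i s + j s := by omega
    have e2 : (32 * (i s + j s) + i s) % 32 = i s := by omega
    rw [ValidCode, e1, e2]
    omega
  · rw [evalList_ofFn]
    congr 1
    funext s
    have := h3 s
    rw [codeMono, show (32 * (i s + j s) + i s) % 32 = i s by omega,
      show (32 * (i s + j s) + i s) / 32 = i s + j s by omega, Nat.add_sub_cancel_left]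

theorem exists_valid {k w : ℕ} (hw : w ≤ 18) {σ : Fun 1 k} (h : σ ∈ wtSpace k w 0) {v : List ℕ}
    (h0 : evalList k σ v ≠ 0) : ∃ c : Fin k → Fin 672, Valid (List.ofFn fun s => (c s : ℕ)) ∧
      evalList k σ (List.ofFn fun s => (c s : ℕ)) = evalList k σ v := by
  have hl : v.length = k := by
    by_contra hl
    exact h0 (evalList_eq_zero_of_length σ hl)
  obtain ⟨c, rfl⟩ : ∃ c : Fin k → ℕ, v = List.ofFn c := by
    subst hl
    exact ⟨v.get, (List.ofFn_get v).symm⟩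
  rw [evalList_ofFn] at h0 ⊢
  exact exists_ofFn_eq hw h h0

/-- A relative cocycle vanishes if it vanishes at the free unknowns. -/
theorem cocycle_eq_zero {w k msk nk : ℕ} {ys : List ℕ} (hc : check w k msk ys nk = true)
    (hk : 2 ≤ k) (hk' : k ≤ 18) (hw : w ≤ 18) {σ : Fun 1 k}
    (h : σ ∈ relCochainsOfWeight 1 w k) (hd : coboundary 1 k σ = 0)
    (h0 : ∀ x ∈ unselect (bases w k) msk, evalList k σ (unpack k x) = 0) : σ = 0 := by
  rw [relCochainsOfWeight_eq] at h
  obtain ⟨hσ, hraise⟩ := h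
  have hlow := lieD_lowerX_eq_zero hσ hraise
  have ha := isAlt_of_mem hσ.1
  by_contra hne
  -- the group generated by the values, and a reduction of it that does not kill all of them
  set S := Set.range (evalList k σ) with hS
  have hfin : S.Finite := by
    refine (Set.finite_range fun c : Fin k → Fin 672 =>
      evalList k σ (List.ofFn fun s => (c s : ℕ))).insert 0 |>.subset ?_
    rintro _ ⟨v, rfl⟩
    by_cases hv : evalList k σ v = 0
    · exact Or.inl hv
    · obtain ⟨c, -, h1⟩ := exists_valid hw hσ hv
      exact Or.inr ⟨c, h1⟩
  obtain ⟨x, hx, hx0⟩ : ∃ x ∈ S, x ≠ 0 := by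
    by_contra! hall
    refine hne (eq_zero_of_mono hσ.1 fun i j => ?_)
    by_contra hij
    obtain ⟨c, -, h1⟩ := exists_ofFn_eq hw hσ hij
    exact hij (by rw [← h1]; exact hall _ ⟨_, rfl⟩)
  obtain ⟨φ, y, ⟨v, rfl⟩, hφ⟩ := exists_addMonoidHom_ne_zero (p := 8191) hfin hx hx0
  let f : List ℕ → AddSubgroup.closure S := fun u =>
    ⟨evalList k σ u, AddSubgroup.subset_closure ⟨u, rfl⟩⟩
  have hf : ∀ {u u' : List ℕ}, evalList k σ u = evalList k σ u' → f u = f u' := fun h =>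
    Subtype.ext h
  have hf0 : ∀ {u : List ℕ}, evalList k σ u = 0 → f u = 0 := fun h => Subtype.ext h
  obtain ⟨c, hcv, hce⟩ := exists_valid (v := v) hw hσ fun h1 => hφ (by
    have := hf0 h1
    rw [show (⟨evalList k σ v, AddSubgroup.subset_closure ⟨v, rfl⟩⟩ :
      AddSubgroup.closure S) = f v from rfl, this, map_zero])
  refine hφ ?_
  show φ (f v) = 0
  rw [← hf hce]
  refine eq_zero_of_check hc hk hk' (τ := fun u => φ (f u)) ?_ ?_ ?_ ?_ ?_ ?_ hcv
  · intro pre a b post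
    rw [← map_neg]
    exact congrArg φ (Subtype.ext (swap_evalList ha pre a b post))
  · intro u hu hl
    rw [raiseSum_map, show raiseSum f u = 0 from Subtype.ext ?_, map_zero]
    have h1 := raiseSum_map (AddSubgroup.closure S).subtype f u
    have h2 : raiseSum (evalList k σ) u = 0 := by
      rw [raiseSum_evalList ha hu hl, show lieD raiseX σ = 0 from hraise, evalList_zero]
    exact h1.symm.trans h2
  · intro u hu hl
    rw [lowSum_map, show lowSum f u = 0 from Subtype.ext ?_, map_zero]
    have h1 := lowSum_map (AddSubgroup.closure S).subtype f u
    have h2 : lowSum (evalList k σ) u = 0 := by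
      rw [lowSum_evalList ha hu hl, hlow, evalList_zero]
    exact h1.symm.trans h2
  · intro u hu h22 hl
    rw [dSum_map, show dSum f u = 0 from Subtype.ext ?_, map_zero]
    have h1 := dSum_map (AddSubgroup.closure S).subtype f u
    have h2 : dSum (evalList k σ) u = 0 := by
      rw [dSum_evalList ha hu h22 hl, hd, evalList_zero]
    exact h1.symm.trans h2
  · intro u hu h1
    obtain ⟨h2, h3, h4⟩ := support_evalList hσ hu fun h2 => h1 (by
      rw [hf0 h2, map_zero])
    exact ⟨h2, h3, by omega⟩
  · intro x hx
    rw [hf0 (h0 x hx), map_zero]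

/-- The evaluation at the free unknowns embeds the cocycles. -/
theorem finrank_cocycles_le {w k msk nk : ℕ} {ys : List ℕ} (hc : check w k msk ys nk = true)
    (hk : 2 ≤ k) (hk' : k ≤ 18) (hw : w ≤ 18) :
    Module.finrank ℝ (cocycles (relCochainsOfWeight 1 w) k) ≤ nk := by
  let l := unselect (bases w k) msk
  let Ψ : cocycles (relCochainsOfWeight 1 w) k →ₗ[ℝ] (Fin l.length → ℝ) :=
    { toFun := fun σ s => evalList k σ (unpack k l[s])
      map_add' := fun σ τ => funext fun s => evalList_add _ _ _
      map_smul' := fun r σ => funext fun s => evalList_smul _ _ _ }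
  have hΨ : Function.Injective Ψ := by
    rw [← LinearMap.ker_eq_bot, LinearMap.ker_eq_bot']
    intro σ hσ
    refine Subtype.ext (cocycle_eq_zero hc hk hk' hw σ.2.1 σ.2.2 fun x hx => ?_)
    obtain ⟨s, hs, rfl⟩ := List.getElem_of_mem hx
    exact congrFun hσ ⟨s, hs⟩
  have := LinearMap.finrank_le_finrank_of_injective hΨ
  rwa [Module.finrank_fin_fun, length_of_check hc] at this

/-! ### The linear systems for the weights 12 to 18 -/

set_option maxRecDepth 1000000 in
set_option maxHeartbeats 0 in
theorem check_12_3 : check 12 3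
    0xff
    [0x20084300c6, 0x18c80300e7, 0x18063380e7, 0x1808228108, 0x1806230108, 0x20083280e7,
    0x1806128129, 0x1808020529]
    0 = true := by
  decide +kernel

set_option maxRecDepth 1000000 in
set_option maxHeartbeats 0 in
theorem check_12_4 : check 12 4
    0x30feff
    [0x280a2290a5, 0x62200a0290a5, 0x60188a028cc6, 0x6120084280c6, 0x601888030cc6, 0x6218c80300c6,
    0x60184a0290c6, 0x188a0310c5, 0x180a0314c6, 0x602008120ce7, 0x6018483280e7, 0x6118881280e7,
    0x6118c80280e7, 0x6018463300e7, 0x6018c81280e7, 0x601846228108, 0x601888020508]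
    9 = true := by
  decide +kernel

set_option maxRecDepth 1000000 in
set_option maxHeartbeats 0 in
theorem check_12_5 : check 12 5
    0x40da77f7f
    [0x8020482290a5, 0x802048428ca4, 0x63200a228ca4, 0x63200a0290a5, 0x62200a1290a5,
    0x61200a2290a5, 0x18061188a0290a5, 0x60200a3290a5, 0x1846218c80280c6, 0x1806218c81280c6,
    0x1806118883280c6, 0x1806118c82280c6, 0x180612008220cc6, 0x1846220081208c6, 0x1806320081208c6,
    0x6018ca4294c0, 0x61188a4294c0, 0x6218c8030cc4, 0x6118880310c5, 0x6018c80310c5,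
    0x6018480314c6, 0x1806118c80204e7, 0x1806118880208e7]
    14 = true := by
  decide +kernel

set_option maxRecDepth 1000000 in
set_option maxHeartbeats 0 in
theorem check_12_6 : check 12 6
    0x306bfff
    [0x6018c802048220c84, 0x601846218c80288a5, 0x180612088328ca4, 0x1806320081290a5,
    0x1806120c84288a3, 0x180612048428ca4, 0x1806120083290a5, 0x1806120482290a5, 0x180632048228ca4,
    0x60184622008220ca5, 0x601846220081210a5, 0x1846218ca028ca4, 0x1806118ca228ca4,
    0x1806118ca0290a5, 0x61188802048220c84, 0x1886320483210c0, 0x601846218c80204c6,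
    0x180611886330cc4, 0x1846218c83210e0]
    8 = true := by
  decide +kernel

set_option maxRecDepth 1000000 in
set_option maxHeartbeats 0 in
theorem check_14_2 : check 14 2
    0x1
    [0x6140129]
    0 = true := by
  decide +kernel

set_option maxRecDepth 1000000 in
set_option maxHeartbeats 0 in
theorem check_14_3 : check 14 3
    0x1bf
    [0xc0394e6, 0x2008330108, 0x18c8038108, 0x8041506, 0x180a028929, 0x1806238129, 0x180613014a,
    0x180812814a]
    1 = true := by
  decide +kernel

set_option maxRecDepth 1000000 in
set_option maxHeartbeats 0 in
theorem check_14_4 : check 14 4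
    0x13f7fffffff
    [0x280a530cc4, 0x280a3310c5, 0x280a1314c6, 0x200c3310c5, 0x200c1314c6, 0x60184c0314c6,
    0x28ca4294e0, 0x6218ca0300e7, 0x8020883280e7, 0x8020484280e7, 0x60188a3300e7, 0x60184a4300e7,
    0x6120084300e7, 0x60200a0294e7, 0x20081394e6, 0x20083390e5, 0x18ca0390e5, 0x60200a228ce7,
    0x184a0394e6, 0x6018480390e7, 0x80280a3290a5, 0x632008128108, 0x611888130108, 0x601848330108,
    0x6118c8030108, 0x601888230108, 0x61188a028508, 0x60184a028d08, 0x601846338108,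
    0x6018c8130108, 0x6018ca028508, 0x1806141506, 0x1806341105, 0x602008120929, 0x611888028129,
    0x601846230129, 0x601848228129, 0x60184802054a]
    5 = true := by
  decide +kernel

set_option maxRecDepth 1000000 in
set_option maxHeartbeats 0 in
theorem check_14_5 : check 14 5
    0x1004f5c07fffbfffffffff
    [0x80284a3290a5, 0x18061280a3290a5, 0x83210a1294c0, 0x8220ca3294c0, 0x80210a4294c0,
    0x2008120c84280a5, 0x1808020c84280c6, 0x1808120884280c6, 0x18063200a0290c6, 0x18062200a0294c6,
    0x18063280a228ca5, 0x18462200a0290c6, 0x18061200a2290c6, 0x1848120883280c6, 0x1806320084300c6,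
    0x6320ca030cc4, 0x62210a030cc4, 0x1846218ca0304c6, 0x18863200a0288c6, 0x1848020884280c6,
    0x63204a0310c5, 0x62208a0310c5, 0x6120ca0310c5, 0x60210a0310c5, 0x1806118ca030cc6,
    0x1888020883280c6, 0x1888020484280c6, 0x18080204a3290a5, 0x62200a0314c6, 0x61204a0314c6,
    0x60208a0314c6, 0x18c8020483280c6, 0x18080210a0290a5, 0x6218cc130cc4, 0x6118cc0310c5,
    0x60184c3310c5, 0x18081208a228ca5, 0x60188c0314c6, 0x180802048220ce7, 0x1886320081280e7,
    0x1846220482280e7, 0x1806118ca0288e7, 0x18061188a028ce7, 0x1806320482280e7, 0x1846320082280e7,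
    0x1806320083280e7, 0x1846220083280e7, 0x1808120ca0290a5, 0x1846218c80300e7, 0x1806218c81300e7,
    0x1806118883300e7, 0x1806118c82300e7, 0x1806220084280e7, 0x1806120883280e7, 0x1806118863380e7,
    0x6118c80390e5, 0x1808020ca228ca5, 0x6018880394e6, 0x1806218c8028108, 0x1806118c8128108,
    0x180611888228108, 0x180622008120908, 0x1806218ca0284e7, 0x180611888020529]
    27 = true := by
  decide +kernel

set_option maxRecDepth 1000000 in
set_option maxHeartbeats 0 in
theorem check_14_6 : check 14 6
    0x20200e807001febeffff
    [0x601848120c84280a5, 0x18083210a028ca4, 0x18082210a128ca4, 0x1808220ca228ca4,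
    0x18081210a228ca4, 0x1808220ca0290a5, 0x18081210a0290a5, 0x1808120ca1290a5, 0x18080210a1290a5,
    0x18081208a2290a5, 0x1808020ca2290a5, 0x6018863200a0290a5, 0x601888120884280a5,
    0x6018463200a228ca5, 0x601888020c84280a5, 0x18080208a3290a5, 0x18863280a228ca4,
    0x18463280a1290a5, 0x18462280a2290a5, 0x18063280a2290a5, 0x18062284a2290a5, 0x18062280a3290a5,
    0x601886320083280c6, 0x601846220883280c6, 0x611886320082280c6, 0x601846220484280c6,
    0x601846320084280c6, 0x601886320482280c6, 0x60188802048220cc6, 0x601846218ca0288c6,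
    0x1806120084310c5, 0x1846320081310c5, 0x1806120483310c5, 0x1806218ca0310c5, 0x18061188a0314c6,
    0x601846320081208e7, 0x601846218c81280e7, 0x1806218ca4294e0, 0x60184622008120ce7]
    44 = true := by
  decide +kernel

set_option maxRecDepth 1000000 in
set_option maxHeartbeats 0 in
theorem check_14_7 : check 14 7
    0x1c073c7f
    [0x601848020484290a5, 0x601848020c8428ca4, 0x60184812088428ca4, 0x6018c8020482290a5,
    0x601848220c84288a3, 0x601848020883290a5, 0x6018c802048428ca4, 0x6118863200a228ca4,
    0x6118863200a0290a5, 0x6018863200a1290a5, 0x6018463200a2290a5, 0x6018462200a3290a5,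
    0x6218c8120883210c0, 0x180611886320081208c6, 0x601846218ca4294c0, 0x601846218c80310c5,
    0x611886320883210e0]
    14 = true := by
  decide +kernel

set_option maxRecDepth 1000000 in
set_option maxHeartbeats 0 in
theorem check_14_8 : check 14 8
    0xf
    [0x1846218c8120883210a0, 0x601846218c802048220c84, 0x18061188632008328ca4,
    0x180611886320081290a5]
    1 = true := by
  decide +kernel

set_option maxRecDepth 1000000 in
set_option maxHeartbeats 0 in
theorem check_16_3 : check 16 3
    0xfff
    [0x180c438108, 0x200c031108, 0x2008338129, 0x280a128929, 0x18c8040129, 0x200823014a,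
    0x200a02894a, 0x180624014a, 0x1806348129, 0x180a02856b, 0x180613816b, 0x200812816b]
    0 = true := by
  decide +kernel

set_option maxRecDepth 1000000 in
set_option maxHeartbeats 0 in
theorem check_16_4 : check 16 4
    0x119bc77ffdefffffff
    [0x300c2314c6, 0x80208c0314c6, 0x60280c3310c6, 0x62280c0314c6, 0x61280a5300e7, 0x80284a228ce7,
    0x80280a2290e7, 0x82210a0300e7, 0x210c0390e5, 0x80280a2314c6, 0x208c0394e6, 0x60188c0390e7,
    0x200c0398e7, 0x180e2394e6, 0x80204a5300e7, 0x180e0398e7, 0x60280a228d08, 0x60280a129108,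
    0x802048430108, 0x802088330108, 0x6218ca038108, 0x81208a028908, 0x80204a029108,
    0x80210a028508, 0x60184a438108, 0x60184c031108, 0x60200a530108, 0x61210a030108,
    0x612008438108, 0x63208a030108, 0x6220ca030108, 0x188a041506, 0x180a041907, 0x63200a028529,
    0x602048330129, 0x6018ca130129, 0x632008130129, 0x60184a330129, 0x61188a130129,
    0x602008430129, 0x601888238129, 0x601848338129, 0x6118c8038129, 0x611888138129,
    0x6118ca030129, 0x601846340129, 0x612048230129, 0x802048328129, 0x60184a02894a,
    0x60184823014a, 0x60188813014a, 0x61188803014a, 0x60184623814a, 0x6018c803014a,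
    0x60184812816b, 0x60188802816b, 0x62200812814a]
    12 = true := by
  decide +kernel

set_option maxRecDepth 1000000 in
set_option maxHeartbeats 0 in
theorem check_16_5 : check 16 5
    0xb8001fbda00f3d7fffffb7bf3efabfffffefffffff
    [0xa228ca4294c0, 0x8028ca430cc4, 0x80288a530cc4, 0x80290a5308c3, 0x20081208a0294c6,
    0x80288a3310c5, 0x80284a4310c5, 0x80280a5310c5, 0x2008220ca028cc6, 0x18080280a3294c6,
    0x80284a2314c6, 0x80280a3314c6, 0x1808020ca0314c6, 0x83210c030cc4, 0x8220cc0310c5,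
    0x81210c0310c5, 0x80208c3310c5, 0x8020cc2310c5, 0x81208c0314c6, 0x8020cc0314c6,
    0x18462200c0314c6, 0x63280c2310c5, 0x62280c3310c5, 0x63280c0314c6, 0x62280c1314c6,
    0x61280c2314c6, 0x60280c3314c6, 0x18062200c2310c6, 0x18061200c3310c6, 0x18062280a228ce7,
    0x18061280a2290e7, 0x18061280a1294e7, 0x18462210a0300e7, 0x2008120884280e7, 0x1888020883300e7,
    0x1808120884300e7, 0x18863200a2300e7, 0x18080210a028ce7, 0x18463200a3300e7, 0x18063200a4300e7,
    0x18062200a5300e7, 0x18061210a2300e7, 0x1846320ca0300e7, 0x18080210a1288e7, 0x1808020c84300e7,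
    0x18863208a0300e7, 0x18462200a4300e7, 0x18080208a228ce7, 0x18080204a2290e7, 0x18081208a128ce7,
    0x1846218cc0304e7, 0x18063200c0314c6, 0x1806118cc030ce7, 0x18061188c0310e7, 0x18063210a0300e7,
    0x1808020ca128ce7, 0x1808020ca0290e7, 0x8020482394e6, 0x8020484390e5, 0x63210a038ce4,
    0x63208a0390e5, 0x6220ca0390e5, 0x61210a0390e5, 0x1806218ca0388e7, 0x1848020884300e7,
    0x63200a0394e6, 0x62204a0394e6, 0x61208a0394e6, 0x6020ca0394e6, 0x18061188a0390e7,
    0x18081208a0290e7, 0x61200a0398e7, 0x60204a0398e7, 0x1808120ca1288e7, 0x6218cc0390e5,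
    0x61188c0394e6, 0x6018cc0394e6, 0x60184c0398e7, 0x180812088328108, 0x18863200a028508,
    0x18c802048228108, 0x18463200a028908, 0x18062200a128d08, 0x18462200a028d08, 0x18061200a228d08,
    0x18061200a129108, 0x180612088330108, 0x180622008430108, 0x1846218ca030108, 0x180622048330108,
    0x180612048430108, 0x188632008130108, 0x184622048230108, 0x180632008330108, 0x180632048230108,
    0x1806118ca230108, 0x184622008330108, 0x184632008230108, 0x18462200a128908, 0x18061188a330108,
    0x18063200a128908, 0x188802048328108, 0x184802088328108, 0x184802048428108, 0x6018cc531900,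
    0x61188c531900, 0x1846218c8038108, 0x1806218c8138108, 0x1806118c8238108, 0x180611888338108,
    0x6218c8041105, 0x611888041506, 0x6018c8041506, 0x601848041907, 0x184632008128129,
    0x184622008228129, 0x18061188a028929, 0x180612008428129, 0x180632008228129, 0x180622048228129,
    0x1806218c8030129, 0x180611888230129, 0x1806118c8130129, 0x18061188812814a, 0x1806118c802814a,
    0x18061200812094a, 0x1806118ca028529]
    49 = true := by
  decide +kernel

set_option maxRecDepth 1000000 in
set_option maxHeartbeats 0 in
theorem check_16_6 : check 16 6
    0x8380002017f53fcc000203fe5ffffe3ff99ffffffffffffffffff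
    [0x20c84280a128ca4, 0x20883280a1290a5, 0x20484280a1290a5, 0x20483280a2290a5,
    0x20084280a2290a5, 0x20482284a2290a5, 0x20083284a2290a5, 0x20482280a3290a5, 0x20083280a3290a5,
    0x20081288a3290a5, 0x180a1288a3290a5, 0x20883210a1294c0, 0x20083210a3294c0, 0x2048220ca4294c0,
    0x632008120883280c6, 0x802048220c84280a5, 0x622008120884280c6, 0x6020081208a3290a5,
    0x6020883210a0284a5, 0x18c8028ca4294c0, 0x6018c80280a3290a5, 0x6118880280a3290a5,
    0x6018462280a2290c6, 0x6018480288a3290a5, 0x6118863280a1288c6, 0x6018480210a0290c6,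
    0x6018462280a1294c6, 0x601848020ca0294c6, 0x6018481208a0294c6, 0x602048220ca0290a5,
    0x2008120883310c5, 0x18c8220ca030cc4, 0x18c81210a030cc4, 0x18882210a030cc4, 0x18483210a030cc4,
    0x18c83210a0308c3, 0x6018c8020884300c6, 0x6018c8120883300c6, 0x611888120883300c6,
    0x6018863210a0300c6, 0x611886320ca0300c6, 0x18c81208a0310c5, 0x18c8020ca0310c5,
    0x1888120ca0310c5, 0x1848220ca0310c5, 0x18880210a0310c5, 0x18481210a0310c5, 0x18082210a0310c5,
    0x6118863200a030cc6, 0x6018863204a030cc6, 0x601846220ca030cc6, 0x6018463208a030cc6,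
    0x601888020c84300c6, 0x601848120c84300c6, 0x602008220c84280c6, 0x18c80204a0314c6,
    0x18880208a0314c6, 0x18481208a0314c6, 0x1848020ca0314c6, 0x1808120ca0314c6, 0x18080210a0314c6,
    0x6018462204a0314c6, 0x6018463200a0314c6, 0x6118c8020883300c6, 0x612008120c84280c6,
    0x18061288a3310c5, 0x18061280a5310c5, 0x18063280a530cc4, 0x18061290a5308c3, 0x1806128ca430cc4,
    0x18061288a530cc4, 0x18063280a1314c6, 0x18061284a4310c5, 0x18061280a3314c6, 0x18063284a2310c5,
    0x18863200c1310c5, 0x601846218cc030cc6, 0x18463200c2310c5, 0x18462200c3310c5,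
    0x18063200c3310c5, 0x18463200c0314c6, 0x18462200c1314c6, 0x18063200c1314c6, 0x18062200c2314c6,
    0x18061200c3314c6, 0x6020082210a0290a5, 0x601848120884280e7, 0x18082210a4294e0,
    0x18083210a3294e0, 0x6118863200a0288e7, 0x6018863200a1288e7, 0x601888120883280e7,
    0x611888020883280e7, 0x611888020484280e7, 0x6018463200a128ce7, 0x601888020884280e7,
    0x6018462200a228ce7, 0x6018c8020484280e7, 0x6018c8020883280e7, 0x6018462200a1290e7,
    0x6218c8020482280e7, 0x6018462200a0294e7, 0x6118c8020483280e7, 0x18463288a4294e0,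
    0x1846228ca4294e0, 0x1806328ca4294e0, 0x18863284a4294e0, 0x601846320483300e7,
    0x601846220883300e7, 0x601886320083300e7, 0x601846220484300e7, 0x601846320084300e7,
    0x601886320482300e7, 0x611886320082300e7, 0x602008220ca228ca5, 0x6018483210a0284c6,
    0x601846218ca2300e7, 0x1846218cc4314e0, 0x1806118cc5318e0, 0x601846218c80388e7,
    0x1806120083394e6, 0x1886320081390e5, 0x1806120482394e6, 0x1806320081394e6, 0x1806120081398e7,
    0x1806120883390e5, 0x1806320083390e5, 0x1846218ca0390e5, 0x1806118ca0394e6,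
    0x60184632048228108, 0x60184622048328108, 0x60184632008328108, 0x60188632008228108,
    0x60184622008428108, 0x61188632008128108, 0x601846218ca028508, 0x60184802048220d08,
    0x601846218c8130108, 0x180611886341105, 0x60184622008120929, 0x601846218c8028129,
    0x1846218ca429520]
    77 = true := by
  decide +kernel

set_option maxRecDepth 1000000 in
set_option maxHeartbeats 0 in
theorem check_16_7 : check 16 7
    0x71c3c61b9600603bffffffffffff
    [0x180612048220c84280a5, 0x6020883210a028ca4, 0x6020483210a128ca4, 0x6020482210a228ca4,
    0x6020083210a228ca4, 0x6020482210a0290a5, 0x6020083210a0290a5, 0x602048220ca1290a5,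
    0x6020082210a1290a5, 0x602008220ca2290a5, 0x6020081210a2290a5, 0x180622008220c84280a5,
    0x1806118880210a0290a5, 0x184622008120c84280a5, 0x180632008120c84280a5, 0x602008120ca3290a5,
    0x1806218c80208a0290a5, 0x6218c80280a2290a5, 0x6118c80284a2290a5, 0x1806118863280a1290a5,
    0x6118c80280a3290a5, 0x6118880284a3290a5, 0x6018c80284a3290a5, 0x1846218c80204a0290a5,
    0x1806118c81208a0290a5, 0x6018880288a3290a5, 0x1806118c8020ca0290a5, 0x1806118c8120883280c6,
    0x180611888120884280c6, 0x180611888020c84280c6, 0x1806118c8020884280c6, 0x6218c81208a3294c0,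
    0x6218c8020ca3294c0, 0x6118c83210a0294c0, 0x611888220ca3294c0, 0x6018c8220ca3294c0,
    0x6218c80210a3290c0, 0x1806218c8020484280c6, 0x6018c83210a1294c0, 0x6018883210a2294c0,
    0x6018483210a3294c0, 0x6218c80208a4294c0, 0x6118c81208a4294c0, 0x6018c80210a4294c0,
    0x6118880210a4294c0, 0x6018883210a3290c0, 0x6018482210a4294c0, 0x601888220ca4294c0,
    0x6218c83210a0290c0, 0x1806218c8020883280c6, 0x6218c82210a0294c0, 0x6018881210a4294c0,
    0x1806118863200a128cc6, 0x1806118863200a0290c6, 0x1846218c8020483280c6, 0x6118863284a4294c0,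
    0x6018863288a4294c0, 0x601846328ca4294c0, 0x601848120883310c5, 0x6118c8020482310c5,
    0x180611886320483300c6, 0x601848020884310c5, 0x180611886320084300c6, 0x611886320ca030cc4,
    0x6018863210a030cc4, 0x6118863204a0310c5, 0x6018863208a0310c5, 0x601846320ca0310c5,
    0x6018462210a0310c5, 0x6018863200a0314c6, 0x6018463204a0314c6, 0x6018462208a0314c6,
    0x180611886320482280e7, 0x180611886320083280e7, 0x18061188802048220ce7]
    71 = true := by
  decide +kernel

set_option maxRecDepth 1000000 in
set_option maxHeartbeats 0 in
theorem check_18_2 : check 18 2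
    0x1
    [0x615016b]
    0 = true := by
  decide +kernel

set_option maxRecDepth 1000000 in
set_option maxHeartbeats 0 in
theorem check_18_3 : check 18 3
    0x3bff
    [0x10041907, 0x210c038129, 0xc049927, 0x200a33814a, 0x200834014a, 0x18c804814a, 0x8051947,
    0x200823816b, 0x180824016b, 0x180624816b, 0x200a02858c, 0x200813018c, 0x180614018c]
    1 = true := by
  decide +kernel

set_option maxRecDepth 1000000 in
set_option maxHeartbeats 0 in
theorem check_18_4 : check 18 4
    0x479bfeefffffeffffffffffff
    [0x300c5390e5, 0x300c3394e6, 0x300c1398e7, 0x280e3394e6, 0x280e1398e7, 0x61200e0398e7,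
    0x30cc531900, 0x80304c3310c6, 0x61280a538108, 0x60288a438108, 0x61280c0398e7, 0x62280a438108,
    0x62200c438108, 0x61200c538108, 0x60200e3390e7, 0x80280a1398e7, 0x60200c638108, 0x280a141907,
    0x280a341506, 0xa0284a228d08, 0x80204c031508, 0x20cc041506, 0x80208c031108, 0x204c041907,
    0x60184c041508, 0x18ce041506, 0x60184e039508, 0x184e041907, 0x80204c0398e7, 0x63280a230129,
    0x60280a530129, 0x80280a228d29, 0x61210a038129, 0x802048438129, 0x802088338129,
    0x80204a430129, 0x6218cc038129, 0x60184c438129, 0x60200a538129, 0x61280a430129,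
    0x6218ca040129, 0x80280a129129, 0x62280a330129, 0x8220ca030129, 0x60184a440129,
    0x62284a230129, 0x81208a230129, 0x81210a030129, 0x2008149927, 0x2008349526, 0x18ca049526,
    0x6220ca038129, 0x184a049927, 0x601848049129, 0x60280a128d4a, 0x81208a02854a, 0x80204833014a,
    0x60184c030d4a, 0x60204833814a, 0x61204823814a, 0x63200813814a, 0x60184a33814a,
    0x61188c03054a, 0x6018cc03054a, 0x60200843814a, 0x61200833814a, 0x60188824014a,
    0x60184834014a, 0x6118c804014a, 0x61188814014a, 0x6118ca03814a, 0x60184634814a,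
    0x61188a13814a, 0x60188a23814a, 0x1806151947, 0x1806351546, 0x80204822816b, 0x62200813016b,
    0x60184a23016b, 0x60204823016b, 0x60184823816b, 0x61188803816b, 0x6018c803816b,
    0x60184624016b, 0x61188a03016b, 0x60184a02858c, 0x61200812818c, 0x60188803018c,
    0x60184813018c, 0x6018480281ad]
    9 = true := by
  decide +kernel

set_option maxRecDepth 1000000 in
set_option maxHeartbeats 0 in
theorem check_18_5 : check 18 5
    0x401ff0003897fffae01f00bfffebffffe95ffffc7adddbfffffbfffffeffffffffffffffffffffff
    [0xa3294c030cc4, 0xa3290c130cc4, 0xa2290c0310c5, 0xa1294c0310c5, 0xa1288c3310c5,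
    0xa028cc3310c5, 0x180a0290a5300c6, 0xa128cc0314c6, 0xa0290c0314c6, 0x180a0284a3314c6,
    0x180a228ca4300c6, 0x80304c3314c6, 0x18062300c3310c6, 0x80300c4314c6, 0x180a0284a3290e7,
    0x180a0284a2294e7, 0x20081280a2294e7, 0x84280c5318e0, 0x20483210a0300e7, 0x20081208a5300e7,
    0x18462280c230ce7, 0x18463280c0310e7, 0x2008220ca3300e7, 0x18062280c2310e7, 0x18080280c4314c6,
    0x18063280c0314e7, 0x1808020cc0314e7, 0x18061280c2314e7, 0x18062280c0318e7, 0x18061280c3310e7,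
    0x60310c5318e0, 0x18063300c1314c6, 0x2008120cc0314c6, 0x18063280c230ce7, 0x8028ca538ce4,
    0x18063280a5380e7, 0x80288a4390e5, 0x80284a5390e5, 0x1806128ca4380e7, 0x20081280a3290e7,
    0x20082280a2290e7, 0x80284a3394e6, 0x80280a4394e6, 0x18c80204a0390e7, 0x18080210a0390e7,
    0x80280a2398e7, 0x18080208a0398e7, 0x18863280c030ce7, 0x82210c0390e5, 0x2008120c84380e7,
    0x18080204c3310e7, 0x8120cc0394e6, 0x80210c0394e6, 0x20482280a228ce7, 0x18463200c0390e7,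
    0x80208c0398e7, 0x18062200c0398e7, 0x63294c038ce4, 0x18462280c0314e7, 0x6328cc0390e5,
    0x62290c0390e5, 0x61294c0390e5, 0x18080208c0318e7, 0x20482280a1290e7, 0x180a1288a330cc6,
    0x18880280c3310c6, 0x63284c0394e6, 0x62288c0394e6, 0x6128cc0394e6, 0x60290c0394e6,
    0x18084280c0314c6, 0x20084280a5300c6, 0x18082280c3310c6, 0x20083210a1300e7, 0x62280c0398e7,
    0x61284c0398e7, 0x60288c0398e7, 0x18061204c0398e7, 0x18480204a0398e7, 0x63200e1394e6,
    0x62200e2394e6, 0x63200e3390e5, 0x1806118ce0390e7, 0x61200e3394e6, 0x60200e4394e6,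
    0x62200e0398e7, 0x61200e1398e7, 0x60200e2398e7, 0x20082210a2300e7, 0x280a1288a3290a5,
    0x18863280a230108, 0x18c80280a128d08, 0x18463280a330108, 0x2008120ca028d08, 0x18062288a330108,
    0x18462280a430108, 0x20081208a029108, 0x18061288a430108, 0x18062280a530108, 0x18061284a530108,
    0x8220cc431900, 0x200812088430108, 0x80210c531900, 0x18863200c030908, 0x18462200c130d08,
    0x18463200c130908, 0x18462200c031108, 0x18062200c031508, 0x18063280a430108, 0x18083210a030108,
    0x18063200c130d08, 0x18482210a030108, 0x18463200c030d08, 0x18061200c231108, 0x18881210a030108,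
    0x18061200c131508, 0x18061200c031908, 0x18063210a038108, 0x188802088338108, 0x188802048438108,
    0x18c802048338108, 0x1808020c8438108, 0x180812088438108, 0x1806120ca338108, 0x18061208a438108,
    0x18062200a538108, 0x18863200a238108, 0x1846320ca038108, 0x1888220ca030108, 0x18061210a238108,
    0x18462210a038108, 0x18063200a438108, 0x18462200a438108, 0x18463200a338108, 0x184812088338108,
    0x18863208a038108, 0x1846218cc138108, 0x18062200c131108, 0x1806218cc238108, 0x18062200c230d08,
    0x18c80210a030108, 0x1806118cc338108, 0x18c8120ca030108, 0x18c80204a330108, 0x18061188c438108,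
    0x18880204a430108, 0x2048220ca028508, 0x18480284a228d08, 0x6218ce439900, 0x6018ce539d00,
    0x18880280a228d08, 0x18080284a229108, 0x180632008440108, 0x6320ca041105, 0x62210a041105,
    0x1846218ca040508, 0x18080280a329108, 0x18880280a129108, 0x63204a041506, 0x62208a041506,
    0x6120ca041506, 0x60210a041506, 0x1806118ca040d08, 0x184802088438108, 0x18480280a229108,
    0x18480280a129508, 0x62200a041907, 0x61204a041907, 0x60208a041907, 0x18080280a229508,
    0x60200a041d08, 0x6118cc041506, 0x60188c041907, 0x18462280a128929, 0x18061280a228d29,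
    0x200812088328129, 0x18863204a030129, 0x188802048330129, 0x18863200a130129, 0x18c802048230129,
    0x18463200a230129, 0x18462200a330129, 0x18062200a430129, 0x18063204a230129, 0x18063280a128929,
    0x18063200a330129, 0x18062204a330129, 0x18462208a130129, 0x18061204a430129, 0x18462204a230129,
    0x18061200a530129, 0x18061208a330129, 0x180802088430129, 0x18061188c030d29, 0x184802048430129,
    0x180812088330129, 0x184802088330129, 0x180632008338129, 0x180622008438129, 0x1846218ca038129,
    0x180632048238129, 0x180612048438129, 0x188632008138129, 0x184622048238129, 0x180612088338129,
    0x184632008238129, 0x1806118ca238129, 0x184622008338129, 0x180622048338129, 0x18463208a030129,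
    0x18061188a338129, 0x1846220ca030129, 0x1806320ca030129, 0x1846218c8040129, 0x1806218c8140129,
    0x1806118c8240129, 0x180611888340129, 0x200a0288a3290c6, 0x180611886348129, 0x6118c8049526,
    0x1808220ca230108, 0x601888049927, 0x18880204822814a, 0x18463200a02854a, 0x18062200a12894a,
    0x18462200a02894a, 0x18063200a02894a, 0x18061204833014a, 0x1806218ca03014a, 0x18062204823014a,
    0x18463200813014a, 0x18061200843014a, 0x1806118ca13014a, 0x18462200823014a, 0x18063200823014a,
    0x18080208832814a, 0x18061188a23014a, 0x18080204842814a, 0x18480204832814a, 0x18061200a128d4a,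
    0x1806218c803814a, 0x18061188823814a, 0x1806118c813814a, 0x18462200812816b, 0x18061188a02856b,
    0x18061200832816b, 0x18063200812816b, 0x18061204822816b, 0x18061188813016b, 0x1806118c803016b,
    0x18062200822816b, 0x18081208a128929, 0x18061188802818c]
    71 = true := by
  decide +kernel

set_option maxRecDepth 1000000 in
set_option maxHeartbeats 0 in
theorem check_18_6 : check 18 6
    0x203c00009000041f95fffa01c0000200fe0010004dfffffffeffb3c1f83d009df3ff9fffe0003fffffdfebffffffffffffbffbf7fffffbffffffffffff
    [0x61200a1288a3290a5, 0x60184a0288a3290c6, 0x60184a0284a3294c6, 0x20884280a1310c5,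
    0x20084284a2310c5, 0x20081280a4314c6, 0x20081284a5310c5, 0x20084280a1314c6, 0x2008128ca530cc4,
    0x8020883210a0284c6, 0x20081288a4310c5, 0x20082288a3310c5, 0x802048220ca0290c6,
    0x6020083210a030cc6, 0x6020883210a0304c6, 0x602008220ca0314c6, 0x6018c8028ca4300c6,
    0x6020081280a4294c6, 0x6320083210a0300c6, 0x6120883210a0300c6, 0x6020081210a0314c6,
    0x6020482210a030cc6, 0x6218c80280a5300c6, 0x180a228ca430cc4, 0x180a128ca530cc4,
    0x180a0290a530cc4, 0x180a2290a5308c3, 0x6220081208a0314c6, 0x6018480290a5300c6,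
    0x180a1288a4310c5, 0x180a028ca4310c5, 0x180a0288a5310c5, 0x6120083210a0308c6,
    0x6020081288a3290c6, 0x6020081284a3294c6, 0x180a0288a3314c6, 0x180a0284a4314c6,
    0x6018480284a3314c6, 0x20883210c030cc4, 0x20482210c0310c5, 0x20083210c0310c5,
    0x2008120cc3310c5, 0x20081210c2310c5, 0x2008220cc0314c6, 0x20081210c0314c6,
    0x6118c80204c0314c6, 0x18c84280c0310c5, 0x18c83280c1310c5, 0x18884280c1310c5,
    0x18c84280c230cc4, 0x18c82280c2310c5, 0x18883280c2310c5, 0x18484280c2310c5, 0x18c81280c3310c5,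
    0x18882280c3310c5, 0x18483280c3310c5, 0x18084280c3310c5, 0x18c82280c0314c6, 0x18883280c0314c6,
    0x18484280c0314c6, 0x18c81280c1314c6, 0x18882280c1314c6, 0x18483280c1314c6, 0x18084280c1314c6,
    0x18c80280c2314c6, 0x18881280c2314c6, 0x18482280c2314c6, 0x18083280c2314c6, 0x18880280c3314c6,
    0x18481280c3314c6, 0x18082280c3314c6, 0x6018863280c0314c6, 0x6018480210c0314c6,
    0x6018480280a4314c6, 0x6018463280c2310c6, 0x601888020cc0314c6, 0x6018c80208c0314c6,
    0x6018880280a3314c6, 0x6018462280c3310c6, 0x601848120cc0314c6, 0x18480280c4314c6,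
    0x18081280c4314c6, 0x612008120ca0314c6, 0x18863300c2310c5, 0x18463300c3310c5,
    0x18463300c1314c6, 0x18462300c2314c6, 0x18063300c2314c6, 0x18062300c3314c6, 0x18062304c2314c6,
    0x622008220ca030cc6, 0x18061300c4314c6, 0x20883288a4294e0, 0x20484288a4294e0,
    0x2048328ca4294e0, 0x2008428ca4294e0, 0x20c84280a4294e0, 0x6218c80280a128ce7,
    0x20c84288a3290e0, 0x6118c80280a228ce7, 0x6118880284a228ce7, 0x6018880280a3290e7,
    0x8020483280a3290a5, 0x6018c80280a1294e7, 0x6018c80284a228ce7, 0x6018480284a3290e7,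
    0x6018883210a0300e7, 0x622008120884300e7, 0x6018483210a1300e7, 0x632008120883300e7,
    0x6018c80210a2300e7, 0x601848220ca3300e7, 0x6018880210a3300e7, 0x601888020ca4300e7,
    0x6118880204a5300e7, 0x6018c82210a0300e7, 0x6118c8220ca0300e7, 0x6118882210a0300e7,
    0x6118863284a2300e7, 0x6018480284a2294e7, 0x6118880210a2300e7, 0x6118863280a3300e7,
    0x6218c80210a0300e7, 0x6018481210a3300e7, 0x6018863284a3300e7, 0x6018480280a3294e7,
    0x6018c8020ca3300e7, 0x6018482210a2300e7, 0x6018463288a3300e7, 0x18c84290a5300e0,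
    0x6218c8120ca0300e7, 0x602008220c84300e7, 0x6018863280a4300e7, 0x6118880208a4300e7,
    0x612008120c84300e7, 0x6018480210a4300e7, 0x6018463284a4300e7, 0x6118880280a1294e7,
    0x6018880284a2290e7, 0x6118880280a2290e7, 0x6018462288a4300e7, 0x6018c80280a2290e7,
    0x6020483210a0284e7, 0x6018463280a5300e7, 0x6018c80204a5300e7, 0x6020482210a0288e7,
    0x601848020ca5300e7, 0x6018462284a5300e7, 0x602048220ca028ce7, 0x6020081210a0290e7,
    0x602008220ca0290e7, 0x602008120ca0294e7, 0x18083210c4314e0, 0x18082210c4318e0,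
    0x1808220cc5318e0, 0x18081210c5318e0, 0x18083210c3318e0, 0x6118863200c030ce7,
    0x6118863200c1308e7, 0x602048220ca1288e7, 0x6018463200c230ce7, 0x6020082210a1288e7,
    0x6018863200c0310e7, 0x6020081210a128ce7, 0x6018463200c1310e7, 0x602008220ca128ce7,
    0x6018462200c2310e7, 0x602008120ca228ce7, 0x6018463200c0314e7, 0x6020081208a2290e7,
    0x6018462200c1314e7, 0x6020081208a1294e7, 0x6018462200c0318e7, 0x602008120ca1290e7,
    0x18863280c5318e0, 0x6218c8020483380e7, 0x611886320ca0380e7, 0x6018863210a0380e7,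
    0x18883210a038ce4, 0x6020083280a3290c6, 0x18c8120ca0390e5, 0x1888220ca0390e5,
    0x18c80210a0390e5, 0x18881210a0390e5, 0x18482210a0390e5, 0x18083210a0390e5,
    0x6118863204a0388e7, 0x601846320ca0388e7, 0x18c82210a038ce4, 0x6118c8020883380e7,
    0x6018462210a0388e7, 0x18c80208a0394e6, 0x18881208a0394e6, 0x1888020ca0394e6,
    0x1848120ca0394e6, 0x1808220ca0394e6, 0x18480210a0394e6, 0x18081210a0394e6,
    0x6018463204a0390e7, 0x6018462208a0390e7, 0x6118863200a038ce7, 0x601888020c84380e7,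
    0x18880204a0398e7, 0x18480208a0398e7, 0x18081208a0398e7, 0x1808020ca0398e7,
    0x6018462200a0398e7, 0x18061280a4394e6, 0x18061284a5390e5, 0x18463280a1394e6,
    0x18061288a4390e5, 0x18863210c038ce4, 0x18863208c0390e5, 0x1846320cc0390e5, 0x18462210c0390e5,
    0x18063210c0390e5, 0x18863200c0394e6, 0x18463204c0394e6, 0x18462208c0394e6, 0x18063208c0394e6,
    0x1806220cc0394e6, 0x18061210c0394e6, 0x18462200c0398e7, 0x18063200c0398e7, 0x18062204c0398e7,
    0x18061208c0398e7, 0x1846218ce1390e5, 0x1806218ce0394e6, 0x18061188e0398e7, 0x20883210a329100,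
    0x20083210a429500, 0x6118880210a028508, 0x6218c80204a028908, 0x611888120ca028508,
    0x6118880204a029108, 0x6018881210a028508, 0x6018462280a228d08, 0x6018863280a128908,
    0x6018c80210a028508, 0x601888220ca028508, 0x6018c8120ca028508, 0x6218c80208a028508,
    0x6118c81208a028508, 0x60184812088430108, 0x601886320ca030108, 0x6118863208a030108,
    0x6018463210a030108, 0x61188802048430108, 0x60188812088330108, 0x601848020c8430108,
    0x6118863204a130108, 0x6018c802088330108, 0x61188802088330108, 0x60188802088430108,
    0x6018462210a130108, 0x6018c802048430108, 0x6118c802048330108, 0x6018463208a230108,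
    0x6018863204a230108, 0x601846220ca230108, 0x6118863200a230108, 0x6218c802048230108,
    0x6118c8020ca028508, 0x602008120c8428108, 0x6018863200a330108, 0x6018462208a330108,
    0x6018463204a330108, 0x61200812088428108, 0x62200812088328108, 0x6018462204a430108,
    0x6018463200a430108, 0x6018462200a530108, 0x601846218cc030908, 0x60184632048338108,
    0x60184622088338108, 0x60188632008338108, 0x60184622048438108, 0x60184632008438108,
    0x60188632048238108, 0x61188632008238108, 0x601846218ca238108, 0x180612008241907,
    0x180612008441506, 0x180612048341506, 0x1806218ca041506, 0x18061188a041907,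
    0x60184812088328129, 0x6118863200a028529, 0x60184802088428129, 0x6018863200a028929,
    0x60188802048428129, 0x6018463200a128929, 0x60188802088328129, 0x6018463200a028d29,
    0x61188802048328129, 0x6018462200a128d29, 0x6018c802048328129, 0x6018462200a029129,
    0x6118c802048228129, 0x6018462280a129108, 0x6018463280a128d08, 0x60184632048230129,
    0x60184622048330129, 0x60184632008330129, 0x61188632008130129, 0x60184622008430129,
    0x60188632008230129, 0x601846218ca130129, 0x1806218cc531920, 0x601846218c8138129,
    0x6018462204822814a, 0x6018462200832814a, 0x6018463200822814a, 0x6018863200812814a,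
    0x601846218c803014a]
    192 = true := by
  decide +kernel

set_option maxRecDepth 1000000 in
set_option maxHeartbeats 0 in
theorem check_18_7 : check 18 7
    0x601000000660039fffffb1e1d1fc0100000802008047fc016ffff8fc1fffffffffc07ff009fffc4dffffffffffff5fffffffefff
    [0x8220c84280a128ca4, 0x8120884280a1290a5, 0x8020c84280a1290a5, 0x8120883280a2290a5,
    0x8020884280a2290a5, 0x8020883284a2290a5, 0x8020484284a2290a5, 0x8020883280a3290a5,
    0x8020484280a3290a5, 0x8020482288a3290a5, 0x63200a0288a3290a5, 0x62200a1288a3290a5,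
    0x8120883210a3290c0, 0x8020483210a4294c0, 0x184802048220c84280c6, 0x1808120883210a0288a5,
    0x6020c84284a4294c0, 0x6020884288a4294c0, 0x6020c84288a3294c0, 0x602088328ca4294c0,
    0x1806218c80284a228cc6, 0x1806120084280a3290a5, 0x602048428ca4294c0, 0x1806120483280a3290a5,
    0x1806218c80280a2290c6, 0x1808020883210a028ca5, 0x1806118c80284a2290c6,
    0x1806220083280a3290a5, 0x1806118c80280a3290c6, 0x1806120883210a0284c6,
    0x1806118880284a3290c6, 0x1806120483210a0288c6, 0x1806218c80280a1294c6,
    0x1806120081210a0294c6, 0x1806118c80280a2294c6, 0x180612008220ca0294c6,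
    0x1806118880284a2294c6, 0x1806118880280a3294c6, 0x180622008120ca0294c6,
    0x1806320081208a0294c6, 0x6218ca028ca4294c0, 0x61188a228ca4294c0, 0x6018ca228ca4294c0,
    0x6118ca128ca4294c0, 0x6218ca1288a4294c0, 0x802048220c8430cc4, 0x6320482210a030cc4,
    0x6320083210a030cc4, 0x6220483210a030cc4, 0x6120883210a030cc4, 0x6320883210a0308c3,
    0x180612048220c84300c6, 0x1846220081208a0294c6, 0x180612048220ca0290c6,
    0x1806120082210a0290c6, 0x180622008220ca0290c6, 0x632008220ca0310c5, 0x622048220ca0310c5,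
    0x6320081210a0310c5, 0x6220082210a0310c5, 0x6120482210a0310c5, 0x6120083210a0310c5,
    0x6020483210a0310c5, 0x180622008220c84300c6, 0x1846218c80208a030cc6, 0x180611888220ca030cc6,
    0x1806118881210a030cc6, 0x1806118c80210a030cc6, 0x1806218c8020ca030cc6,
    0x1806120083210a028cc6, 0x6320081208a0314c6, 0x622008120ca0314c6, 0x612008220ca0314c6,
    0x602048220ca0314c6, 0x6120081210a0314c6, 0x6020082210a0314c6, 0x1806118881208a0314c6,
    0x180611888020ca0314c6, 0x1806118c80208a0314c6, 0x1806218c80204a0314c6, 0x6218c80288a330cc4,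
    0x6218c80284a430cc4, 0x6118c80288a430cc4, 0x611888028ca430cc4, 0x6018c8028ca430cc4,
    0x6218c80280a530cc4, 0x6118c80284a530cc4, 0x6118880288a530cc4, 0x6018c80288a530cc4,
    0x601888028ca530cc4, 0x6018480290a530cc4, 0x6218c8028ca4308c3, 0x6118c8028ca5308c3,
    0x6218c80288a5308c3, 0x6118880290a5308c3, 0x6018c80290a5308c3, 0x1806120482210a028cc6,
    0x6218c80284a2310c5, 0x6218c80280a3310c5, 0x6118c80284a3310c5, 0x6118880288a3310c5,
    0x6018c80288a3310c5, 0x6118c80280a4310c5, 0x6118880284a4310c5, 0x6018c80284a4310c5,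
    0x6018880288a4310c5, 0x601848028ca4310c5, 0x6118880280a5310c5, 0x6018c80280a5310c5,
    0x6018880284a5310c5, 0x6018480288a5310c5, 0x6218c80290a5304c2, 0x1806220083210a0288c6,
    0x6218c80280a1314c6, 0x6118c80280a2314c6, 0x6118880284a2314c6, 0x6018c80284a2314c6,
    0x6118880280a3314c6, 0x6018c80280a3314c6, 0x6018880284a3314c6, 0x6018480288a3314c6,
    0x6018880280a4314c6, 0x6018480284a4314c6, 0x6018480280a5314c6, 0x6218c8220cc030cc4,
    0x6218c81210c030cc4, 0x6218c80210c130cc4, 0x6218c83210c0308c3, 0x6118883210c030cc4,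
    0x6018c83210c030cc4, 0x6018883210c130cc4, 0x6218c81208c0310c5, 0x6218c8020cc0310c5,
    0x6118c8120cc0310c5, 0x611888220cc0310c5, 0x6018c8220cc0310c5, 0x6118c80210c0310c5,
    0x6118881210c0310c5, 0x6018c81210c0310c5, 0x6018882210c0310c5, 0x6018483210c0310c5,
    0x6218c80204c2310c5, 0x6118c80204c3310c5, 0x6018880210c2310c5, 0x6018483210c230cc4,
    0x6018c80208c3310c5, 0x601848220cc2310c5, 0x6018481210c2310c5, 0x6018c81208c2310c5,
    0x6018480210c3310c5, 0x6118c82210c030cc4, 0x6218c80204c0314c6, 0x6118c80208c0314c6,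
    0x6118881208c0314c6, 0x6018c81208c0314c6, 0x611888020cc0314c6, 0x6018c8020cc0314c6,
    0x601888120cc0314c6, 0x601848220cc0314c6, 0x6018880210c0314c6, 0x6018481210c0314c6,
    0x6018480204c4314c6, 0x1806118863200c0314c6, 0x6118863280c2310c5, 0x6018863280c3310c5,
    0x6118863280c0314c6, 0x6018863280c1314c6, 0x6018463280c2314c6, 0x6018462280c3314c6,
    0x1846218c81208a0284e7, 0x1806118c80210a0288e7, 0x1846218c80208a0288e7,
    0x1806218c81208a0288e7, 0x1806118881210a0288e7, 0x1806118c8020ca028ce7,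
    0x1806118880210a028ce7, 0x1806118c8220ca0284e7, 0x1806218c80210a0284e7,
    0x1806218c8020ca0288e7, 0x180611888020ca0290e7, 0x1806118881208a0290e7,
    0x1806218c80208a028ce7, 0x6020483210a4294e0, 0x1806118c80204a0294e7, 0x1806118880208a0294e7,
    0x6218c8028ca4294e0, 0x184622008120884280e7, 0x184632008120883280e7, 0x180632008120884280e7,
    0x1806118c8120883300e7, 0x180611888120884300e7, 0x180611888020c84300e7,
    0x1806118c8020884300e7, 0x6218c83210a5300e0, 0x1806218c8020883300e7, 0x1806118863210a0300e7,
    0x1806218c8020484300e7, 0x1846218c8020483300e7, 0x180611886320ca1300e7,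
    0x1806118863208a2300e7, 0x1806118863204a3300e7, 0x1806118863200a4300e7, 0x6118863200c5318e0,
    0x6018c8020482394e6, 0x601848020883394e6, 0x6018c8020484390e5, 0x6218c8020482390e5,
    0x601848020482398e7, 0x601848020c84390e5, 0x601848020484394e6, 0x6118863210a038ce4,
    0x6118863208a0390e5, 0x601886320ca0390e5, 0x6018463210a0390e5, 0x6118863200a0394e6,
    0x6018863204a0394e6, 0x6018463208a0394e6, 0x601846220ca0394e6, 0x6018463200a0398e7,
    0x6018462204a0398e7, 0x601846218cc0394e6, 0x18061188812088328108, 0x18061188802088428108,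
    0x1806118c802048428108, 0x1846218c8020ca0284e7, 0x1806218c8120ca0284e7,
    0x1806118c802088328108, 0x6020883210a3294e0, 0x1806118c81210a0284e7, 0x180611888220ca0288e7,
    0x1806118c8120ca0288e7, 0x1806118882210a0284e7, 0x1846218c80204a028ce7, 0x6018483210a429500,
    0x1806118863200a128908, 0x180611888120ca028ce7, 0x1806118c81208a028ce7, 0x6218c81208a429500,
    0x1846218c80280a228cc6, 0x6218c8020ca429500, 0x1806218c802048328108, 0x1846218c802048228108,
    0x1806118863200a028d08, 0x180612008220c84280e7, 0x180622008120c84280e7, 0x601886328ca429500,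
    0x6118863288a429500, 0x18061188632048230108, 0x18061188632008330108, 0x601846218cc531900,
    0x601846218c8041506, 0x18061188632008228129]
    188 = true := by
  decide +kernel

set_option maxRecDepth 1000000 in
set_option maxHeartbeats 0 in
theorem check_18_8 : check 18 8
    0xc0020023ff8df0fc07f07ff0021023fffffffffffffffffffffff
    [0x1808120883210a128ca4, 0x1808020883210a228ca4, 0x1808020883210a0290a5,
    0x1808020483210a1290a5, 0x1808020482210a2290a5, 0x6018c802048220c84280a5,
    0x61188802048220c84280a5, 0x180802048220ca3290a5, 0x1886320883280a128ca4,
    0x1846320883280a228ca4, 0x1886320084280a228ca4, 0x1886320484280a128ca4,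
    0x1846220c84280a128ca4, 0x1806320c84280a128ca4, 0x1806220c84280a228ca4,
    0x1886320482280a1290a5, 0x1886320083280a1290a5, 0x1846320483280a1290a5,
    0x1846220883280a1290a5, 0x1806320883280a1290a5, 0x1846320084280a1290a5,
    0x1846220484280a1290a5, 0x1806320484280a1290a5, 0x1806220884280a1290a5,
    0x1806120c84280a1290a5, 0x1886320082280a2290a5, 0x1846320482280a2290a5,
    0x1846320083280a2290a5, 0x1846220483280a2290a5, 0x1806320483280a2290a5,
    0x1806220883280a2290a5, 0x1846220084280a2290a5, 0x1806320084280a2290a5,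
    0x1806220484280a2290a5, 0x1806120884280a2290a5, 0x1886320081284a2290a5,
    0x1806320482284a2290a5, 0x1806320083284a2290a5, 0x1846220482284a2290a5,
    0x1806320884280a228ca4, 0x1806120883284a2290a5, 0x1806220084284a2290a5,
    0x1846220083284a2290a5, 0x1806120484284a2290a5, 0x1806120c84284a228ca4,
    0x1886320081280a3290a5, 0x1846320082280a3290a5, 0x1846220482280a3290a5,
    0x1806320482280a3290a5, 0x1846220083280a3290a5, 0x1806320083280a3290a5,
    0x1806220483280a3290a5, 0x1806120883280a3290a5, 0x1806220084280a3290a5,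
    0x1806120484280a3290a5, 0x1806320081288a3290a5, 0x1846220081288a3290a5,
    0x1806120482288a3290a5, 0x1806120083288a3290a5, 0x601846218c80280a3290a5,
    0x60184632008220ca0290a5, 0x60184622048220ca0290a5, 0x1846218ca0284a2290a5,
    0x1806218ca0284a3290a5, 0x1806118ca0288a3290a5, 0x18061188a1288a3290a5,
    0x60184622008220c84280c6, 0x601846218c8220ca0284c6, 0x1846320883210a0294c0,
    0x1886320081210a3294c0, 0x1886320883210a0290c0, 0x601846218c81210a0284c6,
    0x1806320883210a1294c0, 0x60184632008120c84280c6, 0x1806320083210a3294c0,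
    0x1806220883210a2294c0, 0x1806120883210a3294c0, 0x188632008120ca4294c0,
    0x1846320081210a4294c0, 0x1806220883210a3290c0, 0x180632048220ca4294c0,
    0x184622048220ca4294c0, 0x1806220482210a4294c0, 0x60188632008120884280c6,
    0x1806120483210a4294c0, 0x601846218c80210a0288c6, 0x601846220082210a0290a5,
    0x1886320483210a0294c0, 0x1806220083210a4294c0, 0x601846218c8120ca0288c6,
    0x188632048220ca3290c0, 0x601846218c81208a028cc6, 0x611886320081208a0290a5,
    0x61188632008120883280c6, 0x601846218c80208a0290c6, 0x601846218c80204a0294c6,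
    0x1846218c8028ca4294c0, 0x180632008120883310c5, 0x180612048220c8430cc4,
    0x180612008120883314c6, 0x180612008120c84310c5, 0x601846218c8020884300c6,
    0x601846218c8120883300c6, 0x1846218c8220ca030cc4, 0x1846218c81210a030cc4,
    0x1806218c82210a030cc4, 0x1806118c83210a030cc4, 0x1846218c83210a0308c3,
    0x1846218c81208a0310c5, 0x1846218c8020ca0310c5, 0x1806218c8120ca0310c5,
    0x1806118c8220ca0310c5, 0x1806218c80210a0310c5, 0x1806118c81210a0310c5,
    0x1806118882210a0310c5, 0x1846218c80204a0314c6, 0x1806218c80208a0314c6,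
    0x1806118c81208a0314c6, 0x1806118c8020ca0314c6, 0x180611888120ca0314c6,
    0x1806118880210a0314c6, 0x1806118863280a530cc4, 0x1806118863280a3310c5,
    0x1806118863280a1314c6, 0x1806118863200c3310c5, 0x1806118863200c1314c6,
    0x601846218c8020883280e7, 0x601846218c8020484280e7, 0x1846218c81208a4294e0,
    0x1846218c8020ca4294e0, 0x1806218c8120ca4294e0, 0x1806118c8220ca4294e0,
    0x1806218c80210a4294e0, 0x1806118c81210a4294e0, 0x1806118882210a4294e0,
    0x601846218c8020ca028cc6, 0x1846218c83210a0294e0, 0x1846218c80210a3294e0,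
    0x1806118883210a3294e0, 0x1806118c83210a3290e0, 0x180611886328ca4294e0,
    0x180611886320081394e6, 0x180611886320083390e5]
    80 = true := by
  decide +kernel

set_option maxRecDepth 1000000 in
set_option maxHeartbeats 0 in
theorem check_18_9 : check 18 9
    0x1c107ffffd
    [0x18061188632008120c84280a5, 0x61188632048220ca028ca4, 0x611886320082210a028ca4,
    0x601886320482210a028ca4, 0x601886320083210a028ca4, 0x601846320483210a028ca4,
    0x601846220883210a028ca4, 0x611886320081210a128ca4, 0x61188632008220ca128ca4,
    0x60188632048220ca128ca4, 0x601846320083210a128ca4, 0x601846220483210a128ca4,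
    0x601846220083210a228ca4, 0x601886320883210a0288a3, 0x61188632008120ca0290a5,
    0x60188632008220ca0290a5, 0x60184632048220ca0290a5, 0x601886320081210a0290a5,
    0x601846320082210a0290a5, 0x601846220482210a0290a5, 0x601846220083210a0290a5,
    0x60184622008120ca3290a5, 0x601846218c80284a3290a5, 0x601846218c8220ca3294c0,
    0x601846218c83210a1294c0, 0x601846218c80210a4294c0]
    20 = true := by
  decide +kernel

/-! ### Dimensions -/

theorem finrank_map_add_finrank_cocycles {C : (k : ℕ) → Submodule ℝ (Fun 1 k)} (k : ℕ)
    [FiniteDimensional ℝ (C k)] : Module.finrank ℝ ((C k).map (coboundary 1 k)) +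
      Module.finrank ℝ (cocycles C k) = Module.finrank ℝ (C k) := by
  have h := LinearMap.finrank_range_add_finrank_ker ((coboundary 1 k).domRestrict (C k))
  rw [LinearMap.range_domRestrict] at h
  rw [← h, cocycles, ← Submodule.map_comap_subtype, Submodule.finrank_map_subtype_eq]
  rfl

theorem coboundaries_le_cocycles {C : (k : ℕ) → Submodule ℝ (Fun 1 k)} (hC : IsComplex C)
    (k : ℕ) : coboundaries C k ≤ cocycles C k := by
  cases k with
  | zero => exact bot_le
  | succ k =>
    rintro _ ⟨σ, hσ, rfl⟩
    exact hC k σ hσ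

theorem finrank_cohomology_add {C : (k : ℕ) → Submodule ℝ (Fun 1 k)} (hC : IsComplex C) (k : ℕ)
    [FiniteDimensional ℝ (C k)] : Module.finrank ℝ (Cohomology C k) +
      Module.finrank ℝ (coboundaries C k) = Module.finrank ℝ (cocycles C k) := by
  have : FiniteDimensional ℝ (cocycles C k) := Submodule.finiteDimensional_inf_left _ _
  rw [← Submodule.finrank_quotient_add_finrank
    ((coboundaries C k).submoduleOf (cocycles C k)),
    (Submodule.submoduleOfEquivOfLe (coboundaries_le_cocycles hC k)).finrank_eq]

/-- The upper bounds `dims - ranks` for the spaces of cocycles determine all ranks: they bound the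
ranks from below, and `r_(k-1) + r_k ≤ dim C^k` bounds them from above, with equality wherever the
Betti number is expected to vanish. -/
theorem hasTable_of_le {C : (k : ℕ) → Submodule ℝ (Fun 1 k)} (hC : IsComplex C)
    {dims ranks bettis : List ℕ}
    (hdim : ∀ k, FiniteDimensional ℝ (C k) ∧ Module.finrank ℝ (C k) = dims.getD k 0)
    (hle : ∀ k < 11, ranks.getD k 0 ≠ 0 →
      Module.finrank ℝ (cocycles C k) ≤ dims.getD k 0 - ranks.getD k 0)
    (hd : dims.length = 11) (hr : ranks.length = 11) (hb : bettis.length = 11)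
    (h0 : dims.getD 0 0 = 0 ∧ ranks.getD 0 0 = 0 ∧ bettis.getD 0 0 = 0)
    (hsum : ∀ k < 10, dims.getD (k + 1) 0 =
      ranks.getD (k + 1) 0 + ranks.getD k 0 + bettis.getD (k + 1) 0)
    (hlast : ranks.getD 10 0 = 0)
    (hbet : ∀ k < 11, bettis.getD k 0 = 0 ∨ bettis.getD (k + 1) 0 = 0) :
    HasTable C dims ranks bettis := by
  have hout : ∀ {l : List ℕ}, l.length = 11 → ∀ k, 11 ≤ k → l.getD k 0 = 0 := fun hl k hk =>
    List.getD_eq_default _ _ (by omega)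
  set D := fun k => dims.getD k 0 with hD
  set R := fun k => ranks.getD k 0 with hR
  set B := fun k => bettis.getD k 0 with hB
  let r := fun k => Module.finrank ℝ ((C k).map (coboundary 1 k))
  let z := fun k => Module.finrank ℝ (cocycles C k)
  have hfin := fun k => (hdim k).1
  have hrz : ∀ k, r k + z k = D k := fun k => by
    rw [show D k = Module.finrank ℝ (C k) from (hdim k).2.symm]
    exact finrank_map_add_finrank_cocycles k
  have hcoh : ∀ k, Module.finrank ℝ (Cohomology C (k + 1)) + r k = z (k + 1) := fun k =>
    finrank_cohomology_add hC (k + 1)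
  have hlow : ∀ k, R k ≤ r k := fun k => by
    have h1 := hrz k
    by_cases hk : k < 11
    · by_cases h2 : R k = 0
      · omega
      · have h3 : z k ≤ D k - R k := hle k hk h2
        by_cases h4 : R k ≤ D k
        · omega
        · exfalso
          obtain - | k := k
          · exact h2 h0.2.1
          · have h5 : D (k + 1) = R (k + 1) + R k + B (k + 1) := hsum k (by omega)
            omega
    · have : R k = 0 := hout hr k (by omega)
      omega
  have hup : ∀ k, r (k + 1) + r k ≤ R (k + 1) + R k + B (k + 1) := fun k => by
    have h1 := hrz (k + 1)
    have h2 := hcoh k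
    by_cases hk : k < 10
    · have h5 : D (k + 1) = R (k + 1) + R k + B (k + 1) := hsum k (by omega)
      omega
    · have h3 : D (k + 1) = 0 := hout hd _ (by omega)
      omega
  have hbet' : ∀ k, B k = 0 ∨ B (k + 1) = 0 := fun k => by
    by_cases hk : k < 11
    · exact hbet k hk
    · exact Or.inl (hout hb k (by omega))
  have hz0 : r 0 = 0 ∧ z 0 = 0 := by
    have h1 := hrz 0
    have h2 : D 0 = 0 := h0.1
    omega
  have hreq : ∀ k, r k = R k := by
    intro k
    obtain - | k := k
    · rw [hz0.1]
      exact h0.2.1.symm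
    · have h1 := hlow k
      have h2 := hlow (k + 1)
      have h3 := hlow (k + 1 + 1)
      rcases hbet' (k + 1) with h | h
      · have := hup k
        omega
      · have := hup (k + 1)
        omega
  have hsum' : ∀ k, D (k + 1) = R (k + 1) + R k + B (k + 1) := by
    intro k
    by_cases hk : k < 10
    · exact hsum k hk
    · have h1 : D (k + 1) = 0 := hout hd _ (by omega)
      have h2 : R (k + 1) = 0 := hout hr _ (by omega)
      have h3 : B (k + 1) = 0 := hout hb _ (by omega)
      have h4 : R k = 0 := by
        rcases Nat.lt_or_ge 10 k with h | h
        · exact hout hr _ (by omega)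
        · rw [show k = 10 by omega]
          exact hlast
      omega
  refine fun k => ⟨hfin k, (hdim k).2, hreq k, ?_⟩
  obtain - | k := k
  · have h1 := finrank_cohomology_add hC 0
    have h2 : Module.finrank ℝ (cocycles C 0) = 0 := hz0.2
    rw [h0.2.2]
    omega
  · have h1 := hcoh k
    have h2 := hrz (k + 1)
    have h3 := hreq k
    have h4 := hreq (k + 1)
    have h5 := hsum' k
    show _ = B (k + 1)
    omega

theorem finrank_of_dimsFrom {w : ℕ} {l dims : List ℕ} (hw : w ≤ 18) (h2 : w % 2 = 0) (h0 : 2 ≤ w)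
    (hl : dimsFrom fullTable w = l) (hd : l = dims ++ List.replicate 8 0) (k : ℕ) :
    FiniteDimensional ℝ (relCochainsOfWeight 1 w k) ∧
      Module.finrank ℝ (relCochainsOfWeight 1 w k) = dims.getD k 0 := by
  have h := finrank_relCochainsOfWeight_eq k hw h2 h0
  rw [hl, hd] at h
  refine ⟨h.1, h.2.trans ?_⟩
  rcases Nat.lt_or_ge k dims.length with hk | hk
  · exact List.getD_append _ _ _ _ hk
  · rw [List.getD_append_right _ _ _ _ hk, List.getD_eq_default dims 0 hk]
    rcases Nat.lt_or_ge (k - dims.length) 8 with h | h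
    · exact List.getD_replicate _ h
    · exact List.getD_eq_default _ _ (by rwa [List.length_replicate])

theorem hasTable_12 : HasTable (relCochainsOfWeight 1 12)
    [0, 0, 0, 8, 23, 22, 13, 5, 0, 0, 0]
    [0, 0, 0, 8, 14, 8, 5, 0, 0, 0, 0]
    [0, 0, 0, 0, 1, 0, 0, 0, 0, 0, 0] := by
  have h := dimsFrom_fullTable
  simp only [List.map_cons, List.cons.injEq] at h
  have hle : ∀ k < 11, [0, 0, 0, 8, 14, 8, 5, 0, 0, 0, 0].getD k 0 ≠ 0 →
      Module.finrank ℝ (cocycles (relCochainsOfWeight 1 (12 : ℕ)) k) ≤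
        [0, 0, 0, 8, 23, 22, 13, 5, 0, 0, 0].getD k 0 -
          [0, 0, 0, 8, 14, 8, 5, 0, 0, 0, 0].getD k 0
    | 0, _, h => absurd rfl h
    | 1, _, h => absurd rfl h
    | 2, _, h => absurd rfl h
    | 3, _, _ => finrank_cocycles_le check_12_3 (by norm_num) (by norm_num) (by norm_num)
    | 4, _, _ => finrank_cocycles_le check_12_4 (by norm_num) (by norm_num) (by norm_num)
    | 5, _, _ => finrank_cocycles_le check_12_5 (by norm_num) (by norm_num) (by norm_num)
    | 6, _, _ => finrank_cocycles_le check_12_6 (by norm_num) (by norm_num) (by norm_num)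
    | 7, _, h => absurd rfl h
    | 8, _, h => absurd rfl h
    | 9, _, h => absurd rfl h
    | 10, _, h => absurd rfl h
    | k + 11, hk, _ => absurd hk (by omega)
  exact hasTable_of_le (isComplex_relCochainsOfWeight 12)
    (finrank_of_dimsFrom (w := 12) (by norm_num) rfl (by norm_num) h.1 rfl) hle
    rfl rfl rfl (by decide) (by decide) rfl (by decide)

theorem hasTable_14 : HasTable (relCochainsOfWeight 1 14)
    [0, 0, 1, 6, 31, 71, 58, 15, 2, 1, 0]
    [0, 0, 1, 5, 26, 44, 14, 1, 1, 0, 0]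
    [0, 0, 0, 0, 0, 1, 0, 0, 0, 0, 0] := by
  have h := dimsFrom_fullTable
  simp only [List.map_cons, List.cons.injEq] at h
  have hle : ∀ k < 11, [0, 0, 1, 5, 26, 44, 14, 1, 1, 0, 0].getD k 0 ≠ 0 →
      Module.finrank ℝ (cocycles (relCochainsOfWeight 1 (14 : ℕ)) k) ≤
        [0, 0, 1, 6, 31, 71, 58, 15, 2, 1, 0].getD k 0 -
          [0, 0, 1, 5, 26, 44, 14, 1, 1, 0, 0].getD k 0
    | 0, _, h => absurd rfl h
    | 1, _, h => absurd rfl h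
    | 2, _, _ => finrank_cocycles_le check_14_2 (by norm_num) (by norm_num) (by norm_num)
    | 3, _, _ => finrank_cocycles_le check_14_3 (by norm_num) (by norm_num) (by norm_num)
    | 4, _, _ => finrank_cocycles_le check_14_4 (by norm_num) (by norm_num) (by norm_num)
    | 5, _, _ => finrank_cocycles_le check_14_5 (by norm_num) (by norm_num) (by norm_num)
    | 6, _, _ => finrank_cocycles_le check_14_6 (by norm_num) (by norm_num) (by norm_num)
    | 7, _, _ => finrank_cocycles_le check_14_7 (by norm_num) (by norm_num) (by norm_num)
    | 8, _, _ => finrank_cocycles_le check_14_8 (by norm_num) (by norm_num) (by norm_num)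
    | 9, _, h => absurd rfl h
    | 10, _, h => absurd rfl h
    | k + 11, hk, _ => absurd hk (by omega)
  exact hasTable_of_le (isComplex_relCochainsOfWeight 14)
    (finrank_of_dimsFrom (w := 14) (by norm_num) rfl (by norm_num) h.2.1 rfl) hle
    rfl rfl rfl (by decide) (by decide) rfl (by decide)

theorem hasTable_16 : HasTable (relCochainsOfWeight 1 16)
    [0, 0, 0, 12, 61, 126, 147, 95, 24, 0, 0]
    [0, 0, 0, 12, 49, 77, 70, 24, 0, 0, 0]
    [0, 0, 0, 0, 0, 0, 0, 1, 0, 0, 0] := by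
  have h := dimsFrom_fullTable
  simp only [List.map_cons, List.cons.injEq] at h
  have hle : ∀ k < 11, [0, 0, 0, 12, 49, 77, 70, 24, 0, 0, 0].getD k 0 ≠ 0 →
      Module.finrank ℝ (cocycles (relCochainsOfWeight 1 (16 : ℕ)) k) ≤
        [0, 0, 0, 12, 61, 126, 147, 95, 24, 0, 0].getD k 0 -
          [0, 0, 0, 12, 49, 77, 70, 24, 0, 0, 0].getD k 0
    | 0, _, h => absurd rfl h
    | 1, _, h => absurd rfl h
    | 2, _, h => absurd rfl h
    | 3, _, _ => finrank_cocycles_le check_16_3 (by norm_num) (by norm_num) (by norm_num)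
    | 4, _, _ => finrank_cocycles_le check_16_4 (by norm_num) (by norm_num) (by norm_num)
    | 5, _, _ => finrank_cocycles_le check_16_5 (by norm_num) (by norm_num) (by norm_num)
    | 6, _, _ => finrank_cocycles_le check_16_6 (by norm_num) (by norm_num) (by norm_num)
    | 7, _, _ => finrank_cocycles_le check_16_7 (by norm_num) (by norm_num) (by norm_num)
    | 8, _, h => absurd rfl h
    | 9, _, h => absurd rfl h
    | 10, _, h => absurd rfl h
    | k + 11, hk, _ => absurd hk (by omega)
  exact hasTable_of_le (isComplex_relCochainsOfWeight 16)
    (finrank_of_dimsFrom (w := 16) (by norm_num) rfl (by norm_num) h.2.2.1 rfl) hle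
    rfl rfl rfl (by decide) (by decide) rfl (by decide)

theorem hasTable_18 : HasTable (relCochainsOfWeight 1 18)
    [0, 0, 1, 10, 80, 262, 380, 268, 100, 21, 1]
    [0, 0, 1, 9, 71, 191, 188, 80, 20, 1, 0]
    [0, 0, 0, 0, 0, 0, 1, 0, 0, 0, 0] := by
  have h := dimsFrom_fullTable
  simp only [List.map_cons, List.cons.injEq] at h
  have hle : ∀ k < 11, [0, 0, 1, 9, 71, 191, 188, 80, 20, 1, 0].getD k 0 ≠ 0 →
      Module.finrank ℝ (cocycles (relCochainsOfWeight 1 (18 : ℕ)) k) ≤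
        [0, 0, 1, 10, 80, 262, 380, 268, 100, 21, 1].getD k 0 -
          [0, 0, 1, 9, 71, 191, 188, 80, 20, 1, 0].getD k 0
    | 0, _, h => absurd rfl h
    | 1, _, h => absurd rfl h
    | 2, _, _ => finrank_cocycles_le check_18_2 (by norm_num) (by norm_num) (by norm_num)
    | 3, _, _ => finrank_cocycles_le check_18_3 (by norm_num) (by norm_num) (by norm_num)
    | 4, _, _ => finrank_cocycles_le check_18_4 (by norm_num) (by norm_num) (by norm_num)
    | 5, _, _ => finrank_cocycles_le check_18_5 (by norm_num) (by norm_num) (by norm_num)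
    | 6, _, _ => finrank_cocycles_le check_18_6 (by norm_num) (by norm_num) (by norm_num)
    | 7, _, _ => finrank_cocycles_le check_18_7 (by norm_num) (by norm_num) (by norm_num)
    | 8, _, _ => finrank_cocycles_le check_18_8 (by norm_num) (by norm_num) (by norm_num)
    | 9, _, _ => finrank_cocycles_le check_18_9 (by norm_num) (by norm_num) (by norm_num)
    | 10, _, h => absurd rfl h
    | k + 11, hk, _ => absurd hk (by omega)
  exact hasTable_of_le (isComplex_relCochainsOfWeight 18)
    (finrank_of_dimsFrom (w := 18) (by norm_num) rfl (by norm_num) h.2.2.2.1 rfl) hle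
    rfl rfl rfl (by decide) (by decide) rfl (by decide)

end

end GKF

theorem mainTheorem1 :
    (GKF.IsComplex (GKF.relCochains 1) ∧
      Module.finrank ℝ (GKF.Cohomology (GKF.relCochains 1) 0) = 1) ∧
    (∀ w : ℤ, GKF.IsComplex (GKF.relCochainsOfWeight 1 w)) ∧
    GKF.HasTable (GKF.relCochainsOfWeight 1 12)
      [0, 0, 0, 8, 23, 22, 13, 5, 0, 0, 0]
      [0, 0, 0, 8, 14, 8, 5, 0, 0, 0, 0]
      [0, 0, 0, 0, 1, 0, 0, 0, 0, 0, 0] ∧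
    GKF.HasTable (GKF.relCochainsOfWeight 1 14)
      [0, 0, 1, 6, 31, 71, 58, 15, 2, 1, 0]
      [0, 0, 1, 5, 26, 44, 14, 1, 1, 0, 0]
      [0, 0, 0, 0, 0, 1, 0, 0, 0, 0, 0] ∧
    GKF.HasTable (GKF.relCochainsOfWeight 1 16)
      [0, 0, 0, 12, 61, 126, 147, 95, 24, 0, 0]
      [0, 0, 0, 12, 49, 77, 70, 24, 0, 0, 0]
      [0, 0, 0, 0, 0, 0, 0, 1, 0, 0, 0] ∧
    GKF.HasTable (GKF.relCochainsOfWeight 1 18)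
      [0, 0, 1, 10, 80, 262, 380, 268, 100, 21, 1]
      [0, 0, 1, 9, 71, 191, 188, 80, 20, 1, 0]
      [0, 0, 0, 0, 0, 0, 1, 0, 0, 0, 0] :=
  ⟨⟨GKF.isComplex_relCochains, GKF.finrank_cohomology_zero⟩, GKF.isComplex_relCochainsOfWeight,
    GKF.hasTable_12, GKF.hasTable_14, GKF.hasTable_16, GKF.hasTable_18⟩
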